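/- **Foliated linearization theorem.** Let $M$ be a finite-dimensional $C^\infty$ manifold (Hausdorff, second countable, possibly non-compact, possibly with boundary), let $\mathcal F$ be a partition of $M$ (its elements are called leaves), and let $B\subset M$ be an $\mathcal F$-saturated (i.e. a union of leaves) proper submanifold, whose components may have distinct dimensions. Let $p:E\to B$ be a regular neighborhood of $B$, i.e. $E$ is an open neighborhood of $B$ in $M$ and $p$ is a $C^\infty$ retraction endowed with the structure of a smooth vector bundle with zero section $B$; for $x\in E$ and $t\in\mathbb R$ let $tx$ denote the multiplication by scalars in the fibers. Suppose that there exists a compact neighborhood $U\subset E$ of $B$ such that (a) $U$ is $\mathcal F$-homogeneous: if $x,y\in U$ and $\tau>0$ are such that $\tau x,\tau y\in U$ and $x,y$ belong to the same leaf, then $\tau x,\tau y$ belong to the same leaf; (b) $U\cap(\overline{\omega}\setminus\omega)\subset B$ for each leaf $\omega\in\mathcal F$. Let $\mathcal D$ be the group of all $C^\infty$ diffeomorphisms $h$ of $M$ with $h(\omega)\subset\omega$ for every $\omega\in\mathcal F$ and $h(B)=B$, and let $\mathcal D_{\mathrm{fix}}\subset\mathcal D$ be the subgroup of those $h$ that are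 fixed on $B$. Let $\mathcal D^{\mathrm{lin}}\subset\mathcal D$ be the subgroup of those $h$ that coincide on some open neighborhood of $B$ in $E$ with a $C^\infty$ vector bundle isomorphism $\hat h:E\to E$ (not necessarily over $\mathrm{id}_B$), and let $\mathcal D^{\mathrm{lin}}_{\mathrm{fix}}=\mathcal D_{\mathrm{fix}}\cap\mathcal D^{\mathrm{lin}}$. Then the inclusion of pairs $$\bigl(\mathcal D^{\mathrm{lin}}_{\mathrm{fix}},\ \mathcal D^{\mathrm{lin}}\bigr)\subset\bigl(\mathcal D_{\mathrm{fix}},\ \mathcal D\bigr)$$ is a homotopy equivalence of pairs when all groups carry the topology induced from the weak Whitney topology $W^\infty$ on $C^\infty(M,M)$, and also when all groups carry the topology induced from the strong Whitney topology $S^\infty$ on $C^\infty(M,M)$. -/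

import Mathlib

open Set Topology
open scoped Manifold ContDiff

universe u

/-! ### Manifolds with (possibly empty) boundary -/

/-- `I` models manifolds without boundary (its range is the whole vector space) or manifolds with
boundary (its range is a closed half-space); corners are not allowed. -/
def IsHalfSpaceModel {V : Type*} [NormedAddCommGroup V] [NormedSpace ℝ V]
    {H : Type*} [TopologicalSpace H] (I : ModelWithCorners ℝ V H) : Prop :=
  range I = univ ∨ ∃ l : V →L[ℝ] ℝ, l ≠ 0 ∧ range I = {v | 0 ≤ l v}

/-! ### The Whitney topologies on the space of smooth maps -/

section Whitney

variable {V : Type*} [NormedAddCommGroup V] [NormedSpace ℝ V]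
  {H : Type*} [TopologicalSpace H] (I : ModelWithCorners ℝ V H)
  {V' : Type*} [NormedAddCommGroup V'] [NormedSpace ℝ V']
  {H' : Type*} [TopologicalSpace H'] (J : ModelWithCorners ℝ V' H')
  (A : Type u) [TopologicalSpace A] [ChartedSpace H A]
  (B : Type*) [TopologicalSpace B] [ChartedSpace H' B]

/-- The data of a basic Whitney neighbourhood of the smooth map `f`, indexed by `ι`: smooth charts
`src i` of `A` and `tgt i` of `B`, compact sets `K i` lying in the domain of `src i` and mapped
by `f` to the domain of `tgt i`, and numbers `ε i > 0`. -/
structure WhitneyData (ι : Type u) (f : C^∞⟮I, A; J, B⟯) where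
  src : ι → OpenPartialHomeomorph A H
  tgt : ι → OpenPartialHomeomorph B H'
  K : ι → Set A
  ε : ι → ℝ
  src_mem : ∀ i, src i ∈ IsManifold.maximalAtlas I ∞ A
  tgt_mem : ∀ i, tgt i ∈ IsManifold.maximalAtlas J ∞ B
  isCompact_K : ∀ i, IsCompact (K i)
  K_subset : ∀ i, K i ⊆ (src i).source
  mapsTo_K : ∀ i, MapsTo f (K i) (tgt i).source
  ε_pos : ∀ i, 0 < ε i

variable {I J A B}

/-- The `C^r` basic neighbourhood of `f`: all smooth `g` such that, for each `i`, `g` maps `K i` to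
the domain of `tgt i`, and all derivatives of orders `0, …, r` of the local representatives of `f`
and `g` in the charts `src i`, `tgt i` differ by less than `ε i` at the points of `K i`. -/
def WhitneyData.nhd {ι : Type u} {f : C^∞⟮I, A; J, B⟯} (D : WhitneyData I J A B ι f) (r : ℕ) :
    Set C^∞⟮I, A; J, B⟯ :=
  {g | ∀ i, ∀ x ∈ D.K i, g x ∈ (D.tgt i).source ∧ ∀ k ≤ r,
    ‖iteratedFDerivWithin ℝ k
        ((D.tgt i).extend J ∘ g ∘ ((D.src i).extend I).symm) (range I) ((D.src i).extend I x)
      - iteratedFDerivWithin ℝ k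
        ((D.tgt i).extend J ∘ f ∘ ((D.src i).extend I).symm) (range I) ((D.src i).extend I x)‖
      < D.ε i}

variable (I J A B)

/-- The weak Whitney topology `W^∞` (the `C^∞` compact-open topology) on smooth maps: it is
generated by the basic `C^r` neighbourhoods, `r < ∞`, given by a single compact set. -/
@[reducible] noncomputable def weakWhitney : TopologicalSpace C^∞⟮I, A; J, B⟯ :=
  TopologicalSpace.generateFrom
    {S | ∃ (r : ℕ) (f : C^∞⟮I, A; J, B⟯) (D : WhitneyData I J A B PUnit f), S = D.nhd r}

/-- The strong Whitney topology `S^∞` on smooth maps: it is generated by the basic `C^r`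
neighbourhoods, `r < ∞`, given by locally finite families of compact sets. -/
@[reducible] noncomputable def strongWhitney : TopologicalSpace C^∞⟮I, A; J, B⟯ :=
  TopologicalSpace.generateFrom
    {S | ∃ (r : ℕ) (ι : Type u) (f : C^∞⟮I, A; J, B⟯) (D : WhitneyData I J A B ι f),
      LocallyFinite D.K ∧ S = D.nhd r}

end Whitney

/-! ### Homotopy equivalences of pairs -/

/-- The map `f : (X, X₀) → (Y, Y₀)` of pairs is a homotopy equivalence of pairs. -/
def IsPairHomotopyEquiv {X Y : Type*} [TopologicalSpace X] [TopologicalSpace Y]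
    (X₀ : Set X) (Y₀ : Set Y) (f : C(X, Y)) : Prop :=
  MapsTo f X₀ Y₀ ∧ ∃ g : C(Y, X), MapsTo g Y₀ X₀ ∧
    (g.comp f).HomotopicWith (ContinuousMap.id X) (fun u => MapsTo u X₀ X₀) ∧
    (f.comp g).HomotopicWith (ContinuousMap.id Y) (fun u => MapsTo u Y₀ Y₀)

/-- For subsets `X₀ ⊆ X` and `Y₀ ⊆ Y` of `Z` with `X ⊆ Y`, all with the topology induced from the
topology `t` on `Z`: the inclusion of pairs `(X₀, X) ⊆ (Y₀, Y)` is a homotopy equivalence. -/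
def InclusionIsPairHomotopyEquiv {Z : Type*} (t : TopologicalSpace Z) {X Y : Set Z} (hXY : X ⊆ Y)
    (X₀ Y₀ : Set Z) : Prop :=
  letI : TopologicalSpace Z := t
  IsPairHomotopyEquiv ((↑) ⁻¹' X₀ : Set X) ((↑) ⁻¹' Y₀ : Set Y) (ContinuousMap.inclusion hXY)

/-! ### Regular neighbourhoods -/

/-- The model of `k`-dimensional manifolds with boundary: the closed half-space `x₀ ≥ 0` of `ℝ^k`
for `k ≥ 1`, and the point `ℝ^0` for `k = 0`. -/
def stdHalfSpace (k : ℕ) : Set (EuclideanSpace ℝ (Fin k)) :=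
  {x | ∀ i : Fin k, (i : ℕ) = 0 → 0 ≤ x i}

section RegularNeighborhood

variable {V : Type*} [NormedAddCommGroup V] [NormedSpace ℝ V]
  {H : Type*} [TopologicalSpace H] (I : ModelWithCorners ℝ V H)
  {M : Type*} [TopologicalSpace M] [ChartedSpace H M]

/-- A trivialized local chart, with base of dimension `k` and fibre `ℝ^m`, of the vector bundle with
total space the open set `E ⊆ M`, projection `proj`, and fibrewise operations `smul` and `add`:
a diffeomorphism `e` between the (open) part of `E` over an open subset of the base and `O × ℝ^m`,
where `O` is a relatively open subset of the half-space, which carries the zero section to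
`O × 0`, the projection to `(u, v) ↦ (u, 0)`, and is linear on the fibres. -/
structure TrivializedChart (E : Set M) (proj : M → M) (smul : ℝ → M → M) (add : M → M → M)
    (k m : ℕ) where
  e : PartialEquiv M (EuclideanSpace ℝ (Fin k) × EuclideanSpace ℝ (Fin m))
  O : Set (EuclideanSpace ℝ (Fin k))
  /-- `O` is relatively open in the half-space -/
  exists_open : ∃ W, IsOpen W ∧ O = W ∩ stdHalfSpace k
  target_eq : e.target = O ×ˢ univ
  isOpen_source : IsOpen e.source
  source_subset : e.source ⊆ E
  /-- the source consists of whole fibres -/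
  saturated : ∀ x ∈ E, proj x ∈ e.source → x ∈ e.source
  contMDiffOn_toFun :
    ContMDiffOn I 𝓘(ℝ, EuclideanSpace ℝ (Fin k) × EuclideanSpace ℝ (Fin m)) ∞ e e.source
  contMDiffOn_invFun :
    ContMDiffOn 𝓘(ℝ, EuclideanSpace ℝ (Fin k) × EuclideanSpace ℝ (Fin m)) I ∞ e.symm e.target
  proj_symm : ∀ u ∈ O, ∀ v, proj (e.symm (u, v)) = e.symm (u, 0)
  smul_symm : ∀ u ∈ O, ∀ (t : ℝ) v, smul t (e.symm (u, v)) = e.symm (u, t • v)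
  add_symm : ∀ u ∈ O, ∀ v w, add (e.symm (u, v)) (e.symm (u, w)) = e.symm (u, v + w)

/-- A regular neighbourhood of `B` in the manifold `M`: an open neighbourhood `total` of `B`
together with a retraction `proj : total → B` and the structure of a smooth vector bundle on it,
whose zero section is `B`.

The fibre over `b ∈ B` is the set of `x ∈ total` with `proj x = b`; `smul` is the multiplication by
scalars and `add` the addition of two points of the same fibre (the values of `proj`, `smul`,
`add` at other arguments are irrelevant). The vector space axioms and the smoothness of the
operations follow from the existence of trivialized charts. The dimension of the base and the rank
may vary from one component of `B` to another.

Every such `B` is a proper smooth submanifold of `M`: a trivialized chart around `b ∈ B` is a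
submanifold chart, and it shows that `B` meets the boundary of `M` transversally,
exactly in the boundary of `B`. -/
structure RegularNeighborhood (B : Set M) where
  total : Set M
  proj : M → M
  smul : ℝ → M → M
  add : M → M → M
  isOpen_total : IsOpen total
  base_subset : B ⊆ total
  proj_mem : ∀ x ∈ total, proj x ∈ B
  proj_base : ∀ b ∈ B, proj b = b
  exists_chart : ∀ b ∈ B, ∃ (k m : ℕ) (c : TrivializedChart I total proj smul add k m),
    b ∈ c.e.source

variable {I}

/-- `g` (restricted to the total space) is a smooth vector bundle isomorphism of the regular
neighbourhood onto itself, over an arbitrary diffeomorphism of the base. -/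
structure RegularNeighborhood.IsAut {B : Set M} (N : RegularNeighborhood I B) (g : M → M) :
    Prop where
  contMDiffOn : ContMDiffOn I I ∞ g N.total
  mapsTo : MapsTo g N.total N.total
  /-- fibres go to fibres -/
  map_proj : ∀ x ∈ N.total, N.proj (g x) = g (N.proj x)
  map_smul : ∀ (t : ℝ), ∀ x ∈ N.total, g (N.smul t x) = N.smul t (g x)
  map_add : ∀ x ∈ N.total, ∀ y ∈ N.total, N.proj x = N.proj y →
    g (N.add x y) = N.add (g x) (g y)
  exists_inverse : ∃ g' : M → M, ContMDiffOn I I ∞ g' N.total ∧ MapsTo g' N.total N.total ∧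
    InvOn g' g N.total N.total

/-! ### Groups of diffeomorphisms -/

variable (I) in
/-- Diffeomorphisms of `M` leaving `B` invariant. -/
def diffInv (B : Set M) : Set (M ≃ₘ⟮I, I⟯ M) := {h | h '' B = B}

variable (I) in
/-- Diffeomorphisms of `M` fixed on `B`. -/
def diffFix (B : Set M) : Set (M ≃ₘ⟮I, I⟯ M) := {h | h ∈ diffInv I B ∧ ∀ b ∈ B, h b = b}

/-- Diffeomorphisms of `M` leaving `B` invariant and coinciding with a vector bundle isomorphism of
the regular neighbourhood on some open neighbourhood of `B`. -/
def diffInvLin {B : Set M} (N : RegularNeighborhood I B) : Set (M ≃ₘ⟮I, I⟯ M) :=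
  {h | h ∈ diffInv I B ∧ ∃ g, N.IsAut g ∧ ∃ W, IsOpen W ∧ B ⊆ W ∧ W ⊆ N.total ∧ EqOn h g W}

/-- Diffeomorphisms fixed on `B` and linear near `B`. -/
def diffFixLin {B : Set M} (N : RegularNeighborhood I B) : Set (M ≃ₘ⟮I, I⟯ M) :=
  diffFix I B ∩ diffInvLin N

variable (I) in
/-- Diffeomorphisms of `M` preserving every leaf of the partition `F`. -/
def diffLP (F : Set (Set M)) : Set (M ≃ₘ⟮I, I⟯ M) := {h | ∀ L ∈ F, h '' L ⊆ L}

theorem diffLP_inter_lin_subset {B : Set M} (N : RegularNeighborhood I B) (F : Set (Set M)) :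
    diffLP I F ∩ diffInvLin N ⊆ diffLP I F ∩ diffInv I B :=
  fun _ h => ⟨h.1, h.2.1⟩

variable (I M) in
/-- The topology `W^∞` on the diffeomorphisms of `M`, as a subspace of the smooth maps `M → M`. -/
@[reducible] noncomputable def weakDiff : TopologicalSpace (M ≃ₘ⟮I, I⟯ M) :=
  (weakWhitney I I M M).induced Diffeomorph.toContMDiffMap

variable (I M) in
/-- The topology `S^∞` on the diffeomorphisms of `M`, as a subspace of the smooth maps `M → M`. -/
@[reducible] noncomputable def strongDiff : TopologicalSpace (M ≃ₘ⟮I, I⟯ M) :=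
  (strongWhitney I I M M).induced Diffeomorph.toContMDiffMap

/-! ### Partitions -/

/-- `B` is a union of leaves of `F`. -/
def IsSaturated (F : Set (Set M)) (B : Set M) : Prop := ∃ S ⊆ F, B = ⋃₀ S

/-- The points `x` and `y` lie in the same leaf of `F`. -/
def SameLeaf (F : Set (Set M)) (x y : M) : Prop := ∃ L ∈ F, x ∈ L ∧ y ∈ L

/-- The subset `U` of the regular neighbourhood is `F`-homogeneous. -/
def RegularNeighborhood.IsHomogeneous {B : Set M} (N : RegularNeighborhood I B)
    (F : Set (Set M)) (U : Set M) : Prop :=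
  ∀ x ∈ U, ∀ y ∈ U, ∀ τ : ℝ, 0 < τ → N.smul τ x ∈ U → N.smul τ y ∈ U →
    SameLeaf F x y → SameLeaf F (N.smul τ x) (N.smul τ y)

end RegularNeighborhood

/-!
# Linearization of leaf preserving diffeomorphisms near a saturated submanifold

Let `h` be a diffeomorphism which preserves the base `B` of a regular neighbourhood. Its conjugates
`x ↦ a⁻¹ h (a x)` by the dilations of the fibres converge, as `a` tends to `0`, to a vector bundle
automorphism, and they form with it a smooth family, by division of the fibre coordinate of
`h (a x)` by `a` (`RegularNeighborhood.dil`, `manifoldFamilyAt_dil`, `isAut_dil_zero`). If `h`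
preserves the leaves then so do the conjugates, inside of a small disc bundle: for `a ≠ 0` because
the neighbourhood is homogeneous, and for the limit `a = 0` because a leaf accumulates only at
points of `B` outside of itself, while the limit sends only points of `B` to `B` (`dil_mem_leaf`).

The deformation `straighten` replaces `h x` by `dil h a x`, where the factor `a ∈ [0, 1]` depends
smoothly on `x`, is `1` away from `B` and becomes `0` near `B` at the end. To obtain a
diffeomorphism, `a` is taken to be a given function `damp` of the norm of the *image* `dil h a x`.
This equation for `a` has a unique solution, since near `B` the dependence of that norm on `a` is of the third order
in the distance from `B`, so that the right-hand side is a contraction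
(`abs_deriv_damp_normQuot_le`). The inverse is then explicit: a point `y` is sent to `dil h⁻¹ a y`,
where the factor `a` is known from the norm of `y` (`unstraighten_straighten`,
`straighten_unstraighten`). The sizes of the disc bundles involved depend on one number, the
`distortion` of `h` near `B`, which is continuous in `h` because the unit sphere bundle is compact.

The continuity of the deformation in the Whitney topologies is reduced to jointly continuous
derivatives in local coordinates. A map from a space `T` to the smooth maps is continuous in the
weak topology exactly if it is a smooth family in this sense (`MapFamilyAt`,
`mapFamilyAt_of_continuous_weakWhitney`, `continuous_weakWhitney_of_mapFamilyAt`), and smooth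
families are closed under composition, division by a coordinate (`SmoothFamilyAt.exists_smul_eq`)
and implicit functions (`SmoothFamilyAt.implicit`), for any space of parameters. In the strong
topology the continuity follows, since the deformation is supported in a fixed compact set
(`continuous_strongWhitney_of_weakWhitney`). Finally, a diffeomorphism that is linear near `B` is
equal to its conjugates near `B`, so that it stays linear throughout the deformation.
-/


/-! ### Families of differentiable maps depending continuously on a parameter -/

section Families

open Filter

variable {T T' : Type*} [TopologicalSpace T] [TopologicalSpace T']
  {E : Type*} [NormedAddCommGroup E] [NormedSpace ℝ E]
  {F : Type*} [NormedAddCommGroup F] [NormedSpace ℝ F]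
  {G : Type*} [NormedAddCommGroup G] [NormedSpace ℝ G]

/-- The family `f : T → E → F` is, near the point `p` of `T × s`, of class `C^n` in the variable
from `s`, and its derivatives of orders `0, …, n` are jointly continuous in both variables. -/
def FamilyAt (n : ℕ) (f : T → E → F) (s : Set E) (p : T × E) : Prop :=
  ∀ᶠ q in 𝓝[univ ×ˢ s] p, ContDiffWithinAt ℝ n (f q.1) s q.2 ∧
    ∀ k ≤ n, ContinuousWithinAt (fun z : T × E => iteratedFDerivWithin ℝ k (f z.1) s z.2)
      (univ ×ˢ s) q

/-- The family `f : T → E → F` is smooth in the variable from `s` near the point `p` of `T × s`,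
with jointly continuous derivatives. -/
def SmoothFamilyAt (f : T → E → F) (s : Set E) (p : T × E) : Prop :=
  ∀ n, FamilyAt n f s p

variable {n : ℕ} {f f' : T → E → F} {s : Set E} {t : Set F} {p : T × E}

omit [NormedSpace ℝ E] in
theorem slice_eventually {P : T × E → Prop} {q : T × E} (h : ∀ᶠ z in 𝓝[univ ×ˢ s] q, P z) :
    ∀ᶠ x in 𝓝[s] q.2, P (q.1, x) := by
  have : Tendsto (fun x : E => (q.1, x)) (𝓝[s] q.2) (𝓝[univ ×ˢ s] q) := by
    refine tendsto_nhdsWithin_iff.2 ⟨?_, ?_⟩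
    · exact ((continuous_const.prodMk continuous_id).tendsto' q.2 q rfl).mono_left
        nhdsWithin_le_nhds
    · filter_upwards [self_mem_nhdsWithin] with x hx using ⟨mem_univ _, hx⟩
  exact this.eventually h

theorem continuousWithinAt_iteratedFDerivWithin_zero_iff {q : T × E} :
    ContinuousWithinAt (fun z : T × E => iteratedFDerivWithin ℝ 0 (f z.1) s z.2) (univ ×ˢ s) q ↔
      ContinuousWithinAt (fun z : T × E => f z.1 z.2) (univ ×ˢ s) q := by
  have : (fun z : T × E => iteratedFDerivWithin ℝ 0 (f z.1) s z.2) =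
      (continuousMultilinearCurryFin0 ℝ E F).symm ∘ fun z : T × E => f z.1 z.2 := by
    funext z; rw [iteratedFDerivWithin_zero_eq_comp]; rfl
  rw [this]
  exact
    (continuousMultilinearCurryFin0 ℝ E F).symm.toHomeomorph.isInducing.continuousWithinAt_iff.symm

theorem FamilyAt.eventually_continuousWithinAt (h : FamilyAt n f s p) :
    ∀ᶠ q in 𝓝[univ ×ˢ s] p,
      ContinuousWithinAt (fun z : T × E => f z.1 z.2) (univ ×ˢ s) q :=
  h.mono fun _ hq => continuousWithinAt_iteratedFDerivWithin_zero_iff.1 (hq.2 0 (Nat.zero_le _))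

omit [TopologicalSpace T] [NormedAddCommGroup E] [NormedSpace ℝ E] in
theorem mem_prod_of_mem (hp : p.2 ∈ s) : p ∈ (univ : Set T) ×ˢ s := ⟨mem_univ _, hp⟩

theorem FamilyAt.continuousWithinAt (h : FamilyAt n f s p) (hp : p.2 ∈ s) :
    ContinuousWithinAt (fun z : T × E => f z.1 z.2) (univ ×ˢ s) p :=
  h.eventually_continuousWithinAt.self_of_nhdsWithin (mem_prod_of_mem hp)

theorem FamilyAt.contDiffWithinAt (h : FamilyAt n f s p) (hp : p.2 ∈ s) :
    ContDiffWithinAt ℝ n (f p.1) s p.2 :=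
  (h.self_of_nhdsWithin (mem_prod_of_mem hp)).1

theorem SmoothFamilyAt.contDiffWithinAt (h : SmoothFamilyAt f s p) (hp : p.2 ∈ s) :
    ContDiffWithinAt ℝ ∞ (f p.1) s p.2 :=
  contDiffWithinAt_infty.2 fun n => (h n).contDiffWithinAt hp

theorem SmoothFamilyAt.continuousWithinAt (h : SmoothFamilyAt f s p) (hp : p.2 ∈ s) :
    ContinuousWithinAt (fun z : T × E => f z.1 z.2) (univ ×ˢ s) p :=
  (h 0).continuousWithinAt hp

theorem FamilyAt.congr (h : FamilyAt n f s p)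
    (hf : ∀ᶠ q in 𝓝[univ ×ˢ s] p, f' q.1 q.2 = f q.1 q.2) : FamilyAt n f' s p := by
  filter_upwards [h, eventually_eventually_nhdsWithin.2 hf, self_mem_nhdsWithin]
    with q hq hfq hqs
  refine ⟨hq.1.congr_of_eventuallyEq_of_mem (slice_eventually hfq) hqs.2, fun k hk => ?_⟩
  refine (hq.2 k hk).congr_of_eventuallyEq_of_mem ?_ hqs
  filter_upwards [eventually_eventually_nhdsWithin.2 hfq, self_mem_nhdsWithin] with z hz hzs
  exact Filter.EventuallyEq.iteratedFDerivWithin_eq (f₁ := f' z.1) (f := f z.1)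
    (slice_eventually hz) (hz.self_of_nhdsWithin hzs) k

theorem SmoothFamilyAt.congr (h : SmoothFamilyAt f s p)
    (hf : ∀ᶠ q in 𝓝[univ ×ˢ s] p, f' q.1 q.2 = f q.1 q.2) : SmoothFamilyAt f' s p :=
  fun n => (h n).congr hf

/-- The iterated derivatives of a composition depend continuously on those of the two maps. -/
theorem continuousWithinAt_taylorComp {X : Type*} [TopologicalSpace X]
    {a : X → FormalMultilinearSeries ℝ F G} {b : X → FormalMultilinearSeries ℝ E F}
    {S : Set X} {x : X} {k : ℕ} (ha : ∀ j ≤ k, ContinuousWithinAt (fun z => a z j) S x)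
    (hb : ∀ j ≤ k, ContinuousWithinAt (fun z => b z j) S x) :
    ContinuousWithinAt (fun z => (a z).taylorComp (b z) k) S x := by
  unfold FormalMultilinearSeries.taylorComp
  refine tendsto_finsetSum _ fun c _ => ?_
  let L := c.compAlongOrderedFinpartitionL ℝ E F G
  have hL : Continuous fun z : (F [×c.length]→L[ℝ] G) × (∀ i, E [×c.partSize i]→L[ℝ] F) =>
      L z.1 z.2 := by
    rw [← continuousOn_univ]
    exact (L.analyticOnNhd_uncurry_of_multilinear (s := univ)).continuousOn
  exact (hL.tendsto _).comp
    ((ha _ c.length_le).prodMk_nhds (tendsto_pi_nhds.2 fun i => hb _ (c.partSize_le i)))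

theorem FamilyAt.tendsto_prodMk (h : FamilyAt n f s p)
    (hst : ∀ᶠ q in 𝓝[univ ×ˢ s] p, f q.1 q.2 ∈ t) :
    ∀ᶠ q in 𝓝[univ ×ˢ s] p, Tendsto (fun z : T × E => (z.1, f z.1 z.2)) (𝓝[univ ×ˢ s] q)
      (𝓝[univ ×ˢ t] (q.1, f q.1 q.2)) := by
  filter_upwards [h.eventually_continuousWithinAt, eventually_eventually_nhdsWithin.2 hst]
    with q hq hqt
  refine tendsto_nhdsWithin_iff.2 ⟨?_, hqt.mono fun z hz => ⟨mem_univ _, hz⟩⟩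
  exact (continuous_fst.continuousWithinAt).prodMk hq

/-- Composition of families. -/
theorem FamilyAt.comp {g : T → F → G} (hg : FamilyAt n g t (p.1, f p.1 p.2))
    (hf : FamilyAt n f s p) (hs : UniqueDiffOn ℝ s) (ht : UniqueDiffOn ℝ t) (hp : p.2 ∈ s)
    (hst : ∀ᶠ q in 𝓝[univ ×ˢ s] p, f q.1 q.2 ∈ t) :
    FamilyAt n (fun τ x => g τ (f τ x)) s p := by
  have h1 := hf.tendsto_prodMk hst
  have h2 := (h1.self_of_nhdsWithin (mem_prod_of_mem hp)).eventually hg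
  filter_upwards [hf, h1, eventually_eventually_nhdsWithin.2 hst, self_mem_nhdsWithin,
    eventually_eventually_nhdsWithin.2 hf, eventually_eventually_nhdsWithin.2 h2, h2]
    with q hfq hq hqt hqs hfq' hgq' hgq
  refine ⟨ContDiffWithinAt.comp_of_preimage_mem_nhdsWithin q.2 hgq.1 hfq.1 (slice_eventually hqt),
    fun k hk => ?_⟩
  have key : ContinuousWithinAt (fun z : T × E =>
      (ftaylorSeriesWithin ℝ (g z.1) t (f z.1 z.2)).taylorComp
        (ftaylorSeriesWithin ℝ (f z.1) s z.2) k) (univ ×ˢ s) q := by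
    refine continuousWithinAt_taylorComp (fun j hj => ?_) (fun j hj => hfq.2 j (hj.trans hk))
    exact (hgq.2 j (hj.trans hk)).tendsto.comp hq
  refine key.congr_of_eventuallyEq_of_mem ?_ hqs
  filter_upwards [hfq', hgq', eventually_eventually_nhdsWithin.2 hqt, self_mem_nhdsWithin]
    with z hz hgz hzt hzs
  exact iteratedFDerivWithin_comp_of_eventually_mem hgz.1 hz.1 ht hs hzs.2 (slice_eventually hzt)
    (by exact_mod_cast hk)

theorem SmoothFamilyAt.comp {g : T → F → G} (hg : SmoothFamilyAt g t (p.1, f p.1 p.2))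
    (hf : SmoothFamilyAt f s p) (hs : UniqueDiffOn ℝ s) (ht : UniqueDiffOn ℝ t) (hp : p.2 ∈ s)
    (hst : ∀ᶠ q in 𝓝[univ ×ˢ s] p, f q.1 q.2 ∈ t) :
    SmoothFamilyAt (fun τ x => g τ (f τ x)) s p :=
  fun n => (hg n).comp (hf n) hs ht hp hst

/-- Reparametrization of a family. -/
theorem FamilyAt.comp_param {θ : T' → T} {x : E} {τ : T'} (hf : FamilyAt n f s (θ τ, x))
    (hθ : Continuous θ) : FamilyAt n (fun σ => f (θ σ)) s (τ, x) := by
  have h1 : ∀ q : T' × E, Tendsto (fun z : T' × E => (θ z.1, z.2)) (𝓝[univ ×ˢ s] q)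
      (𝓝[univ ×ˢ s] (θ q.1, q.2)) := fun q => by
    refine tendsto_nhdsWithin_iff.2 ⟨?_, ?_⟩
    · exact ((hθ.comp continuous_fst).prodMk continuous_snd).continuousWithinAt
    · filter_upwards [self_mem_nhdsWithin] with z hz using ⟨mem_univ _, hz.2⟩
  filter_upwards [(h1 _).eventually hf] with q hq
  exact ⟨hq.1, fun k hk => (hq.2 k hk).tendsto.comp (h1 q)⟩

theorem SmoothFamilyAt.comp_param {θ : T' → T} {x : E} {τ : T'}
    (hf : SmoothFamilyAt f s (θ τ, x)) (hθ : Continuous θ) :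
    SmoothFamilyAt (fun σ => f (θ σ)) s (τ, x) :=
  fun n => (hf n).comp_param hθ

/-- A single smooth map is a constant family. -/
theorem smoothFamilyAt_const {g : E → F} (hg : ContDiffWithinAt ℝ ∞ g s p.2)
    (hs : UniqueDiffOn ℝ s) (hp : p.2 ∈ s) : SmoothFamilyAt (fun _ : T => g) s p := by
  intro n
  have hgn : ContDiffWithinAt ℝ n g s p.2 := hg.of_le (by exact_mod_cast le_top)
  obtain ⟨u, hu, -, hgu⟩ := hgn.contDiffOn le_rfl (by simp)
  rw [insert_eq_of_mem hp] at hu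
  obtain ⟨o, ho, hpo, hou⟩ := mem_nhdsWithin.1 hu
  have hso : UniqueDiffOn ℝ (s ∩ o) := hs.inter ho
  have hgo : ContDiffOn ℝ n g (s ∩ o) := hgu.mono (by rw [inter_comm]; exact hou)
  have hmem : ∀ᶠ q : T × E in 𝓝[univ ×ˢ s] p, q.2 ∈ o :=
    mem_nhdsWithin_of_mem_nhds (continuous_snd.continuousAt.preimage_mem_nhds (ho.mem_nhds hpo))
  filter_upwards [hmem, self_mem_nhdsWithin] with q hq hqs
  refine ⟨(hgo q.2 ⟨hqs.2, hq⟩).mono_of_mem_nhdsWithin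
    (inter_mem self_mem_nhdsWithin (mem_nhdsWithin_of_mem_nhds (ho.mem_nhds hq))), fun k hk => ?_⟩
  have h1 : ContinuousWithinAt (iteratedFDerivWithin ℝ k g s) s q.2 := by
    have := (hgo.continuousOn_iteratedFDerivWithin (m := k) (by exact_mod_cast hk) hso) q.2
      ⟨hqs.2, hq⟩
    have h2 := this.mono_of_mem_nhdsWithin (s := s)
      (inter_mem self_mem_nhdsWithin (mem_nhdsWithin_of_mem_nhds (ho.mem_nhds hq)))
    refine h2.congr_of_eventuallyEq_of_mem ?_ hqs.2
    filter_upwards [mem_nhdsWithin_of_mem_nhds (ho.mem_nhds hq)] with z hz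
    exact (iteratedFDerivWithin_inter_open ho hz).symm
  exact h1.tendsto.comp (tendsto_nhdsWithin_iff.2
    ⟨continuous_snd.continuousWithinAt, by
      filter_upwards [self_mem_nhdsWithin] with z hz using hz.2⟩)

theorem FamilyAt.contDiffAt_comp {g : F → G} (hg : ContDiffAt ℝ ∞ g (f p.1 p.2))
    (hf : FamilyAt n f s p) (hs : UniqueDiffOn ℝ s) (hp : p.2 ∈ s) :
    FamilyAt n (fun τ x => g (f τ x)) s p :=
  (smoothFamilyAt_const (T := T) (s := univ) (p := (p.1, f p.1 p.2)) hg.contDiffWithinAt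
    uniqueDiffOn_univ (mem_univ _) n).comp hf hs uniqueDiffOn_univ hp
    (Eventually.of_forall fun _ => mem_univ _)

theorem SmoothFamilyAt.contDiffAt_comp {g : F → G} (hg : ContDiffAt ℝ ∞ g (f p.1 p.2))
    (hf : SmoothFamilyAt f s p) (hs : UniqueDiffOn ℝ s) (hp : p.2 ∈ s) :
    SmoothFamilyAt (fun τ x => g (f τ x)) s p :=
  fun n => (hf n).contDiffAt_comp hg hs hp

theorem FamilyAt.add (hf : FamilyAt n f s p) (hf' : FamilyAt n f' s p)
    (hs : UniqueDiffOn ℝ s) : FamilyAt n (fun τ x => f τ x + f' τ x) s p := by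
  filter_upwards [hf, hf', eventually_eventually_nhdsWithin.2 hf,
    eventually_eventually_nhdsWithin.2 hf', self_mem_nhdsWithin] with q hq hq' hz hz' hqs
  refine ⟨hq.1.add hq'.1, fun k hk => ?_⟩
  refine ((hq.2 k hk).add (hq'.2 k hk)).congr_of_eventuallyEq_of_mem ?_ hqs
  filter_upwards [hz, hz', self_mem_nhdsWithin] with z h1 h2 hzs
  exact iteratedFDerivWithin_add_apply (h1.1.of_le (by exact_mod_cast hk))
    (h2.1.of_le (by exact_mod_cast hk)) hs hzs.2

theorem FamilyAt.prodMk {g : T → E → G} (hf : FamilyAt n f s p)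
    (hg : FamilyAt n g s p) (hs : UniqueDiffOn ℝ s) (hp : p.2 ∈ s) :
    FamilyAt n (fun τ x => (f τ x, g τ x)) s p := by
  have h1 := hf.contDiffAt_comp (ContinuousLinearMap.inl ℝ F G).contDiff.contDiffAt hs hp
  have h2 := hg.contDiffAt_comp (ContinuousLinearMap.inr ℝ F G).contDiff.contDiffAt hs hp
  refine (h1.add h2 hs).congr (Eventually.of_forall fun q => ?_)
  simp

theorem SmoothFamilyAt.prodMk {g : T → E → G} (hf : SmoothFamilyAt f s p)
    (hg : SmoothFamilyAt g s p) (hs : UniqueDiffOn ℝ s) (hp : p.2 ∈ s) :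
    SmoothFamilyAt (fun τ x => (f τ x, g τ x)) s p :=
  fun n => (hf n).prodMk (hg n) hs hp

theorem smoothFamilyAt_param {c : T → F} (hc : Continuous c) :
    SmoothFamilyAt (fun τ (_ : E) => c τ) s p := by
  intro n
  refine Eventually.of_forall fun q => ⟨contDiffWithinAt_const, fun k _ => ?_⟩
  rcases Nat.eq_zero_or_pos k with rfl | hk
  · exact continuousWithinAt_iteratedFDerivWithin_zero_iff (f := fun τ (_ : E) => c τ).2
      (hc.comp continuous_fst).continuousWithinAt
  · have : (fun z : T × E => iteratedFDerivWithin ℝ k (fun _ : E => c z.1) s z.2) = 0 := by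
      funext z
      rw [iteratedFDerivWithin_const_of_ne hk.ne']
      rfl
    rw [this]
    exact continuousWithinAt_const

theorem smoothFamilyAt_id (hs : UniqueDiffOn ℝ s) (hp : p.2 ∈ s) :
    SmoothFamilyAt (fun (_ : T) (x : E) => x) s p :=
  smoothFamilyAt_const contDiffWithinAt_id hs hp

/-- The derivatives of a family of class `C^(n+1)` form a family of class `C^n`. -/
theorem FamilyAt.fderivWithin (hf : FamilyAt (n + 1) f s p) (hs : UniqueDiffOn ℝ s) :
    FamilyAt n (fun τ x => fderivWithin ℝ (f τ) s x) s p := by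
  filter_upwards [hf, self_mem_nhdsWithin] with q hq hqs
  refine ⟨hq.1.fderivWithin_right hs (by norm_cast) hqs.2, fun k hk => ?_⟩
  have h1 := hq.2 (k + 1) (by omega)
  have h2 : ContinuousWithinAt ((continuousMultilinearCurryRightEquiv' ℝ k E F) ∘
      fun z : T × E => iteratedFDerivWithin ℝ (k + 1) (f z.1) s z.2) (univ ×ˢ s) q :=
    (continuousMultilinearCurryRightEquiv' ℝ k E F).continuous.continuousAt.comp_continuousWithinAt
      h1
  refine h2.congr_of_eventuallyEq_of_mem ?_ hqs
  filter_upwards [self_mem_nhdsWithin] with z hz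
  simp only [Function.comp_apply, iteratedFDerivWithin_succ_eq_comp_right hs hz.2]
  simp

/-- A family whose derivatives form a family of class `C^n` is of class `C^(n+1)`. -/
theorem FamilyAt.succ {D : T → E → E →L[ℝ] F} (h0 : FamilyAt 0 f s p) (hD : FamilyAt n D s p)
    (hfD : ∀ᶠ q in 𝓝[univ ×ˢ s] p, HasFDerivWithinAt (f q.1) (D q.1 q.2) s q.2)
    (hs : UniqueDiffOn ℝ s) : FamilyAt (n + 1) f s p := by
  filter_upwards [h0, hD, eventually_eventually_nhdsWithin.2 hfD, self_mem_nhdsWithin]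
    with q hq hDq hfq hqs
  refine ⟨?_, fun k hk => ?_⟩
  · have : ((n + 1 : ℕ) : WithTop ℕ∞) = (n : WithTop ℕ∞) + 1 := by norm_cast
    rw [this, contDiffWithinAt_succ_iff_hasFDerivWithinAt' (by simp), insert_eq_of_mem hqs.2]
    refine ⟨{x | HasFDerivWithinAt (f q.1) (D q.1 x) s x} ∩ s,
      inter_mem (slice_eventually hfq) self_mem_nhdsWithin, inter_subset_right, by simp,
      D q.1, fun x hx => hx.1, hDq.1⟩
  · rcases k with _ | k
    · exact hq.2 0 le_rfl
    have h1 := hDq.2 k (by omega)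
    have h2 : ContinuousWithinAt ((continuousMultilinearCurryRightEquiv' ℝ k E F).symm ∘
        fun z : T × E => iteratedFDerivWithin ℝ k (D z.1) s z.2) (univ ×ˢ s) q :=
      (continuousMultilinearCurryRightEquiv' ℝ k E F).symm.continuous.continuousAt
        |>.comp_continuousWithinAt h1
    refine h2.congr_of_eventuallyEq_of_mem ?_ hqs
    filter_upwards [self_mem_nhdsWithin, eventually_eventually_nhdsWithin.2 hfq] with z hz hfz
    simp only [Function.comp_apply, iteratedFDerivWithin_succ_eq_comp_right hs hz.2]
    congr 1
    refine Filter.EventuallyEq.iteratedFDerivWithin_eq ?_ ?_ k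
    · filter_upwards [slice_eventually hfz, self_mem_nhdsWithin] with x hx hxs
      exact hx.fderivWithin (hs x hxs)
    · exact (hfz.self_of_nhdsWithin hz).fderivWithin (hs _ hz.2)

theorem FamilyAt.eventually_hasFDerivWithinAt (hf : FamilyAt (n + 1) f s p) :
    ∀ᶠ q in 𝓝[univ ×ˢ s] p, HasFDerivWithinAt (f q.1) (_root_.fderivWithin ℝ (f q.1) s q.2) s q.2 :=
  hf.mono fun q hq => (hq.1.differentiableWithinAt (by norm_cast)).hasFDerivWithinAt

theorem familyAt_zero_iff :
    FamilyAt 0 f s p ↔ ∀ᶠ q in 𝓝[univ ×ˢ s] p,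
      ContinuousWithinAt (fun z : T × E => f z.1 z.2) (univ ×ˢ s) q := by
  refine ⟨FamilyAt.eventually_continuousWithinAt, fun h => ?_⟩
  filter_upwards [h, self_mem_nhdsWithin, eventually_eventually_nhdsWithin.2 h] with q hq hqs hq'
  refine ⟨?_, fun k hk => ?_⟩
  · simp only [CharP.cast_eq_zero]
    rw [contDiffWithinAt_zero hqs.2]
    refine ⟨{x | ContinuousWithinAt (f q.1) s x} ∩ s, inter_mem ?_ self_mem_nhdsWithin, ?_⟩
    · filter_upwards [slice_eventually hq'] with x hx
      refine Tendsto.comp (g := fun z : T × E => f z.1 z.2) (f := fun y => (q.1, y)) hx.tendsto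
        (tendsto_nhdsWithin_iff.2 ⟨?_, ?_⟩)
      · exact (continuous_const.prodMk continuous_id).continuousWithinAt
      · filter_upwards [self_mem_nhdsWithin] with y hy using ⟨mem_univ _, hy⟩
    · intro x hx
      exact (hx.2.1.mono (fun y hy => hy.1))
  · obtain rfl : k = 0 := by omega
    exact continuousWithinAt_iteratedFDerivWithin_zero_iff.2 hq

end Families

/-! ### Hadamard division and implicit functions for families -/

section FamilyCalculus

open Filter

variable {T : Type*} [TopologicalSpace T]
  {E : Type u} [NormedAddCommGroup E] [NormedSpace ℝ E]

omit [NormedSpace ℝ E] in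
theorem eventually_forall_unitInterval {s : Set E} {P : (T × ℝ) × E → Prop} {p : T × E}
    (h : ∀ σ ∈ Icc (0 : ℝ) 1, ∀ᶠ q in 𝓝[univ ×ˢ s] ((p.1, σ), p.2), P q) :
    ∀ᶠ q in 𝓝[univ ×ˢ s] p, ∀ σ ∈ Icc (0 : ℝ) 1, P ((q.1, σ), q.2) := by
  have := (isCompact_Icc (a := (0 : ℝ)) (b := 1)).eventually_forall_of_forall_eventually
    (x₀ := p) (P := fun x σ => x.2 ∈ s → P ((x.1, σ), x.2)) ?_
  · filter_upwards [mem_nhdsWithin_of_mem_nhds this, self_mem_nhdsWithin] with q hq hqs σ hσ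
      using hq σ hσ hqs.2
  · intro σ hσ
    have h1 := eventually_nhdsWithin_iff.1 (h σ hσ)
    have h2 : Tendsto (fun z : (T × E) × ℝ => ((z.1.1, z.2), z.1.2)) (𝓝 (p, σ))
        (𝓝 ((p.1, σ), p.2)) := Continuous.tendsto (by fun_prop) (p, σ)
    filter_upwards [h2.eventually h1] with z hz hzs using hz ⟨mem_univ _, hzs⟩

omit [NormedSpace ℝ E] in
/-- The jointly continuous functions near a segment of parameters have jointly continuous
integrals over it. -/
theorem continuousWithinAt_integral {F : Type*} [NormedAddCommGroup F] [NormedSpace ℝ F]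
    {s : Set E} {ψ : T × ℝ → E → F} {q : T × E} (hqs : q.2 ∈ s)
    (h : ∀ᶠ q' in 𝓝[univ ×ˢ s] q, ∀ σ ∈ Icc (0 : ℝ) 1,
      ContinuousWithinAt (fun w : (T × ℝ) × E => ψ w.1 w.2) (univ ×ˢ s) ((q'.1, σ), q'.2)) :
    ContinuousWithinAt (fun z : T × E => ∫ σ in (0 : ℝ)..1, ψ (z.1, σ) z.2) (univ ×ˢ s) q := by
  have hint : ∀ᶠ q' in 𝓝[univ ×ˢ s] q, IntervalIntegrable (fun σ => ψ (q'.1, σ) q'.2)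
      MeasureTheory.volume 0 1 := by
    filter_upwards [h, self_mem_nhdsWithin] with q' hq' hqs'
    refine ContinuousOn.intervalIntegrable_of_Icc zero_le_one fun σ hσ => ?_
    refine Tendsto.comp (g := fun w : (T × ℝ) × E => ψ w.1 w.2)
      (f := fun σ => ((q'.1, σ), q'.2)) (hq' σ hσ).tendsto (tendsto_nhdsWithin_iff.2 ⟨?_, ?_⟩)
    · exact Continuous.continuousWithinAt (by fun_prop)
    · exact Eventually.of_forall fun _ => ⟨mem_univ _, hqs'.2⟩
  rw [ContinuousWithinAt, Metric.tendsto_nhds]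
  intro ε hε
  have hnear : ∀ᶠ q' in 𝓝[univ ×ˢ s] q, ∀ σ ∈ Icc (0 : ℝ) 1,
      dist (ψ (q'.1, σ) q'.2) (ψ (q.1, σ) q.2) < ε / 2 := by
    refine eventually_forall_unitInterval
      (P := fun w : (T × ℝ) × E => dist (ψ w.1 w.2) (ψ (q.1, w.1.2) q.2) < ε / 2) fun σ hσ => ?_
    have hc := h.self_of_nhdsWithin (mem_prod_of_mem hqs) σ hσ
    have h1 := Metric.tendsto_nhds.1 hc.tendsto (ε / 4) (by positivity)
    have h2 : Tendsto (fun w : (T × ℝ) × E => ((q.1, w.1.2), q.2))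
        (𝓝[univ ×ˢ s] ((q.1, σ), q.2)) (𝓝[univ ×ˢ s] ((q.1, σ), q.2)) := by
      refine tendsto_nhdsWithin_iff.2 ⟨?_, Eventually.of_forall fun _ => ⟨mem_univ _, hqs⟩⟩
      exact Continuous.tendsto' (by fun_prop) _ _ rfl |>.mono_left nhdsWithin_le_nhds
    filter_upwards [h1, h2.eventually h1] with w hw1 hw2
    calc dist (ψ w.1 w.2) (ψ (q.1, w.1.2) q.2)
        ≤ dist (ψ w.1 w.2) (ψ (q.1, σ) q.2) + dist (ψ (q.1, w.1.2) q.2) (ψ (q.1, σ) q.2) :=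
          dist_triangle_right _ _ _
      _ < ε / 4 + ε / 4 := add_lt_add hw1 hw2
      _ = ε / 2 := by ring
  filter_upwards [hnear, hint] with q' hq' hi
  rw [dist_eq_norm, ← intervalIntegral.integral_sub hi
    (hint.self_of_nhdsWithin (mem_prod_of_mem hqs))]
  have := intervalIntegral.norm_integral_le_of_norm_le_const (a := (0 : ℝ)) (b := 1) (C := ε / 2)
    (f := fun σ => ψ (q'.1, σ) q'.2 - ψ (q.1, σ) q.2) (fun σ hσ => by
      rw [← dist_eq_norm]
      rw [uIoc_of_le zero_le_one] at hσ
      exact (hq' σ ⟨hσ.1.le, hσ.2⟩).le)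
  simp only [sub_zero, abs_one, mul_one] at this
  linarith

/-- Integration of a family over an additional parameter in `[0, 1]`. -/
theorem FamilyAt.integral {s : Set E} (hs : UniqueDiffOn ℝ s) (hconv : Convex ℝ s) {p : T × E}
    (n : ℕ) :
    ∀ {F : Type u} [NormedAddCommGroup F] [NormedSpace ℝ F] [CompleteSpace F] {ψ : T × ℝ → E → F},
      (∀ σ ∈ Icc (0 : ℝ) 1, FamilyAt n ψ s ((p.1, σ), p.2)) →
      FamilyAt n (fun τ z => ∫ σ in (0 : ℝ)..1, ψ (τ, σ) z) s p := by
  induction n with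
  | zero =>
    intro F _ _ _ ψ h
    rw [familyAt_zero_iff]
    have h1 := eventually_forall_unitInterval fun σ hσ => (h σ hσ).eventually_continuousWithinAt
    filter_upwards [eventually_eventually_nhdsWithin.2 h1, self_mem_nhdsWithin] with q hq hqs
    exact continuousWithinAt_integral hqs.2 hq
  | succ n ih =>
    intro F _ _ _ ψ h
    let D : T × ℝ → E → E →L[ℝ] F := fun θ z => _root_.fderivWithin ℝ (ψ θ) s z
    have hD : ∀ σ ∈ Icc (0 : ℝ) 1, FamilyAt n D s ((p.1, σ), p.2) :=
      fun σ hσ => (h σ hσ).fderivWithin hs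
    have hint : ∀ {F : Type u} [NormedAddCommGroup F] [NormedSpace ℝ F] {ψ : T × ℝ → E → F}
        {q' : T × E}, q'.2 ∈ s → (∀ σ ∈ Icc (0 : ℝ) 1,
          ContinuousWithinAt (fun w : (T × ℝ) × E => ψ w.1 w.2) (univ ×ˢ s) ((q'.1, σ), q'.2)) →
        IntervalIntegrable (fun σ => ψ (q'.1, σ) q'.2) MeasureTheory.volume 0 1 := by
      intro F _ _ ψ q' hqs' hq'
      refine ContinuousOn.intervalIntegrable_of_Icc zero_le_one fun σ hσ => ?_
      refine Tendsto.comp (g := fun w : (T × ℝ) × E => ψ w.1 w.2)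
        (f := fun σ => ((q'.1, σ), q'.2)) (hq' σ hσ).tendsto (tendsto_nhdsWithin_iff.2 ⟨?_, ?_⟩)
      · exact Continuous.continuousWithinAt (by fun_prop)
      · exact Eventually.of_forall fun _ => ⟨mem_univ _, hqs'⟩
    refine FamilyAt.succ (D := fun τ z => ∫ σ in (0 : ℝ)..1, D (τ, σ) z) ?_ (ih hD) ?_ hs
    · have h1 := eventually_forall_unitInterval fun σ hσ => (h σ hσ).eventually_continuousWithinAt
      rw [familyAt_zero_iff]
      filter_upwards [eventually_eventually_nhdsWithin.2 h1, self_mem_nhdsWithin] with q hq hqs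
      exact continuousWithinAt_integral hqs.2 hq
    have h1 := eventually_forall_unitInterval fun σ hσ => (h σ hσ).eventually_continuousWithinAt
    have h2 := eventually_forall_unitInterval fun σ hσ => (hD σ hσ).eventually_continuousWithinAt
    have h3 := eventually_forall_unitInterval fun σ hσ => (h σ hσ).eventually_hasFDerivWithinAt
    filter_upwards [eventually_eventually_nhdsWithin.2 h1, eventually_eventually_nhdsWithin.2 h2,
      eventually_eventually_nhdsWithin.2 h3, self_mem_nhdsWithin] with q hq1 hq2 hq3 hqs
    rw [hasFDerivWithinAt_iff_isLittleO, Asymptotics.isLittleO_iff]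
    intro ε hε
    have hnear : ∀ᶠ q' in 𝓝[univ ×ˢ s] q, ∀ σ ∈ Icc (0 : ℝ) 1,
        ‖D (q'.1, σ) q'.2 - D (q.1, σ) q.2‖ < ε := by
      refine eventually_forall_unitInterval
        (P := fun w : (T × ℝ) × E => ‖D w.1 w.2 - D (q.1, w.1.2) q.2‖ < ε) fun σ hσ => ?_
      have hc := hq2.self_of_nhdsWithin hqs σ hσ
      have h1 := Metric.tendsto_nhds.1 hc.tendsto (ε / 2) (by positivity)
      have h2 : Tendsto (fun w : (T × ℝ) × E => ((q.1, w.1.2), q.2))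
          (𝓝[univ ×ˢ s] ((q.1, σ), q.2)) (𝓝[univ ×ˢ s] ((q.1, σ), q.2)) := by
        refine tendsto_nhdsWithin_iff.2 ⟨?_, Eventually.of_forall fun _ => ⟨mem_univ _, hqs.2⟩⟩
        exact Continuous.tendsto' (by fun_prop) _ _ rfl |>.mono_left nhdsWithin_le_nhds
      filter_upwards [h1, h2.eventually h1] with w hw1 hw2
      rw [← dist_eq_norm]
      calc dist (D w.1 w.2) (D (q.1, w.1.2) q.2)
          ≤ dist (D w.1 w.2) (D (q.1, σ) q.2) + dist (D (q.1, w.1.2) q.2) (D (q.1, σ) q.2) :=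
            dist_triangle_right _ _ _
        _ < ε / 2 + ε / 2 := add_lt_add hw1 hw2
        _ = ε := by ring
    obtain ⟨r, hr, hball⟩ := Metric.mem_nhdsWithin_iff.1
      (slice_eventually (hnear.and (hq3.and hq1)))
    have hmem : Metric.ball q.2 r ∩ s ∈ 𝓝[s] q.2 :=
      inter_mem (mem_nhdsWithin_of_mem_nhds (Metric.ball_mem_nhds _ hr)) self_mem_nhdsWithin
    have hq0 : q.2 ∈ Metric.ball q.2 r ∩ s := ⟨Metric.mem_ball_self hr, hqs.2⟩
    filter_upwards [hmem] with z hz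
    have hi0 := hint hqs.2 (hball hq0).2.2
    have hi1 := hint (q' := (q.1, z)) hz.2 (hball hz).2.2
    have hiD := hint hqs.2 (hq2.self_of_nhdsWithin hqs)
    have hmv : ∀ σ ∈ Icc (0 : ℝ) 1,
        ‖ψ (q.1, σ) z - ψ (q.1, σ) q.2 - D (q.1, σ) q.2 (z - q.2)‖ ≤ ε * ‖z - q.2‖ := by
      intro σ hσ
      refine Convex.norm_image_sub_le_of_norm_hasFDerivWithin_le' (f' := D (q.1, σ))
        (s := Metric.ball q.2 r ∩ s) (fun x hx => ?_) (fun x hx => ?_)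
        ((convex_ball _ _).inter hconv) hq0 hz
      · exact HasFDerivWithinAt.mono (t := s) ((hball hx).2.1 σ hσ) inter_subset_right
      · exact ((hball hx).1 σ hσ).le
    have happ : (∫ σ in (0 : ℝ)..1, D (q.1, σ) q.2) (z - q.2) =
        ∫ σ in (0 : ℝ)..1, D (q.1, σ) q.2 (z - q.2) :=
      ContinuousLinearMap.intervalIntegral_apply hiD _
    have hiDa : IntervalIntegrable (fun σ => D (q.1, σ) q.2 (z - q.2))
        MeasureTheory.volume 0 1 := by
      have := hiD
      exact ⟨(ContinuousLinearMap.apply ℝ F (z - q.2)).integrable_comp hiD.1,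
        (ContinuousLinearMap.apply ℝ F (z - q.2)).integrable_comp hiD.2⟩
    rw [happ, ← intervalIntegral.integral_sub hi1 hi0,
      ← intervalIntegral.integral_sub (hi1.sub hi0) hiDa]
    have := intervalIntegral.norm_integral_le_of_norm_le_const (a := (0 : ℝ)) (b := 1)
      (C := ε * ‖z - q.2‖)
      (f := fun σ => ψ (q.1, σ) z - ψ (q.1, σ) q.2 - D (q.1, σ) q.2 (z - q.2)) (fun σ hσ => by
        rw [uIoc_of_le zero_le_one] at hσ
        exact hmv σ ⟨hσ.1.le, hσ.2⟩)
    simpa only [sub_zero, abs_one, mul_one] using this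

/-- Division by a coordinate: a family of smooth maps which vanishes where the first coordinate
does is the product of that coordinate and a family of smooth maps. -/
theorem SmoothFamilyAt.exists_smul_eq {F : Type u} [NormedAddCommGroup F] [NormedSpace ℝ F]
    [CompleteSpace F] {f : T → ℝ × E → F} {s : Set E} (hs : UniqueDiffOn ℝ s)
    (hconv : Convex ℝ s) {τ₀ : T} {x₀ : E} (hx₀ : x₀ ∈ s)
    (hf : SmoothFamilyAt f (univ ×ˢ s) (τ₀, ((0 : ℝ), x₀)))
    (h0 : ∀ᶠ q in 𝓝[univ ×ˢ (univ ×ˢ s)] (τ₀, ((0 : ℝ), x₀)), f q.1 (0, q.2.2) = 0) :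
    ∃ g : T → ℝ × E → F, SmoothFamilyAt g (univ ×ˢ s) (τ₀, ((0 : ℝ), x₀)) ∧
      ∀ᶠ q in 𝓝[univ ×ˢ (univ ×ˢ s)] (τ₀, ((0 : ℝ), x₀)), q.2.1 • g q.1 q.2 = f q.1 q.2 := by
  set S : Set (ℝ × E) := univ ×ˢ s with hS
  have hSu : UniqueDiffOn ℝ S := uniqueDiffOn_univ.prod hs
  have hSc : Convex ℝ S := convex_univ.prod hconv
  have hmem : ((0 : ℝ), x₀) ∈ S := ⟨mem_univ _, hx₀⟩
  let c : T × ℝ → ℝ × E → ℝ × E := fun θ z => (θ.2 * z.1, z.2)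
  have hc : ∀ q : (T × ℝ) × (ℝ × E), q.2 ∈ S → SmoothFamilyAt c S q := by
    intro q hq
    have h1 : SmoothFamilyAt (fun (θ : T × ℝ) (_ : ℝ × E) => θ.2) S q :=
      smoothFamilyAt_param continuous_snd
    have h2 : SmoothFamilyAt (fun (_ : T × ℝ) (z : ℝ × E) => z) S q := smoothFamilyAt_id hSu hq
    exact (h1.prodMk h2 hSu hq).contDiffAt_comp
      (g := fun w : ℝ × (ℝ × E) => (w.1 * w.2.1, w.2.2))
      (ContDiff.contDiffAt (by fun_prop)) hSu hq
  have hcS : ∀ (θ : T × ℝ) (z : ℝ × E), z ∈ S → c θ z ∈ S := fun θ z hz => ⟨mem_univ _, hz.2⟩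
  let ψ : T × ℝ → ℝ × E → F := fun θ z => fderivWithin ℝ (f θ.1) S (c θ z) (1, 0)
  have hψ : ∀ σ ∈ Icc (0 : ℝ) 1, SmoothFamilyAt ψ S ((τ₀, σ), ((0 : ℝ), x₀)) := by
    intro σ _
    have h1 : SmoothFamilyAt (fun τ z => fderivWithin ℝ (f τ) S z) S (τ₀, ((0 : ℝ), x₀)) :=
      fun n => (hf (n + 1)).fderivWithin hSu
    have h2 : SmoothFamilyAt (fun (θ : T × ℝ) z => fderivWithin ℝ (f θ.1) S z) S
        ((τ₀, σ), ((0 : ℝ), x₀)) := SmoothFamilyAt.comp_param (T' := T × ℝ) (θ := Prod.fst)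
        (f := fun τ z => fderivWithin ℝ (f τ) S z) h1 continuous_fst
    have h3 : SmoothFamilyAt (fun (θ : T × ℝ) z => fderivWithin ℝ (f θ.1) S (c θ z)) S
        ((τ₀, σ), ((0 : ℝ), x₀)) := by
      refine SmoothFamilyAt.comp (g := fun (θ : T × ℝ) z => fderivWithin ℝ (f θ.1) S z) (f := c)
        (t := S) ?_ (hc _ hmem) hSu hSu hmem ?_
      · simpa [c] using h2
      · filter_upwards [self_mem_nhdsWithin] with q hq using hcS _ _ hq.2
    exact h3.contDiffAt_comp (g := fun A : ℝ × E →L[ℝ] F => A (1, 0))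
      (ContinuousLinearMap.apply ℝ F ((1 : ℝ), (0 : E))).contDiff.contDiffAt hSu hmem
  refine ⟨fun τ z => ∫ σ in (0 : ℝ)..1, ψ (τ, σ) z,
    fun n => FamilyAt.integral hSu hSc n fun σ hσ => hψ σ hσ n, ?_⟩
  have h1 := eventually_forall_unitInterval (p := (τ₀, ((0 : ℝ), x₀)))
    fun σ hσ => (hψ σ hσ 0).eventually_continuousWithinAt
  have h2 := eventually_forall_unitInterval (p := (τ₀, ((0 : ℝ), x₀))) (s := S)
    (P := fun w => HasFDerivWithinAt (f w.1.1) (fderivWithin ℝ (f w.1.1) S (c w.1 w.2)) S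
      (c w.1 w.2)) fun σ hσ => by
      have h := (hf 1).eventually_hasFDerivWithinAt
      have ht : Tendsto (fun w : (T × ℝ) × (ℝ × E) => (w.1.1, c w.1 w.2))
          (𝓝[univ ×ˢ S] ((τ₀, σ), ((0 : ℝ), x₀))) (𝓝[univ ×ˢ S] (τ₀, ((0 : ℝ), x₀))) := by
        refine tendsto_nhdsWithin_iff.2 ⟨?_, ?_⟩
        · refine Tendsto.mono_left (Continuous.tendsto' ?_ _ _ ?_) nhdsWithin_le_nhds
          · simp only [c]; fun_prop
          · simp [c]
        · filter_upwards [self_mem_nhdsWithin] with q hq using ⟨mem_univ _, hcS _ _ hq.2⟩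
      exact ht.eventually h
  filter_upwards [h0, h1, h2, self_mem_nhdsWithin] with q hq0 hq1 hq2 hqs
  obtain ⟨τ, a, x⟩ := q
  have hx : x ∈ s := hqs.2.2
  have hcont : ContinuousOn (fun σ => ψ (τ, σ) (a, x)) (Icc 0 1) := by
    intro σ hσ
    refine Tendsto.comp (g := fun w : (T × ℝ) × (ℝ × E) => ψ w.1 w.2)
      (f := fun σ => ((τ, σ), (a, x))) (hq1 σ hσ).tendsto (tendsto_nhdsWithin_iff.2 ⟨?_, ?_⟩)
    · exact Continuous.continuousWithinAt (by fun_prop)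
    · exact Eventually.of_forall fun _ => ⟨mem_univ _, hqs.2⟩
  have hint : IntervalIntegrable (fun σ => ψ (τ, σ) (a, x)) MeasureTheory.volume 0 1 :=
    hcont.intervalIntegrable_of_Icc zero_le_one
  have hder : ∀ σ ∈ uIcc (0 : ℝ) 1,
      HasDerivAt (fun σ : ℝ => f τ (σ * a, x)) (a • ψ (τ, σ) (a, x)) σ := by
    intro σ hσ
    rw [uIcc_of_le zero_le_one] at hσ
    have h3 : HasDerivAt (fun σ : ℝ => (σ * a, x)) (a, (0 : E)) σ := by
      have := (hasDerivAt_id σ).mul_const a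
      simp only [id_eq, one_mul] at this
      exact this.prodMk (hasDerivAt_const σ x)
    have h4 := HasFDerivWithinAt.comp_hasDerivAt (f := fun σ : ℝ => (σ * a, x)) σ (hq2 σ hσ) h3
      (Eventually.of_forall fun y => ⟨mem_univ _, hx⟩)
    have h5 : a • ψ (τ, σ) (a, x) = fderivWithin ℝ (f τ) S (c (τ, σ) (a, x)) (a, 0) := by
      simp only [ψ]
      rw [← map_smul]
      simp
    rw [h5]
    exact h4
  have := intervalIntegral.integral_eq_sub_of_hasDerivAt hder (hint.smul a)
  rw [intervalIntegral.integral_smul] at this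
  simp only [zero_mul, one_mul] at this
  simp only at hq0
  rw [this, hq0, sub_zero]

/-- The implicit function theorem for a scalar equation `a = Φ (a, x)`, in families, and up to the
boundary of the domain. -/
theorem SmoothFamilyAt.implicit {Φ : T → ℝ × E → ℝ} {a : T → E → ℝ} {s : Set E}
    (hs : UniqueDiffOn ℝ s) {p : T × E} (hp : p.2 ∈ s)
    (hΦ : SmoothFamilyAt Φ (univ ×ˢ s) (p.1, (a p.1 p.2, p.2)))
    (ha : ∀ᶠ q in 𝓝[univ ×ˢ s] p, ContinuousWithinAt (fun z : T × E => a z.1 z.2) (univ ×ˢ s) q)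
    (hfix : ∀ᶠ q in 𝓝[univ ×ˢ s] p, a q.1 q.2 = Φ q.1 (a q.1 q.2, q.2))
    (hlt : fderivWithin ℝ (Φ p.1) (univ ×ˢ s) (a p.1 p.2, p.2) (1, 0) ≠ 1) :
    SmoothFamilyAt a s p := by
  set S : Set (ℝ × E) := univ ×ˢ s with hS
  have hSu : UniqueDiffOn ℝ S := uniqueDiffOn_univ.prod hs
  let A : T → E → (ℝ × E →L[ℝ] ℝ) := fun τ x => fderivWithin ℝ (Φ τ) S (a τ x, x)
  let R : (ℝ × E →L[ℝ] ℝ) → (E →L[ℝ] ℝ) :=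
    fun L => (1 - L (1, 0))⁻¹ • L.comp (ContinuousLinearMap.inr ℝ ℝ E)
  have hR : ContDiffAt ℝ ∞ R (A p.1 p.2) := by
    have h1 : ContDiffAt ℝ ∞ (fun L : ℝ × E →L[ℝ] ℝ => 1 - L (1, 0)) (A p.1 p.2) :=
      contDiffAt_const.sub
        (ContinuousLinearMap.apply ℝ ℝ ((1 : ℝ), (0 : E))).contDiff.contDiffAt
    have h2 : ContDiffAt ℝ ∞ (fun L : ℝ × E →L[ℝ] ℝ => L.comp (ContinuousLinearMap.inr ℝ ℝ E))
        (A p.1 p.2) :=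
      ((ContinuousLinearMap.compL ℝ E (ℝ × E) ℝ).flip
        (ContinuousLinearMap.inr ℝ ℝ E)).contDiff.contDiffAt
    exact (h1.inv (sub_ne_zero.2 (Ne.symm hlt))).smul h2
  have haF : FamilyAt 0 a s p := familyAt_zero_iff.2 ha
  have hA : ∀ n, FamilyAt n a s p → FamilyAt n A s p := by
    intro n hn
    have h1 := hn.prodMk (smoothFamilyAt_id (T := T) hs hp n) hs hp
    exact FamilyAt.comp (g := fun τ z => fderivWithin ℝ (Φ τ) S z) (t := S)
      (f := fun τ x => (a τ x, x)) ((hΦ (n + 1)).fderivWithin hSu) h1 hs hSu hp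
      (by filter_upwards [self_mem_nhdsWithin] with q hq using ⟨mem_univ _, hq.2⟩)
  have hder : ∀ᶠ q in 𝓝[univ ×ˢ s] p, HasFDerivWithinAt (a q.1) (R (A q.1 q.2)) s q.2 := by
    have hne : ∀ᶠ q in 𝓝[univ ×ˢ s] p, A q.1 q.2 (1, 0) ≠ 1 := by
      have h1 := (hA 0 haF).contDiffAt_comp (g := fun L : ℝ × E →L[ℝ] ℝ => L (1, 0))
        (ContinuousLinearMap.apply ℝ ℝ ((1 : ℝ), (0 : E))).contDiff.contDiffAt hs hp
      exact (h1.continuousWithinAt hp).tendsto.eventually_ne hlt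
    have hΦd : ∀ᶠ q in 𝓝[univ ×ˢ s] p,
        HasFDerivWithinAt (Φ q.1) (A q.1 q.2) S (a q.1 q.2, q.2) := by
      have h1 := haF.prodMk (smoothFamilyAt_id (T := T) hs hp 0) hs hp
      have h2 := h1.tendsto_prodMk (t := S)
        (by filter_upwards [self_mem_nhdsWithin] with q hq using ⟨mem_univ _, hq.2⟩)
      exact (h2.self_of_nhdsWithin (mem_prod_of_mem hp)).eventually
        (hΦ 1).eventually_hasFDerivWithinAt
    filter_upwards [hne, hΦd, ha, hfix, eventually_eventually_nhdsWithin.2 hfix,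
      self_mem_nhdsWithin] with q hq1 hq2 hq3 hq4 hq5 hqs
    obtain ⟨τ, x⟩ := q
    simp only at hq1 hq2 hq3 hq4 hqs ⊢
    have hxs : x ∈ s := hqs.2
    set L := A τ x with hL
    have hcont : ContinuousWithinAt (a τ) s x := by
      refine Tendsto.comp (g := fun z : T × E => a z.1 z.2) (f := fun y => (τ, y)) hq3.tendsto
        (tendsto_nhdsWithin_iff.2 ⟨?_, ?_⟩)
      · exact Continuous.continuousWithinAt (by fun_prop)
      · filter_upwards [self_mem_nhdsWithin] with y hy using ⟨mem_univ _, hy⟩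
    have htend : Tendsto (fun y => (a τ y, y)) (𝓝[s] x) (𝓝[S] (a τ x, x)) := by
      refine tendsto_nhdsWithin_iff.2 ⟨?_, ?_⟩
      · exact hcont.prodMk continuousWithinAt_id
      · filter_upwards [self_mem_nhdsWithin] with y hy using ⟨mem_univ _, hy⟩
    have hlo := (hasFDerivWithinAt_iff_isLittleO.1 hq2).comp_tendsto htend
    have hk : (1 - L (1, 0)) ≠ 0 := sub_ne_zero.2 (Ne.symm hq1)
    set κ := 1 - L (1, 0) with hκ
    -- the remainder is `κ` times the remainder in the derivative of `a`
    have hrem : ∀ᶠ y in 𝓝[s] x, Φ τ (a τ y, y) - Φ τ (a τ x, x) - L ((a τ y, y) - (a τ x, x)) =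
        κ * (a τ y - a τ x - R L (y - x)) := by
      filter_upwards [slice_eventually hq5] with y hy
      rw [← hy, ← hq4]
      have : ((a τ y, y) : ℝ × E) - (a τ x, x) =
          (a τ y - a τ x) • ((1 : ℝ), (0 : E)) + (0, y - x) := by
        ext <;> simp
      rw [this, map_add, map_smul]
      simp only [R, smul_apply, ContinuousLinearMap.comp_apply,
        ContinuousLinearMap.inr_apply, smul_eq_mul]
      rw [← hκ]
      field_simp
      rw [hκ]; ring
    rw [hasFDerivWithinAt_iff_isLittleO, Asymptotics.isLittleO_iff]
    intro ε hε
    set C := ‖R L‖ + 2 with hC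
    have hCpos : 0 < C := by positivity
    have hε' : 0 < min (ε / (2 * C)) (1 / 2) * |κ| := by
      have : 0 < |κ| := abs_pos.2 hk
      positivity
    filter_upwards [Asymptotics.isLittleO_iff.1 hlo hε', hrem] with y hy1 hy2
    simp only [Function.comp_apply] at hy1
    rw [hy2, Real.norm_eq_abs, abs_mul] at hy1
    have hy3 : |a τ y - a τ x - R L (y - x)| ≤
        min (ε / (2 * C)) (1 / 2) * ‖((a τ y, y) : ℝ × E) - (a τ x, x)‖ := by
      have : 0 < |κ| := abs_pos.2 hk
      have h5 : |κ| * |a τ y - a τ x - R L (y - x)| ≤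
        |κ| * (min (ε / (2 * C)) (1 / 2) * ‖((a τ y, y) : ℝ × E) - (a τ x, x)‖) := by linarith
      exact le_of_mul_le_mul_left h5 this
    have hnorm : ‖((a τ y, y) : ℝ × E) - (a τ x, x)‖ ≤ |a τ y - a τ x| + ‖y - x‖ := by
      rw [Prod.mk_sub_mk, Prod.norm_mk, Real.norm_eq_abs]
      exact max_le (by linarith [norm_nonneg (y - x)]) (by linarith [abs_nonneg (a τ y - a τ x)])
    have hRL : |R L (y - x)| ≤ ‖R L‖ * ‖y - x‖ := (R L).le_opNorm _
    have hN := norm_nonneg (((a τ y, y) : ℝ × E) - (a τ x, x))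
    have h6 : |a τ y - a τ x| ≤ (2 * ‖R L‖ + 1) * ‖y - x‖ := by
      have h7 : |a τ y - a τ x - R L (y - x)| ≤ 1 / 2 * (|a τ y - a τ x| + ‖y - x‖) :=
        hy3.trans (mul_le_mul (min_le_right _ _) hnorm hN (by norm_num))
      have h8 := abs_sub_abs_le_abs_sub (a τ y - a τ x) (R L (y - x))
      nlinarith
    have h9 : ‖((a τ y, y) : ℝ × E) - (a τ x, x)‖ ≤ 2 * C * ‖y - x‖ := by
      rw [hC]; nlinarith [norm_nonneg (y - x), norm_nonneg (R L)]
    rw [Real.norm_eq_abs]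
    calc |a τ y - a τ x - R L (y - x)|
        ≤ min (ε / (2 * C)) (1 / 2) * ‖((a τ y, y) : ℝ × E) - (a τ x, x)‖ := hy3
      _ ≤ ε / (2 * C) * (2 * C * ‖y - x‖) :=
        mul_le_mul (min_le_left _ _) h9 hN (by positivity)
      _ = ε * ‖y - x‖ := by field_simp
  intro n
  induction n with
  | zero => exact haF
  | succ n ih =>
    exact haF.succ ((hA n ih).contDiffAt_comp hR hs hp) hder hs

end FamilyCalculus

/-! ### Families of maps of a manifold -/

section ManifoldFamilies

open Filter

variable {V : Type*} [NormedAddCommGroup V] [NormedSpace ℝ V]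
  {H : Type*} [TopologicalSpace H] {I : ModelWithCorners ℝ V H}
  {M : Type u} [TopologicalSpace M] [ChartedSpace H M]
  {T : Type*} [TopologicalSpace T]
  {E : Type*} [NormedAddCommGroup E] [NormedSpace ℝ E]
  {F : Type*} [NormedAddCommGroup F] [NormedSpace ℝ F]

theorem ContMDiffWithinAt.contDiffWithinAt_extChartAt_comp {f : E → M} {s : Set E} {x : E}
    (h : ContMDiffWithinAt 𝓘(ℝ, E) I ∞ f s x) :
    ContDiffWithinAt ℝ ∞ (fun y => extChartAt I (f x) (f y)) s x :=
  contMDiffWithinAt_iff_contDiffWithinAt.1 (contMDiffWithinAt_iff_target.1 h).2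

theorem ContMDiffAt.contDiffWithinAt_comp_symm [IsManifold I ∞ M] {f : M → F} {x : M}
    (h : ContMDiffAt I 𝓘(ℝ, F) ∞ f x) :
    ContDiffWithinAt ℝ ∞ (fun y => f ((extChartAt I x).symm y)) (range I) (extChartAt I x x) :=
  contMDiffWithinAt_iff_contDiffWithinAt.1 (contMDiffAt_iff_source.1 h)

variable (I) in
/-- The family `f : T → E → M` of maps to a manifold is smooth in the variable from `s` near the
point `p` of `T × s`, and all derivatives in charts are jointly continuous. -/
def ManifoldFamilyAt (f : T → E → M) (s : Set E) (p : T × E) : Prop :=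
  ContinuousWithinAt (fun z : T × E => f z.1 z.2) (univ ×ˢ s) p ∧
    SmoothFamilyAt (fun τ x => extChartAt I (f p.1 p.2) (f τ x)) s p

variable {f f' : T → E → M} {s : Set E} {p : T × E}

theorem ManifoldFamilyAt.eventually_mem_source (h : ManifoldFamilyAt I f s p) :
    ∀ᶠ q in 𝓝[univ ×ˢ s] p, f q.1 q.2 ∈ (extChartAt I (f p.1 p.2)).source :=
  h.1.tendsto.eventually (extChartAt_source_mem_nhds (I := I) (f p.1 p.2))

theorem ManifoldFamilyAt.congr (h : ManifoldFamilyAt I f s p) (hp : p.2 ∈ s)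
    (hf : ∀ᶠ q in 𝓝[univ ×ˢ s] p, f' q.1 q.2 = f q.1 q.2) : ManifoldFamilyAt I f' s p := by
  have hpp : f' p.1 p.2 = f p.1 p.2 := hf.self_of_nhdsWithin (mem_prod_of_mem hp)
  refine ⟨h.1.congr_of_eventuallyEq hf hpp, ?_⟩
  rw [hpp]
  exact h.2.congr (hf.mono fun q hq => by rw [hq])

/-- Composition of a family with a smooth map on the manifold. -/
theorem ManifoldFamilyAt.contMDiffAt_comp [IsManifold I ∞ M] (h : ManifoldFamilyAt I f s p)
    {g : M → F} (hg : ContMDiffAt I 𝓘(ℝ, F) ∞ g (f p.1 p.2)) (hs : UniqueDiffOn ℝ s)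
    (hp : p.2 ∈ s) : SmoothFamilyAt (fun τ x => g (f τ x)) s p := by
  have h1 : SmoothFamilyAt (fun (_ : T) y => g ((extChartAt I (f p.1 p.2)).symm y)) (range I)
      (p.1, extChartAt I (f p.1 p.2) (f p.1 p.2)) :=
    smoothFamilyAt_const hg.contDiffWithinAt_comp_symm I.uniqueDiffOn (by simp)
  refine (h1.comp h.2 hs I.uniqueDiffOn hp (Eventually.of_forall fun q => by simp)).congr ?_
  filter_upwards [h.eventually_mem_source] with q hq
  rw [(extChartAt I (f p.1 p.2)).left_inv hq]

/-- Composition of a family of maps of vector spaces with a smooth map to the manifold. -/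
theorem SmoothFamilyAt.contMDiffWithinAt_comp {a : T → E → F} {t : Set F}
    (h : SmoothFamilyAt a s p) {g : F → M}
    (hg : ContMDiffWithinAt 𝓘(ℝ, F) I ∞ g t (a p.1 p.2)) (hs : UniqueDiffOn ℝ s)
    (ht : UniqueDiffOn ℝ t) (hp : p.2 ∈ s) (hst : ∀ᶠ q in 𝓝[univ ×ˢ s] p, a q.1 q.2 ∈ t) :
    ManifoldFamilyAt I (fun τ x => g (a τ x)) s p := by
  have hpt : a p.1 p.2 ∈ t := hst.self_of_nhdsWithin (mem_prod_of_mem hp)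
  refine ⟨?_, ?_⟩
  · exact Tendsto.comp (g := g) hg.continuousWithinAt.tendsto
      (tendsto_nhdsWithin_iff.2 ⟨h.continuousWithinAt hp, hst⟩)
  · exact (smoothFamilyAt_const (T := T) (p := (p.1, a p.1 p.2))
      hg.contDiffWithinAt_extChartAt_comp ht hpt).comp h hs ht hp hst

/-- Substitution of a family of maps of vector spaces into a family of maps to a manifold. -/
theorem ManifoldFamilyAt.comp {a : T → E → F} {t : Set F} {g : T → F → M}
    (hg : ManifoldFamilyAt I g t (p.1, a p.1 p.2)) (h : SmoothFamilyAt a s p)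
    (hs : UniqueDiffOn ℝ s) (ht : UniqueDiffOn ℝ t) (hp : p.2 ∈ s)
    (hst : ∀ᶠ q in 𝓝[univ ×ˢ s] p, a q.1 q.2 ∈ t) :
    ManifoldFamilyAt I (fun τ x => g τ (a τ x)) s p :=
  ⟨Tendsto.comp (g := fun z : T × F => g z.1 z.2) hg.1.tendsto
    (((h 0).tendsto_prodMk hst).self_of_nhdsWithin (mem_prod_of_mem hp)),
    hg.2.comp h hs ht hp hst⟩

theorem ManifoldFamilyAt.eventually_continuousWithinAt (h : ManifoldFamilyAt I f s p) :
    ∀ᶠ q in 𝓝[univ ×ˢ s] p,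
      ContinuousWithinAt (fun z : T × E => f z.1 z.2) (univ ×ˢ s) q := by
  filter_upwards [(h.2 0).eventually_continuousWithinAt, h.eventually_mem_source,
    eventually_eventually_nhdsWithin.2 h.eventually_mem_source] with q hq hqs hq'
  have h1 := (continuousAt_extChartAt_symm'' (I := I)
    ((extChartAt I (f p.1 p.2)).map_source hqs)).tendsto.comp hq.tendsto
  rw [(extChartAt I (f p.1 p.2)).left_inv hqs] at h1
  refine Tendsto.congr' ?_ h1
  filter_upwards [hq'] with z hz
  exact (extChartAt I (f p.1 p.2)).left_inv hz

variable (I) in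
/-- The family `Φ : T → M → M` of maps of a manifold is smooth near the point `x` for parameters
near `τ`, and all derivatives in charts are jointly continuous. -/
def MapFamilyAt (Φ : T → M → M) (τ : T) (x : M) : Prop :=
  ManifoldFamilyAt I (fun σ z => Φ σ ((extChartAt I x).symm z)) (range I) (τ, extChartAt I x x)

variable {Φ : T → M → M} {τ : T} {x : M}

omit [ChartedSpace H M] in
theorem tendsto_prodMk_extend (e : OpenPartialHomeomorph M H) {q : T × M}
    (hq : q.2 ∈ e.source) : Tendsto (fun w : T × M => (w.1, e.extend I w.2)) (𝓝 q)
      (𝓝[univ ×ˢ range I] (q.1, e.extend I q.2)) := by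
  refine tendsto_nhdsWithin_iff.2 ⟨?_, Eventually.of_forall fun w => ⟨mem_univ _, by simp⟩⟩
  exact continuousAt_fst.prodMk ((e.continuousAt_extend hq).comp continuousAt_snd)

theorem tendsto_prodMk_extChartAt_symm (τ : T) (x : M) :
    Tendsto (fun q : T × V => (q.1, (extChartAt I x).symm q.2))
      (𝓝[univ ×ˢ range I] (τ, extChartAt I x x)) (𝓝 (τ, x)) := by
  refine Tendsto.mono_left ?_ nhdsWithin_le_nhds
  have h1 : Tendsto (fun q : T × V => (extChartAt I x).symm q.2) (𝓝 (τ, extChartAt I x x))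
      (𝓝 x) := by
    have := (continuousAt_extChartAt_symm (I := I) x).tendsto.comp
      (continuousAt_snd (p := ((τ, extChartAt I x x) : T × V))).tendsto
    rwa [extChartAt_to_inv] at this
  exact (continuousAt_fst (p := ((τ, extChartAt I x x) : T × V))).tendsto.prodMk_nhds h1

theorem eventually_nhdsWithin_fst {X : Type*} [TopologicalSpace X] {P : T → Prop} {τ : T}
    (h : ∀ᶠ σ in 𝓝 τ, P σ) (y : X) (S : Set (T × X)) : ∀ᶠ w in 𝓝[S] (τ, y), P w.1 :=
  nhdsWithin_le_nhds ((continuousAt_fst (p := ((τ, y) : T × X))).tendsto.eventually h)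

theorem MapFamilyAt.continuousAt (h : MapFamilyAt I Φ τ x) :
    ContinuousAt (fun w : T × M => Φ w.1 w.2) (τ, x) := by
  have h1 := h.1.tendsto.comp (tendsto_prodMk_extend (chartAt H x) (q := (τ, x))
    (mem_chart_source H x))
  have h2 : (extChartAt I x).symm (extChartAt I x x) = x := extChartAt_to_inv x
  simp only [h2] at h1
  refine Tendsto.congr' ?_ h1
  have : ∀ᶠ w : T × M in 𝓝 (τ, x), w.2 ∈ (extChartAt I x).source :=
    continuousAt_snd.tendsto.eventually (extChartAt_source_mem_nhds (I := I) x)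
  filter_upwards [this] with w hw
  exact congrArg _ ((extChartAt I x).left_inv hw)

theorem MapFamilyAt.apply_comp [IsManifold I ∞ M] (hΦ : MapFamilyAt I Φ p.1 (f p.1 p.2))
    (h : ManifoldFamilyAt I f s p) (hs : UniqueDiffOn ℝ s) (hp : p.2 ∈ s) :
    ManifoldFamilyAt I (fun τ y => Φ τ (f τ y)) s p := by
  have h1 := hΦ.comp (a := fun τ y => extChartAt I (f p.1 p.2) (f τ y)) h.2 hs I.uniqueDiffOn hp
    (Eventually.of_forall fun q => by simp)
  refine h1.congr hp ?_
  filter_upwards [h.eventually_mem_source] with q hq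
  rw [(extChartAt I (f p.1 p.2)).left_inv hq]

theorem MapFamilyAt.smoothFamilyAt_extend [IsManifold I ∞ M] (h : MapFamilyAt I Φ τ x)
    {e e' : OpenPartialHomeomorph M H} (he : e ∈ IsManifold.maximalAtlas I ∞ M)
    (he' : e' ∈ IsManifold.maximalAtlas I ∞ M) (hx : x ∈ e.source) (hx' : Φ τ x ∈ e'.source) :
    SmoothFamilyAt (fun σ z => e'.extend I (Φ σ ((e.extend I).symm z))) (range I)
      (τ, e.extend I x) := by
  have hmem : e.extend I x ∈ range I := by simp
  have hsymm : (e.extend I).symm (e.extend I x) = x := e.extend_left_inv hx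
  have h1 : ContMDiffWithinAt 𝓘(ℝ, V) I ∞ (e.extend I).symm (range I) (e.extend I x) := by
    refine (contMDiffOn_extend_symm he _ ⟨e x, e.map_source hx, rfl⟩).mono_of_mem_nhdsWithin ?_
    rw [← e.extend_target']
    exact e.extend_target_mem_nhdsWithin hx
  have h2 : ManifoldFamilyAt I (fun (_ : T) z => (e.extend I).symm z) (range I)
      (τ, e.extend I x) :=
    (smoothFamilyAt_id I.uniqueDiffOn hmem).contMDiffWithinAt_comp h1 I.uniqueDiffOn
      I.uniqueDiffOn hmem
      (by filter_upwards [self_mem_nhdsWithin] with q hq using hq.2)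
  have h3 := MapFamilyAt.apply_comp (Φ := Φ) (p := (τ, e.extend I x))
    (f := fun (_ : T) z => (e.extend I).symm z) (by simpa only [hsymm] using h) h2
    I.uniqueDiffOn hmem
  exact h3.contMDiffAt_comp (e'.contMDiffAt_extend he' (by simpa only [hsymm] using hx'))
    I.uniqueDiffOn hmem

theorem MapFamilyAt.contMDiffAt [IsManifold I ∞ M] (h : MapFamilyAt I Φ τ x) :
    ContMDiffAt I I ∞ (Φ τ) x := by
  rw [contMDiffAt_iff]
  refine ⟨?_, ?_⟩
  · exact Tendsto.comp (g := fun w : T × M => Φ w.1 w.2) h.continuousAt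
      (Continuous.tendsto' (by fun_prop) x (τ, x) rfl)
  · exact (h.smoothFamilyAt_extend (IsManifold.chart_mem_maximalAtlas x)
      (IsManifold.chart_mem_maximalAtlas (Φ τ x)) (mem_chart_source H x)
      (mem_chart_source H _)).contDiffWithinAt (by simp)

/-- A family of maps of a manifold which is a smooth family in some smooth coordinates. -/
theorem MapFamilyAt.of_coordinates [IsManifold I ∞ M] {g : T → F → M} {γ : M → F} {t : Set F}
    (hg : ManifoldFamilyAt I g t (τ, γ x)) (hγ : ContMDiffAt I 𝓘(ℝ, F) ∞ γ x)
    (ht : UniqueDiffOn ℝ t) (hγt : ∀ᶠ y in 𝓝 x, γ y ∈ t)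
    (hΦ : ∀ᶠ w in 𝓝 (τ, x), Φ w.1 w.2 = g w.1 (γ w.2)) : MapFamilyAt I Φ τ x := by
  have hmem : extChartAt I x x ∈ range I := by simp
  have h2 : (extChartAt I x).symm (extChartAt I x x) = x := extChartAt_to_inv x
  have h1 : SmoothFamilyAt (fun (_ : T) z => γ ((extChartAt I x).symm z)) (range I)
      (τ, extChartAt I x x) :=
    smoothFamilyAt_const hγ.contDiffWithinAt_comp_symm I.uniqueDiffOn hmem
  have hc := tendsto_prodMk_extChartAt_symm (I := I) τ x
  refine (ManifoldFamilyAt.comp (g := g) (t := t) (by simpa only [h2] using hg) h1 I.uniqueDiffOn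
    ht hmem ?_).congr hmem ?_
  · filter_upwards [hc.eventually (continuousAt_snd.tendsto.eventually hγt)] with q hq using hq
  · filter_upwards [hc.eventually hΦ] with q hq using hq

theorem mapFamilyAt_const [IsManifold I ∞ M] {g : M → M} (hg : ContMDiffAt I I ∞ g x) :
    MapFamilyAt I (fun _ : T => g) τ x := by
  have hmem : extChartAt I x x ∈ range I := by simp
  have h2 : (extChartAt I x).symm (extChartAt I x x) = x := extChartAt_to_inv x
  refine (smoothFamilyAt_id I.uniqueDiffOn hmem).contMDiffWithinAt_comp
    (g := fun z => g ((extChartAt I x).symm z)) (a := fun (_ : T) z => z)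
    (t := range I) ?_ I.uniqueDiffOn I.uniqueDiffOn hmem
    (by filter_upwards [self_mem_nhdsWithin] with q hq using hq.2)
  exact contMDiffAt_iff_source.1 hg

theorem MapFamilyAt.congr (h : MapFamilyAt I Φ τ x) {Φ' : T → M → M}
    (hΦ : ∀ᶠ w in 𝓝 (τ, x), Φ' w.1 w.2 = Φ w.1 w.2) : MapFamilyAt I Φ' τ x := by
  have hmem : extChartAt I x x ∈ range I := by simp
  have h2 : (extChartAt I x).symm (extChartAt I x x) = x := extChartAt_to_inv x
  refine ManifoldFamilyAt.congr h hmem ?_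
  have hc := tendsto_prodMk_extChartAt_symm (I := I) τ x
  exact hc.eventually hΦ

/-! ### Whitney topologies and families -/

variable (I) in
/-- The local representative of a map in a pair of charts. -/
noncomputable def localRep (e e' : OpenPartialHomeomorph M H) (g : M → M) : V → V :=
  e'.extend I ∘ g ∘ (e.extend I).symm

variable [IsManifold I ∞ M]

omit [IsManifold I ∞ M] in
/-- Weak Whitney continuity of a map into `C^∞(M, M)` makes it a family of maps whose derivatives
are close to each other, uniformly near a given point. -/
theorem eventually_jets_close [FiniteDimensional ℝ V] {h : T → C^∞⟮I, M; I, M⟯}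
    (hh : @Continuous T _ _ (weakWhitney I I M M) h) (τ : T) (x : M)
    {e e' : OpenPartialHomeomorph M H} (he : e ∈ IsManifold.maximalAtlas I ∞ M)
    (he' : e' ∈ IsManifold.maximalAtlas I ∞ M) (hx : x ∈ e.source) (hx' : h τ x ∈ e'.source)
    (r : ℕ) {ε : ℝ} (hε : 0 < ε) :
    ∃ K ∈ 𝓝 x, K ⊆ e.source ∧ ∀ᶠ σ in 𝓝 τ, ∀ y ∈ K, h σ y ∈ e'.source ∧ ∀ k ≤ r,
      ‖iteratedFDerivWithin ℝ k (localRep I e e' (h σ)) (range I) (e.extend I y) -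
        iteratedFDerivWithin ℝ k (localRep I e e' (h τ)) (range I) (e.extend I y)‖ < ε := by
  have : LocallyCompactSpace M := Manifold.locallyCompact_of_finiteDimensional I
  have hU : e.source ∩ h τ ⁻¹' e'.source ∈ 𝓝 x :=
    inter_mem (e.open_source.mem_nhds hx)
      ((h τ).contMDiff.continuous.continuousAt.preimage_mem_nhds (e'.open_source.mem_nhds hx'))
  obtain ⟨K, hK, hKU, hKc⟩ := local_compact_nhds hU
  let D : WhitneyData I I M M PUnit (h τ) :=
    { src := fun _ => e, tgt := fun _ => e', K := fun _ => K, ε := fun _ => ε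
      src_mem := fun _ => he, tgt_mem := fun _ => he', isCompact_K := fun _ => hKc
      K_subset := fun _ y hy => (hKU hy).1, mapsTo_K := fun _ y hy => (hKU hy).2
      ε_pos := fun _ => hε }
  have hopen : IsOpen (h ⁻¹' D.nhd r) :=
    @IsOpen.preimage T _ _ (weakWhitney I I M M) h hh _
      (TopologicalSpace.isOpen_generateFrom_of_mem ⟨r, h τ, D, rfl⟩)
  have hmem : τ ∈ h ⁻¹' D.nhd r := fun i y hy => ⟨(hKU hy).2, fun k _ => by
    rw [sub_self, norm_zero]; exact hε⟩
  refine ⟨K, hK, fun y hy => (hKU hy).1, ?_⟩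
  filter_upwards [hopen.mem_nhds hmem] with σ hσ y hy
  exact hσ PUnit.unit y hy

/-- A map to `C^∞(M, M)` which is continuous for the weak Whitney topology is a smooth family. -/
theorem mapFamilyAt_of_continuous_weakWhitney [FiniteDimensional ℝ V]
    {h : T → C^∞⟮I, M; I, M⟯} (hh : @Continuous T _ _ (weakWhitney I I M M) h) (τ : T) (x : M) :
    MapFamilyAt I (fun σ => h σ) τ x := by
  set e := chartAt H x with he_def
  set e' := chartAt H (h τ x) with he'_def
  have he : e ∈ IsManifold.maximalAtlas I ∞ M := IsManifold.chart_mem_maximalAtlas x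
  have he' : e' ∈ IsManifold.maximalAtlas I ∞ M := IsManifold.chart_mem_maximalAtlas (h τ x)
  have hmem : extChartAt I x x ∈ range I := by simp
  have h2 : (extChartAt I x).symm (extChartAt I x x) = x := extChartAt_to_inv x
  -- joint continuity of the derivatives at an arbitrary point where the charts can be used
  have key : ∀ (σ : T) (y : M), y ∈ e.source → h σ y ∈ e'.source → ∀ k : ℕ,
      ContinuousWithinAt (fun w : T × V => iteratedFDerivWithin ℝ k (localRep I e e' (h w.1))
        (range I) w.2) (univ ×ˢ range I) (σ, e.extend I y) := by
    intro σ y hy hy' k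
    have hsm : SmoothFamilyAt (fun (_ : T) z => localRep I e e' (h σ) z) (range I)
        (σ, e.extend I y) :=
      (mapFamilyAt_const (h σ).contMDiff.contMDiffAt).smoothFamilyAt_extend he he' hy hy'
    have hc : ContinuousWithinAt (fun w : T × V => iteratedFDerivWithin ℝ k
        (localRep I e e' (h σ)) (range I) w.2) (univ ×ˢ range I) (σ, e.extend I y) :=
      ((hsm k).self_of_nhdsWithin (mem_prod_of_mem (by simp))).2 k le_rfl
    rw [ContinuousWithinAt, Metric.tendsto_nhds] at hc ⊢
    intro ε hε
    obtain ⟨K, hK, hKs, hclose⟩ := eventually_jets_close hh σ y he he' hy hy' k (half_pos hε)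
    have hT : ∀ᶠ w : T × V in 𝓝[univ ×ˢ range I] (σ, e.extend I y), ∀ y ∈ K,
        h w.1 y ∈ e'.source ∧ ∀ j ≤ k,
        ‖iteratedFDerivWithin ℝ j (localRep I e e' (h w.1)) (range I) (e.extend I y) -
          iteratedFDerivWithin ℝ j (localRep I e e' (h σ)) (range I) (e.extend I y)‖ < ε / 2 :=
      eventually_nhdsWithin_fst hclose _ _
    have hV : ∀ᶠ w : T × V in 𝓝[univ ×ˢ range I] (σ, e.extend I y),
        w.2 ∈ (e.extend I).target ∧ (e.extend I).symm w.2 ∈ K := by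
      have ht : Tendsto Prod.snd (𝓝[univ ×ˢ range I] ((σ, e.extend I y) : T × V))
          (𝓝[range I] (e.extend I y)) :=
        tendsto_nhdsWithin_iff.2 ⟨continuousAt_snd.tendsto.mono_left nhdsWithin_le_nhds, by
          filter_upwards [self_mem_nhdsWithin] with w hw using hw.2⟩
      exact ht.eventually (inter_mem (e.extend_target_mem_nhdsWithin hy)
        (mem_nhdsWithin_of_mem_nhds (e.extend_preimage_mem_nhds hy hK)))
    filter_upwards [hc (ε / 2) (half_pos hε), hT, hV] with w hw1 hw2 hw3
    have h5 := (hw2 _ hw3.2).2 k le_rfl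
    rw [(e.extend I).right_inv hw3.1] at h5
    rw [← dist_eq_norm] at h5
    calc _ ≤ _ := dist_triangle _ _ _
      _ < ε / 2 + ε / 2 := add_lt_add h5 hw1
      _ = ε := by ring
  have hxe : x ∈ e.source := mem_chart_source H x
  have hxe' : h τ x ∈ e'.source := mem_chart_source H (h τ x)
  -- points near `(τ, x)` can be handled in the same charts
  have hnear : ∀ᶠ w : T × V in 𝓝[univ ×ˢ range I] (τ, e.extend I x),
      w.2 ∈ (e.extend I).target ∧ h w.1 ((e.extend I).symm w.2) ∈ e'.source := by
    obtain ⟨K, hK, hKs, hclose⟩ := eventually_jets_close hh τ x he he' hxe hxe' 0 one_pos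
    have hT : ∀ᶠ w : T × V in 𝓝[univ ×ˢ range I] (τ, e.extend I x), ∀ y ∈ K,
        h w.1 y ∈ e'.source :=
      eventually_nhdsWithin_fst (hclose.mono fun σ hσ y hy => (hσ y hy).1) _ _
    have ht : Tendsto Prod.snd (𝓝[univ ×ˢ range I] ((τ, e.extend I x) : T × V))
        (𝓝[range I] (e.extend I x)) :=
      tendsto_nhdsWithin_iff.2 ⟨continuousAt_snd.tendsto.mono_left nhdsWithin_le_nhds, by
        filter_upwards [self_mem_nhdsWithin] with w hw using hw.2⟩
    have hV : ∀ᶠ w : T × V in 𝓝[univ ×ˢ range I] (τ, e.extend I x),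
        w.2 ∈ (e.extend I).target ∧ (e.extend I).symm w.2 ∈ K :=
      ht.eventually (inter_mem (e.extend_target_mem_nhdsWithin hxe)
        (mem_nhdsWithin_of_mem_nhds (e.extend_preimage_mem_nhds hxe hK)))
    filter_upwards [hT, hV] with w hw1 hw2 using ⟨hw2.1, hw1 _ hw2.2⟩
  have hfam : SmoothFamilyAt (fun σ z => localRep I e e' (h σ) z) (range I)
      (τ, e.extend I x) := by
    intro n
    filter_upwards [hnear] with w hw
    have hy : (e.extend I).symm w.2 ∈ e.source := by
      rw [← e.extend_source (I := I)]
      exact (e.extend I).map_target hw.1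
    refine ⟨?_, fun k _ => ?_⟩
    · have hsm : SmoothFamilyAt (fun (_ : T) z => localRep I e e' (h w.1) z) (range I)
          (w.1, e.extend I ((e.extend I).symm w.2)) :=
        (mapFamilyAt_const (h w.1).contMDiff.contMDiffAt).smoothFamilyAt_extend he he' hy hw.2
      have := (hsm n).contDiffWithinAt (by simp)
      rwa [(e.extend I).right_inv hw.1] at this
    · have := key w.1 _ hy hw.2 k
      rwa [(e.extend I).right_inv hw.1] at this
  refine ⟨?_, ?_⟩
  · have h3 := (continuousAt_extChartAt_symm'' (I := I) (x := h τ x)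
      (y := localRep I e e' (h τ) (e.extend I x)) ?_).tendsto.comp
      (hfam.continuousWithinAt hmem).tendsto
    · have h4 : (extChartAt I (h τ x)).symm (localRep I e e' (h τ) (e.extend I x)) =
          h τ ((extChartAt I x).symm (extChartAt I x x)) := by
        rw [h2]
        change (e'.extend I).symm (e'.extend I (h τ ((e.extend I).symm (e.extend I x)))) = _
        rw [e.extend_left_inv hxe, e'.extend_left_inv hxe']
      rw [h4] at h3
      refine Tendsto.congr' ?_ h3
      filter_upwards [hnear] with w hw
      exact e'.extend_left_inv hw.2
    · change e'.extend I (h τ ((e.extend I).symm (e.extend I x))) ∈ (e'.extend I).target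
      rw [e.extend_left_inv hxe]
      exact (e'.extend I).map_source (by rwa [e'.extend_source])
  · simp only [h2]
    exact hfam

/-- A family of smooth maps, smooth at all points, is continuous for the weak Whitney topology. -/
theorem continuous_weakWhitney_of_mapFamilyAt {Φ : T → C^∞⟮I, M; I, M⟯}
    (hΦ : ∀ τ x, MapFamilyAt I (fun σ => Φ σ) τ x) :
    @Continuous T _ _ (weakWhitney I I M M) Φ := by
  rw [continuous_generateFrom_iff]
  rintro _ ⟨r, f, D, rfl⟩
  rw [isOpen_iff_mem_nhds]
  intro τ hτ
  have key : ∀ i, ∀ᶠ σ in 𝓝 τ, ∀ x ∈ D.K i, Φ σ x ∈ (D.tgt i).source ∧ ∀ k ≤ r,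
      ‖iteratedFDerivWithin ℝ k (localRep I (D.src i) (D.tgt i) (Φ σ)) (range I)
          ((D.src i).extend I x) -
        iteratedFDerivWithin ℝ k (localRep I (D.src i) (D.tgt i) f) (range I)
          ((D.src i).extend I x)‖ < D.ε i := by
    intro i
    refine (D.isCompact_K i).eventually_forall_of_forall_eventually fun x hx => ?_
    obtain ⟨hx1, hx2⟩ := hτ i x hx
    have hxs := D.K_subset i hx
    have h1 : ∀ᶠ w : T × M in 𝓝 (τ, x), Φ w.1 w.2 ∈ (D.tgt i).source :=
      (hΦ τ x).continuousAt.tendsto.eventually ((D.tgt i).open_source.mem_nhds hx1)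
    have h2 := (hΦ τ x).smoothFamilyAt_extend (D.src_mem i) (D.tgt_mem i) hxs hx1
    have h3 : SmoothFamilyAt (fun (_ : T) z => (D.tgt i).extend I (f (((D.src i).extend I).symm z)))
        (range I) (τ, (D.src i).extend I x) :=
      (mapFamilyAt_const (T := T) f.contMDiff.contMDiffAt).smoothFamilyAt_extend (D.src_mem i)
        (D.tgt_mem i) hxs (D.mapsTo_K i hx)
    have h4 : ∀ k ∈ Finset.range (r + 1), ∀ᶠ w : T × M in 𝓝 (τ, x),
      ‖iteratedFDerivWithin ℝ k (localRep I (D.src i) (D.tgt i) (Φ w.1)) (range I)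
          ((D.src i).extend I w.2) -
        iteratedFDerivWithin ℝ k (localRep I (D.src i) (D.tgt i) f) (range I)
          ((D.src i).extend I w.2)‖ < D.ε i := by
      intro k hk
      have hk' : k ≤ r := by simpa [Nat.lt_succ_iff] using hk
      have h5 := ((h2 k).self_of_nhdsWithin (mem_prod_of_mem (by simp))).2 k le_rfl
      have h6 := ((h3 k).self_of_nhdsWithin (mem_prod_of_mem (by simp))).2 k le_rfl
      have h7 := (h5.sub h6).norm.tendsto.comp
        (tendsto_prodMk_extend (I := I) (D.src i) (q := (τ, x)) hxs)
      exact h7.eventually_lt_const (hx2 k hk')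
    filter_upwards [h1, (Filter.eventually_all_finset _).2 h4] with w hw1 hw2
    exact ⟨hw1, fun k hk => hw2 k (Finset.mem_range.2 (by omega))⟩
  filter_upwards [key PUnit.unit] with σ hσ
  intro i
  exact hσ

omit [IsManifold I ∞ M] in
/-- If `Φ` is continuous for the weak Whitney topology and agrees with a family which is continuous
for the strong Whitney topology outside of a compact set, then it is continuous for the strong
Whitney topology. -/
theorem continuous_strongWhitney_of_weakWhitney [T2Space M] {Φ Ψ : T → C^∞⟮I, M; I, M⟯}
    (hΦ : @Continuous T _ _ (weakWhitney I I M M) Φ)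
    (hΨ : @Continuous T _ _ (strongWhitney I I M M) Ψ) {Z : Set M} (hZ : IsCompact Z)
    (hΦΨ : ∀ τ, ∀ x ∉ Z, Φ τ x = Ψ τ x) :
    @Continuous T _ _ (strongWhitney I I M M) Φ := by
  rw [continuous_generateFrom_iff]
  rintro _ ⟨r, ι, f, D, hD, rfl⟩
  have hfin := hD.finite_nonempty_inter_compact hZ
  set J := {i | (D.K i ∩ Z).Nonempty} with hJ
  -- the conditions on the compact sets which meet `Z`
  let D₁ : ι → WhitneyData I I M M PUnit f := fun i =>
    { src := fun _ => D.src i, tgt := fun _ => D.tgt i, K := fun _ => D.K i, ε := fun _ => D.ε i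
      src_mem := fun _ => D.src_mem i, tgt_mem := fun _ => D.tgt_mem i
      isCompact_K := fun _ => D.isCompact_K i
      K_subset := fun _ => D.K_subset i, mapsTo_K := fun _ => D.mapsTo_K i
      ε_pos := fun _ => D.ε_pos i }
  -- the conditions on the compact sets disjoint from `Z`
  let D₂ : WhitneyData I I M M {i // i ∉ J} f :=
    { src := fun i => D.src i, tgt := fun i => D.tgt i, K := fun i => D.K i, ε := fun i => D.ε i
      src_mem := fun i => D.src_mem i, tgt_mem := fun i => D.tgt_mem i
      isCompact_K := fun i => D.isCompact_K i
      K_subset := fun i => D.K_subset i, mapsTo_K := fun i => D.mapsTo_K i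
      ε_pos := fun i => D.ε_pos i }
  have h1 : ∀ i, IsOpen (Φ ⁻¹' (D₁ i).nhd r) := fun i =>
    @IsOpen.preimage T _ _ (weakWhitney I I M M) Φ hΦ _
      (TopologicalSpace.isOpen_generateFrom_of_mem ⟨r, f, D₁ i, rfl⟩)
  have h2 : IsOpen (Ψ ⁻¹' D₂.nhd r) :=
    @IsOpen.preimage T _ _ (strongWhitney I I M M) Ψ hΨ _
      (TopologicalSpace.isOpen_generateFrom_of_mem ⟨r, _, f, D₂,
        hD.comp_injective Subtype.val_injective, rfl⟩)
  have heq : Φ ⁻¹' D.nhd r = (⋂ i ∈ J, Φ ⁻¹' (D₁ i).nhd r) ∩ Ψ ⁻¹' D₂.nhd r := by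
    have hloc : ∀ τ, ∀ i ∉ J, ∀ x ∈ D.K i, Φ τ x = Ψ τ x ∧ ∀ k,
        iteratedFDerivWithin ℝ k (localRep I (D.src i) (D.tgt i) (Φ τ)) (range I)
          ((D.src i).extend I x) =
        iteratedFDerivWithin ℝ k (localRep I (D.src i) (D.tgt i) (Ψ τ)) (range I)
          ((D.src i).extend I x) := by
      intro τ i hi x hx
      have hxZ : x ∈ Zᶜ := fun h => hi ⟨x, hx, h⟩
      have hxs := D.K_subset i hx
      refine ⟨hΦΨ τ x hxZ, fun k => ?_⟩
      refine Filter.EventuallyEq.iteratedFDerivWithin_eq (mem_nhdsWithin_of_mem_nhds ?_) ?_ k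
      · filter_upwards [(D.src i).extend_preimage_mem_nhds (I := I) hxs
          (hZ.isClosed.isOpen_compl.mem_nhds hxZ)] with z hz
        exact congrArg _ (hΦΨ τ _ hz)
      · change (D.tgt i).extend I (Φ τ _) = (D.tgt i).extend I (Ψ τ _)
        rw [(D.src i).extend_left_inv hxs, hΦΨ τ x hxZ]
    ext τ
    simp only [mem_preimage, mem_inter_iff, mem_iInter]
    constructor
    · intro hτ
      refine ⟨fun i _ _ => hτ i, fun i x hx => ?_⟩
      obtain ⟨h3, h4⟩ := hloc τ i i.2 x hx
      refine ⟨h3 ▸ (hτ i x hx).1, fun k hk => ?_⟩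
      have := (hτ i x hx).2 k hk
      erw [h4 k] at this
      exact this
    · rintro ⟨hτ1, hτ2⟩ i x hx
      by_cases hi : i ∈ J
      · exact hτ1 i hi PUnit.unit x hx
      · obtain ⟨h3, h4⟩ := hloc τ i hi x hx
        refine ⟨h3 ▸ (hτ2 ⟨i, hi⟩ x hx).1, fun k hk => ?_⟩
        have := (hτ2 ⟨i, hi⟩ x hx).2 k hk
        erw [← h4 k] at this
        exact this
  rw [heq]
  exact (hfin.isOpen_biInter fun i _ => h1 i).inter h2

omit [IsManifold I ∞ M] in
/-- The strong Whitney topology is finer than the weak one. -/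
theorem continuous_weakWhitney_of_strongWhitney {Φ : T → C^∞⟮I, M; I, M⟯}
    (hΦ : @Continuous T _ _ (strongWhitney I I M M) Φ) :
    @Continuous T _ _ (weakWhitney I I M M) Φ := by
  rw [continuous_generateFrom_iff]
  rintro _ ⟨r, f, D, rfl⟩
  exact @IsOpen.preimage T _ _ (strongWhitney I I M M) Φ hΦ _
      (TopologicalSpace.isOpen_generateFrom_of_mem ⟨r, _, f, D, locallyFinite_of_finite _, rfl⟩)

end ManifoldFamilies

/-! ### Regular neighbourhoods and norms on their fibres -/

section FibreNorm

open Filter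

/-- The model of trivialized charts: the product of a half-space and the fibre. -/
def modelSet (k m : ℕ) : Set (EuclideanSpace ℝ (Fin k) × EuclideanSpace ℝ (Fin m)) :=
  stdHalfSpace k ×ˢ univ

theorem convex_stdHalfSpace (k : ℕ) : Convex ℝ (stdHalfSpace k) := by
  intro x hx y hy a b ha hb _ i hi
  have h1 := hx i hi
  have h2 := hy i hi
  simp only [PiLp.add_apply, PiLp.smul_apply, smul_eq_mul]
  positivity

theorem uniqueDiffOn_stdHalfSpace (k : ℕ) : UniqueDiffOn ℝ (stdHalfSpace k) := by
  refine uniqueDiffOn_convex (convex_stdHalfSpace k) ?_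
  let v : EuclideanSpace ℝ (Fin k) := WithLp.toLp 2 fun _ => 1
  have hopen : IsOpen {x : EuclideanSpace ℝ (Fin k) | ∀ i : Fin k, 0 < x i} := by
    simp only [Set.ofPred_forall]
    exact isOpen_iInter_of_finite fun i =>
      isOpen_lt continuous_const (EuclideanSpace.proj (𝕜 := ℝ) i).continuous
  refine ⟨v, mem_interior.2 ⟨_, fun x hx i _ => (hx i).le, hopen, fun i => ?_⟩⟩
  simp [v]

theorem convex_modelSet (k m : ℕ) : Convex ℝ (modelSet k m) :=
  (convex_stdHalfSpace k).prod convex_univ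

theorem uniqueDiffOn_modelSet (k m : ℕ) : UniqueDiffOn ℝ (modelSet k m) :=
  (uniqueDiffOn_stdHalfSpace k).prod uniqueDiffOn_univ

variable {V : Type*} [NormedAddCommGroup V] [NormedSpace ℝ V]
  {H : Type*} [TopologicalSpace H] {I : ModelWithCorners ℝ V H}
  {M : Type u} [TopologicalSpace M] [ChartedSpace H M]

namespace TrivializedChart

variable {E : Set M} {proj : M → M} {smul : ℝ → M → M} {add : M → M → M} {k m : ℕ}
  (c : TrivializedChart I E proj smul add k m)

theorem target_subset : c.e.target ⊆ modelSet k m := by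
  rw [c.target_eq]
  obtain ⟨W, _, hW⟩ := c.exists_open
  rintro ⟨u, v⟩ ⟨hu, _⟩
  rw [hW] at hu
  exact ⟨hu.2, mem_univ _⟩

theorem target_mem_nhdsWithin {w : EuclideanSpace ℝ (Fin k) × EuclideanSpace ℝ (Fin m)}
    (hw : w ∈ c.e.target) : c.e.target ∈ 𝓝[modelSet k m] w := by
  rw [c.target_eq] at hw ⊢
  obtain ⟨W, hWo, hW⟩ := c.exists_open
  rw [hW] at hw ⊢
  refine mem_nhdsWithin.2 ⟨W ×ˢ univ, hWo.prod isOpen_univ, ⟨hw.1.1, mem_univ _⟩, ?_⟩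
  rintro ⟨u, v⟩ ⟨⟨h1, _⟩, h2, _⟩
  exact ⟨⟨h1, h2⟩, mem_univ _⟩

theorem contMDiffAt_toFun {x : M} (hx : x ∈ c.e.source) :
    ContMDiffAt I 𝓘(ℝ, EuclideanSpace ℝ (Fin k) × EuclideanSpace ℝ (Fin m)) ∞ c.e x :=
  (c.contMDiffOn_toFun x hx).contMDiffAt (c.isOpen_source.mem_nhds hx)

theorem contMDiffWithinAt_symm {w : EuclideanSpace ℝ (Fin k) × EuclideanSpace ℝ (Fin m)}
    (hw : w ∈ c.e.target) :
    ContMDiffWithinAt 𝓘(ℝ, EuclideanSpace ℝ (Fin k) × EuclideanSpace ℝ (Fin m)) I ∞ c.e.symm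
      (modelSet k m) w :=
  (c.contMDiffOn_invFun w hw).mono_of_mem_nhdsWithin (c.target_mem_nhdsWithin hw)

theorem fst_mem {x : M} (hx : x ∈ c.e.source) : (c.e x).1 ∈ c.O := by
  have := c.e.map_source hx
  rw [c.target_eq] at this
  exact this.1

theorem mk_mem_target {x : M} (hx : x ∈ c.e.source) (v : EuclideanSpace ℝ (Fin m)) :
    ((c.e x).1, v) ∈ c.e.target := by
  rw [c.target_eq]
  exact ⟨c.fst_mem hx, mem_univ _⟩

theorem mk_mem_target' {w : EuclideanSpace ℝ (Fin k) × EuclideanSpace ℝ (Fin m)}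
    (hw : w ∈ c.e.target) (v : EuclideanSpace ℝ (Fin m)) : (w.1, v) ∈ c.e.target := by
  rw [c.target_eq] at hw ⊢
  exact ⟨hw.1, mem_univ _⟩

theorem proj_eq {x : M} (hx : x ∈ c.e.source) : proj x = c.e.symm ((c.e x).1, 0) := by
  conv_lhs => rw [← c.e.left_inv hx]
  exact c.proj_symm _ (c.fst_mem hx) _

theorem smul_eq {x : M} (hx : x ∈ c.e.source) (t : ℝ) :
    smul t x = c.e.symm ((c.e x).1, t • (c.e x).2) := by
  conv_lhs => rw [← c.e.left_inv hx]
  exact c.smul_symm _ (c.fst_mem hx) _ _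

theorem smul_mem {x : M} (hx : x ∈ c.e.source) (t : ℝ) : smul t x ∈ c.e.source := by
  rw [c.smul_eq hx]
  exact c.e.map_target (c.mk_mem_target hx _)

theorem proj_mem {x : M} (hx : x ∈ c.e.source) : proj x ∈ c.e.source := by
  rw [c.proj_eq hx]
  exact c.e.map_target (c.mk_mem_target hx _)

theorem apply_smul {x : M} (hx : x ∈ c.e.source) (t : ℝ) :
    c.e (smul t x) = ((c.e x).1, t • (c.e x).2) := by
  rw [c.smul_eq hx, c.e.right_inv (c.mk_mem_target hx _)]

theorem apply_proj {x : M} (hx : x ∈ c.e.source) : c.e (proj x) = ((c.e x).1, 0) := by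
  rw [c.proj_eq hx, c.e.right_inv (c.mk_mem_target hx _)]

theorem proj_eq_self_iff {x : M} (hx : x ∈ c.e.source) : proj x = x ↔ (c.e x).2 = 0 := by
  constructor
  · intro h
    have := c.apply_proj hx
    rw [h] at this
    exact congrArg Prod.snd this
  · intro h
    rw [c.proj_eq hx, ← h]
    exact c.e.left_inv hx

end TrivializedChart

namespace RegularNeighborhood

variable {B : Set M} (N : RegularNeighborhood I B)

theorem exists_chart_of_mem {x : M} (hx : x ∈ N.total) :
    ∃ (k m : ℕ) (c : TrivializedChart I N.total N.proj N.smul N.add k m), x ∈ c.e.source := by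
  obtain ⟨k, m, c, hc⟩ := N.exists_chart _ (N.proj_mem x hx)
  exact ⟨k, m, c, c.saturated x hx hc⟩

theorem mem_base_iff {x : M} (hx : x ∈ N.total) : x ∈ B ↔ N.proj x = x :=
  ⟨N.proj_base x, fun h => h ▸ N.proj_mem x hx⟩

theorem mem_base_iff_snd {k m : ℕ} (c : TrivializedChart I N.total N.proj N.smul N.add k m)
    {x : M} (hx : x ∈ c.e.source) : x ∈ B ↔ (c.e x).2 = 0 :=
  (N.mem_base_iff (c.source_subset hx)).trans (c.proj_eq_self_iff hx)

theorem smul_mem {x : M} (hx : x ∈ N.total) (t : ℝ) : N.smul t x ∈ N.total := by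
  obtain ⟨k, m, c, hc⟩ := N.exists_chart_of_mem hx
  exact c.source_subset (c.smul_mem hc t)

theorem smul_zero {x : M} (hx : x ∈ N.total) : N.smul 0 x = N.proj x := by
  obtain ⟨k, m, c, hc⟩ := N.exists_chart_of_mem hx
  rw [c.smul_eq hc, c.proj_eq hc, zero_smul]

theorem smul_one {x : M} (hx : x ∈ N.total) : N.smul 1 x = x := by
  obtain ⟨k, m, c, hc⟩ := N.exists_chart_of_mem hx
  rw [c.smul_eq hc, one_smul]
  exact c.e.left_inv hc

theorem smul_smul {x : M} (hx : x ∈ N.total) (s t : ℝ) :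
    N.smul s (N.smul t x) = N.smul (s * t) x := by
  obtain ⟨k, m, c, hc⟩ := N.exists_chart_of_mem hx
  rw [c.smul_eq (c.smul_mem hc t), c.apply_smul hc, c.smul_eq hc, mul_smul]

theorem smul_base {b : M} (hb : b ∈ B) (t : ℝ) : N.smul t b = b := by
  obtain ⟨k, m, c, hc⟩ := N.exists_chart b hb
  rw [c.smul_eq hc, (N.mem_base_iff_snd c hc).1 hb, _root_.smul_zero]
  conv_rhs => rw [← c.e.left_inv hc]
  rw [← (N.mem_base_iff_snd c hc).1 hb]

theorem smul_zero_mem {x : M} (hx : x ∈ N.total) : N.smul 0 x ∈ B := by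
  rw [N.smul_zero hx]
  exact N.proj_mem x hx

theorem proj_smul {x : M} (hx : x ∈ N.total) (t : ℝ) : N.proj (N.smul t x) = N.proj x := by
  rw [← N.smul_zero hx, ← N.smul_zero (N.smul_mem hx t), N.smul_smul hx, zero_mul]

theorem smul_inv_smul {x : M} (hx : x ∈ N.total) {t : ℝ} (ht : t ≠ 0) :
    N.smul t⁻¹ (N.smul t x) = x := by
  rw [N.smul_smul hx, inv_mul_cancel₀ ht, N.smul_one hx]

theorem smul_smul_inv {x : M} (hx : x ∈ N.total) {t : ℝ} (ht : t ≠ 0) :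
    N.smul t (N.smul t⁻¹ x) = x := by
  rw [N.smul_smul hx, mul_inv_cancel₀ ht, N.smul_one hx]

theorem continuousAt_smul {t : ℝ} {x : M} (hx : x ∈ N.total) :
    ContinuousAt (fun w : ℝ × M => N.smul w.1 w.2) (t, x) := by
  obtain ⟨k, m, c, hc⟩ := N.exists_chart_of_mem hx
  have h1 : ContinuousAt (fun w : ℝ × M => ((c.e w.2).1, w.1 • (c.e w.2).2)) (t, x) := by
    have h2 : ContinuousAt (fun w : ℝ × M => c.e w.2) (t, x) :=
      ContinuousAt.comp (f := Prod.snd) (x := (t, x)) (c.contMDiffAt_toFun hc).continuousAt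
        continuousAt_snd
    exact h2.fst.prodMk (continuousAt_fst.smul h2.snd)
  have hev : ∀ᶠ w : ℝ × M in 𝓝 (t, x), w.2 ∈ c.e.source :=
    continuousAt_snd.tendsto.eventually (c.isOpen_source.mem_nhds hc)
  have h3 := (c.contMDiffWithinAt_symm (c.mk_mem_target hc (t • (c.e x).2))).continuousWithinAt
  have h4 : Tendsto (fun w : ℝ × M => ((c.e w.2).1, w.1 • (c.e w.2).2)) (𝓝 (t, x))
      (𝓝[modelSet k m] ((c.e x).1, t • (c.e x).2)) :=
    tendsto_nhdsWithin_iff.2 ⟨h1, hev.mono fun w hw => c.target_subset (c.mk_mem_target hw _)⟩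
  have h5 := h3.tendsto.comp h4
  rw [← c.smul_eq hc] at h5
  refine Tendsto.congr' ?_ h5
  filter_upwards [hev] with w hw using (c.smul_eq hw w.1).symm

theorem contMDiffAt_proj {x : M} (hx : x ∈ N.total) : ContMDiffAt I I ∞ N.proj x := by
  obtain ⟨k, m, c, hc⟩ := N.exists_chart_of_mem hx
  let r : EuclideanSpace ℝ (Fin k) × EuclideanSpace ℝ (Fin m) →
      EuclideanSpace ℝ (Fin k) × EuclideanSpace ℝ (Fin m) := fun w => (w.1, 0)
  have hr : ContDiff ℝ ∞ r := contDiff_fst.prodMk contDiff_const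
  have h1 : ContMDiffAt I 𝓘(ℝ, EuclideanSpace ℝ (Fin k) × EuclideanSpace ℝ (Fin m)) ∞
      (fun y => r (c.e y)) x := hr.contMDiff.contMDiffAt.comp x (c.contMDiffAt_toFun hc)
  have h2 : ContMDiffWithinAt I I ∞ (fun y => c.e.symm (r (c.e y))) c.e.source x :=
    (c.contMDiffWithinAt_symm (c.mk_mem_target hc 0)).comp (t := modelSet k m) x
      h1.contMDiffWithinAt (fun y hy => c.target_subset (c.mk_mem_target hy 0))
  refine (h2.contMDiffAt (c.isOpen_source.mem_nhds hc)).congr_of_eventuallyEq ?_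
  filter_upwards [c.isOpen_source.mem_nhds hc] with y hy using c.proj_eq hy

/-- `q` is the square of a smooth fibrewise Euclidean norm, normalized so that its unit disc bundle
is compact and lies in `U`. -/
structure IsFibreNormSq (U : Set M) (q : M → ℝ) : Prop where
  contMDiffAt : ∀ x ∈ N.total, ContMDiffAt I 𝓘(ℝ, ℝ) ∞ q x
  nonneg : ∀ x ∈ N.total, 0 ≤ q x
  smul : ∀ x ∈ N.total, ∀ t, q (N.smul t x) = t ^ 2 * q x
  eq_zero_iff : ∀ x ∈ N.total, q x = 0 ↔ x ∈ B
  isCompact_disc : IsCompact {x | x ∈ N.total ∧ q x ≤ 1}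
  disc_subset : ∀ x ∈ N.total, q x ≤ 1 → x ∈ U

variable [FiniteDimensional ℝ V] [T2Space M] [IsManifold I ∞ M]

/-- Near a point of the base there is a function, quadratic on the fibres, whose unit disc bundle
is as small as desired. -/
theorem exists_local_fibreNormSq {b : M} (hb : b ∈ B) {W : Set M} (hW : W ∈ 𝓝 b) :
    ∃ (q : M → ℝ) (O : Set M), O ∈ 𝓝 b ∧ (∀ x ∈ N.total, ContMDiffAt I 𝓘(ℝ, ℝ) ∞ q x) ∧
      (∀ x, 0 ≤ q x) ∧ (∀ x ∈ N.total, ∀ t, q (N.smul t x) = t ^ 2 * q x) ∧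
      (∀ x ∈ B, q x = 0) ∧
      ∀ x ∈ N.total, N.proj x ∈ O → (q x ≤ 1 → x ∈ W) ∧ (q x = 0 → x ∈ B) := by
  obtain ⟨k, m, c, hc⟩ := N.exists_chart b hb
  obtain ⟨f, -, hf⟩ := (SmoothBumpFunction.nhds_basis_tsupport (I := I) b).mem_iff.1
    (c.isOpen_source.mem_nhds hc)
  have heb : c.e b = ((c.e b).1, 0) := by
    rw [← (N.mem_base_iff_snd c hc).1 hb]
  have htb : ((c.e b).1, (0 : EuclideanSpace ℝ (Fin m))) ∈ c.e.target := c.mk_mem_target hc 0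
  have hsymm : c.e.symm ((c.e b).1, 0) = b := by
    rw [← heb]; exact c.e.left_inv hc
  have hcont := (c.contMDiffWithinAt_symm htb).continuousWithinAt
  rw [ContinuousWithinAt, hsymm] at hcont
  obtain ⟨δ, hδ, hball⟩ := Metric.mem_nhdsWithin_iff.1 (hcont hW)
  set R := δ / 2 with hR
  have hRpos : 0 < R := half_pos hδ
  let q : M → ℝ := fun x => f (N.proj x) * (‖(c.e x).2‖ ^ 2 / R ^ 2)
  have hzero : ∀ x ∈ N.total, x ∉ c.e.source → f (N.proj x) = 0 := by
    intro x hx hxs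
    by_contra hne
    exact hxs (c.saturated x hx (hf (subset_tsupport _ hne)))
  have hO : {y | f y = 1} ∩ (c.e.source ∩ {y | dist (c.e y).1 (c.e b).1 < δ}) ∈ 𝓝 b := by
    refine inter_mem f.eventuallyEq_one (inter_mem (c.isOpen_source.mem_nhds hc) ?_)
    have h1 : ContinuousAt (fun y => (c.e y).1) b := (c.contMDiffAt_toFun hc).continuousAt.fst
    exact h1 (Metric.ball_mem_nhds _ hδ)
  refine ⟨q, _, hO, ?_, ?_, ?_, ?_, ?_⟩
  · intro x hx
    by_cases hxs : N.proj x ∈ tsupport f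
    · have hxc : x ∈ c.e.source := c.saturated x hx (hf hxs)
      have h1 : ContMDiffAt I 𝓘(ℝ, ℝ) ∞ (fun y => f (N.proj y)) x :=
        (f.contMDiff.contMDiffAt).comp x (N.contMDiffAt_proj hx)
      have h2 : ContDiff ℝ ∞ (fun w : EuclideanSpace ℝ (Fin k) × EuclideanSpace ℝ (Fin m) =>
          ‖w.2‖ ^ 2 / R ^ 2) := (contDiff_snd.norm_sq ℝ).div_const _
      exact h1.mul (h2.contMDiff.contMDiffAt.comp x (c.contMDiffAt_toFun hxc))
    · have h1 : ∀ᶠ y in 𝓝 x, q y = 0 := by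
        have h2 : ∀ᶠ z in 𝓝 (N.proj x), f z = 0 := by
          have := (isClosed_tsupport f).isOpen_compl.mem_nhds hxs
          filter_upwards [this] with z hz
          exact image_eq_zero_of_notMem_tsupport hz
        filter_upwards [(N.contMDiffAt_proj hx).continuousAt.eventually h2] with y hy
        simp [q, hy]
      exact (contMDiffAt_const (c := (0 : ℝ))).congr_of_eventuallyEq h1
  · intro x
    exact mul_nonneg f.nonneg (by positivity)
  · intro x hx t
    simp only [q, N.proj_smul hx]
    by_cases hxs : x ∈ c.e.source
    · rw [c.apply_smul hxs, norm_smul, mul_pow, Real.norm_eq_abs, sq_abs]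
      ring
    · rw [hzero x hx hxs]; ring
  · intro x hx
    have hxt := N.base_subset hx
    by_cases hxs : x ∈ c.e.source
    · simp [q, (N.mem_base_iff_snd c hxs).1 hx]
    · simp [q, hzero x hxt hxs]
  · rintro x hx ⟨h1, h2, h3⟩
    have hxs : x ∈ c.e.source := c.saturated x hx h2
    have hqx : q x = ‖(c.e x).2‖ ^ 2 / R ^ 2 := by
      have h1' : f (N.proj x) = 1 := h1
      simp only [q, h1', one_mul]
    refine ⟨fun h => ?_, fun h => ?_⟩
    · rw [hqx, div_le_one (by positivity)] at h
      have h4 : ‖(c.e x).2‖ ≤ R := le_of_sq_le_sq h hRpos.le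
      have h5 : c.e x ∈ Metric.ball ((c.e b).1, (0 : EuclideanSpace ℝ (Fin m))) δ := by
        rw [Metric.mem_ball, Prod.dist_eq]
        refine max_lt ?_ ?_
        · have : dist (c.e (N.proj x)).1 (c.e b).1 < δ := h3
          rwa [c.apply_proj hxs] at this
        · rw [dist_zero_right]
          linarith
      have h6 := hball ⟨h5, c.target_subset (c.e.map_source hxs)⟩
      rw [mem_preimage, c.e.left_inv hxs] at h6
      exact h6
    · rw [hqx, div_eq_zero_iff] at h
      rcases h with h | h
      · exact (N.mem_base_iff_snd c hxs).2 (by simpa using h)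
      · exact absurd h (by positivity)

omit [FiniteDimensional ℝ V] [IsManifold I ∞ M] in
theorem isCompact_base {U : Set M} (hUN : U ⊆ N.total) (hBU : B ⊆ U) (hU : IsCompact U) :
    IsCompact B := by
  have h1 : IsClosed (U ∩ (fun x => (N.proj x, x)) ⁻¹' diagonal M) := by
    refine ContinuousOn.preimage_isClosed_of_isClosed ?_ hU.isClosed isClosed_diagonal
    exact fun x hx => ((N.contMDiffAt_proj (hUN hx)).continuousAt.prodMk
      continuousAt_id).continuousWithinAt
  have h2 : B = U ∩ (fun x => (N.proj x, x)) ⁻¹' diagonal M := by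
    ext x
    refine ⟨fun h => ⟨hBU h, N.proj_base x h⟩, fun h => ?_⟩
    exact (N.mem_base_iff (hUN h.1)).2 h.2
  rw [h2]
  exact hU.of_isClosed_subset h1 inter_subset_left

/-- A compact neighbourhood of the base contains the unit disc bundle of some fibre norm: finitely
many local quadratic forms, cut off in the base, are added. -/
theorem exists_isFibreNormSq {U : Set M} (hUN : U ⊆ N.total) (hUB : U ∈ 𝓝ˢ B)
    (hU : IsCompact U) : ∃ q, N.IsFibreNormSq U q := by
  have hBc := N.isCompact_base hUN (subset_of_mem_nhdsSet hUB) hU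
  choose! q O hO hsm hnn hhom hzero hloc using
    fun (b : M) (hb : b ∈ B) => N.exists_local_fibreNormSq hb (mem_nhdsSet_iff_forall.1 hUB b hb)
  obtain ⟨s, hsB, hs⟩ := hBc.elim_nhds_subcover O hO
  have hle : ∀ b ∈ s, ∀ x, q b x ≤ ∑ b ∈ s, q b x := fun b hb x =>
    Finset.single_le_sum (f := fun b => q b x) (fun b hb => hnn b (hsB b hb) x) hb
  have hmem : ∀ x ∈ N.total, ∃ b ∈ s, N.proj x ∈ O b := fun x hx => by
    simpa using hs (N.proj_mem x hx)
  have hsub : ∀ x ∈ N.total, ∑ b ∈ s, q b x ≤ 1 → x ∈ U := by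
    intro x hx h
    obtain ⟨b, hb, hxb⟩ := hmem x hx
    exact (hloc b (hsB b hb) x hx hxb).1 ((hle b hb x).trans h)
  have hcont : ∀ x ∈ N.total, ContMDiffAt I 𝓘(ℝ, ℝ) ∞ (fun x => ∑ b ∈ s, q b x) x :=
    fun x hx => ContMDiffAt.sum fun b hb => hsm b (hsB b hb) x hx
  refine ⟨fun x => ∑ b ∈ s, q b x, hcont, ?_, ?_, ?_, ?_, hsub⟩
  · exact fun x _ => Finset.sum_nonneg fun b hb => hnn b (hsB b hb) x
  · intro x hx t
    rw [Finset.mul_sum]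
    exact Finset.sum_congr rfl fun b hb => hhom b (hsB b hb) x hx t
  · intro x hx
    refine ⟨fun h => ?_, fun h => Finset.sum_eq_zero fun b hb => hzero b (hsB b hb) x h⟩
    obtain ⟨b, hb, hxb⟩ := hmem x hx
    refine (hloc b (hsB b hb) x hx hxb).2 (le_antisymm ?_ (hnn b (hsB b hb) x))
    exact (hle b hb x).trans h.le
  · have h1 : {x | x ∈ N.total ∧ ∑ b ∈ s, q b x ≤ 1} =
        U ∩ (fun x => ∑ b ∈ s, q b x) ⁻¹' Iic 1 := by
      ext x
      exact ⟨fun h => ⟨hsub x h.1 h.2, h.2⟩, fun h => ⟨hUN h.1, h.2⟩⟩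
    rw [h1]
    refine hU.of_isClosed_subset ?_ inter_subset_left
    exact ContinuousOn.preimage_isClosed_of_isClosed
      (fun x hx => (hcont x (hUN hx)).continuousAt.continuousWithinAt) hU.isClosed isClosed_Iic

end RegularNeighborhood

end FibreNorm

/-! ### Conjugation by dilations of the fibres -/

section Dilations

open Filter

variable {V : Type*} [NormedAddCommGroup V] [NormedSpace ℝ V]
  {H : Type*} [TopologicalSpace H] {I : ModelWithCorners ℝ V H}
  {M : Type u} [TopologicalSpace M] [ChartedSpace H M]

namespace RegularNeighborhood

variable {B : Set M} (N : RegularNeighborhood I B)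

/-- The conjugate `x ↦ a⁻¹ h (a x)` of the map `h` by the multiplication by `a` in the fibres of
the regular neighbourhood; for `a = 0` it is the limit of the conjugates by nonzero numbers. -/
noncomputable def dil (h : M → M) (a : ℝ) (x : M) : M :=
  open Classical in
  if a = 0 then @limUnder _ _ _ ⟨x⟩ (𝓝[≠] (0 : ℝ)) fun r => N.smul r⁻¹ (h (N.smul r x))
  else N.smul a⁻¹ (h (N.smul a x))

theorem dil_of_ne (h : M → M) {a : ℝ} (ha : a ≠ 0) (x : M) :
    N.dil h a x = N.smul a⁻¹ (h (N.smul a x)) := by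
  rw [dil, if_neg ha]

theorem dil_one {h : M → M} {x : M} (hx : x ∈ N.total) (hhx : h x ∈ N.total) :
    N.dil h 1 x = h x := by
  rw [N.dil_of_ne h one_ne_zero, inv_one, N.smul_one hx, N.smul_one hhx]

theorem dil_zero_eq [T2Space M] {h : M → M} {x y : M}
    (hxy : Tendsto (fun r : ℝ => N.smul r⁻¹ (h (N.smul r x))) (𝓝[≠] (0 : ℝ)) (𝓝 y)) :
    N.dil h 0 x = y := by
  rw [dil, if_pos rfl]
  exact @Tendsto.limUnder_eq _ _ _ _ _ _ _ _ hxy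

variable [T2Space M] [IsManifold I ∞ M]

section Fixed

variable {h : M → M} (hh : ContMDiff I I ∞ h) (hB : MapsTo h B B)

include hh hB

omit [T2Space M] [IsManifold I ∞ M] in
/-- The conjugates of a smooth map preserving the base converge, on each fibre, to a linear map. -/
theorem exists_linear_dil_zero {x : M} (hx : x ∈ N.total) {k m : ℕ}
    (c : TrivializedChart I N.total N.proj N.smul N.add k m) (hc : x ∈ c.e.source) :
    ∃ (k' m' : ℕ) (c' : TrivializedChart I N.total N.proj N.smul N.add k' m')
      (L : EuclideanSpace ℝ (Fin m) →L[ℝ] EuclideanSpace ℝ (Fin m')),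
      h (N.proj x) ∈ c'.e.source ∧ ∀ v : EuclideanSpace ℝ (Fin m),
        Tendsto (fun r : ℝ => N.smul r⁻¹ (h (N.smul r (c.e.symm ((c.e x).1, v))))) (𝓝[≠] (0 : ℝ))
          (𝓝 (c'.e.symm ((c'.e (h (N.proj x))).1, L v))) := by
  have hpB : h (N.proj x) ∈ B := hB (N.proj_mem x hx)
  obtain ⟨k', m', c', hc'⟩ := N.exists_chart _ hpB
  set u := (c.e x).1 with hu
  have htar : ∀ v, (u, v) ∈ c.e.target := fun v => c.mk_mem_target hc v
  have hsrc : ∀ v, c.e.symm (u, v) ∈ c.e.source := fun v => c.e.map_target (htar v)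
  have h0 : c.e.symm (u, 0) = N.proj x := (c.proj_eq hc).symm
  -- the fibre coordinate of `h` along the fibre
  let A : EuclideanSpace ℝ (Fin m) → EuclideanSpace ℝ (Fin k') × EuclideanSpace ℝ (Fin m') :=
    fun v => c'.e (h (c.e.symm (u, v)))
  have hsymm : ContMDiff 𝓘(ℝ, EuclideanSpace ℝ (Fin m)) I ∞ fun v => c.e.symm (u, v) := by
    rw [← contMDiffOn_univ]
    exact c.contMDiffOn_invFun.comp (t := c.e.target)
      (contDiff_const.prodMk contDiff_id).contMDiff.contMDiffOn (fun v _ => htar v)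
  have hA : ContDiffAt ℝ ∞ A 0 := by
    rw [← contMDiffAt_iff_contDiffAt]
    refine ContMDiffAt.comp (0 : EuclideanSpace ℝ (Fin m)) (g := c'.e) (I' := I) ?_
      (hh.comp hsymm).contMDiffAt
    simp only [h0]
    exact c'.contMDiffAt_toFun hc'
  have hA0 : A 0 = ((c'.e (h (N.proj x))).1, 0) := by
    simp only [A, h0]
    rw [← (N.mem_base_iff_snd c' hc').1 hpB]
  have hd : HasFDerivAt (fun v => (A v).2) (fderiv ℝ (fun v => (A v).2) 0) 0 :=
    (hA.snd.differentiableAt (by simp)).hasFDerivAt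
  refine ⟨k', m', c', fderiv ℝ (fun v => (A v).2) 0, hc', fun v => ?_⟩
  set L := fderiv ℝ (fun v => (A v).2) 0
  have hcurve : Tendsto (fun r : ℝ => r • v) (𝓝 0) (𝓝 (0 : EuclideanSpace ℝ (Fin m))) :=
    Continuous.tendsto' (by fun_prop) _ _ (zero_smul _ _)
  have h1 : Tendsto (fun r : ℝ => r⁻¹ • (A (r • v)).2) (𝓝[≠] 0) (𝓝 (L v)) := by
    have h2 : HasDerivAt (fun r : ℝ => (A (r • v)).2) (L v) 0 := by
      have h3 : HasDerivAt (fun r : ℝ => r • v) v 0 := by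
        simpa using (hasDerivAt_id (0 : ℝ)).smul_const v
      refine HasFDerivAt.comp_hasDerivAt (l := fun v => (A v).2) (f := fun r : ℝ => r • v)
        (0 : ℝ) ?_ h3
      rwa [zero_smul]
    have := h2.tendsto_slope_zero
    simpa [hA0] using this
  have h2 : Tendsto (fun r : ℝ => (A (r • v)).1) (𝓝[≠] 0) (𝓝 (c'.e (h (N.proj x))).1) := by
    have h3 := (hA.continuousAt.fst.tendsto.comp hcurve).mono_left
      (nhdsWithin_le_nhds (s := {0}ᶜ))
    rwa [hA0] at h3
  have hev : ∀ᶠ r : ℝ in 𝓝[≠] 0, h (c.e.symm (u, r • v)) ∈ c'.e.source := by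
    have h3 : Tendsto (fun r : ℝ => h (c.e.symm (u, r • v))) (𝓝 0) (𝓝 (h (N.proj x))) := by
      have := ((hh.comp hsymm).continuous.tendsto 0).comp hcurve
      rwa [Function.comp_apply, h0] at this
    exact nhdsWithin_le_nhds (h3.eventually (c'.isOpen_source.mem_nhds hc'))
  have htar' := c'.mk_mem_target hc' (L v)
  have h4 : Tendsto (fun r : ℝ => ((A (r • v)).1, r⁻¹ • (A (r • v)).2)) (𝓝[≠] 0)
      (𝓝[modelSet k' m'] ((c'.e (h (N.proj x))).1, L v)) := by
    refine tendsto_nhdsWithin_iff.2 ⟨h2.prodMk_nhds h1, ?_⟩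
    filter_upwards [hev] with r hr using c'.target_subset (c'.mk_mem_target hr _)
  refine Tendsto.congr' ?_ ((c'.contMDiffWithinAt_symm htar').continuousWithinAt.tendsto.comp h4)
  filter_upwards [hev] with r hr
  have h5 : N.smul r (c.e.symm (u, v)) = c.e.symm (u, r • v) :=
    c.smul_symm u (c.fst_mem hc) r v
  rw [h5, c'.smul_eq hr]
  rfl

omit [IsManifold I ∞ M] in
theorem tendsto_dil_zero {x : M} (hx : x ∈ N.total) :
    Tendsto (fun r : ℝ => N.smul r⁻¹ (h (N.smul r x))) (𝓝[≠] (0 : ℝ)) (𝓝 (N.dil h 0 x)) := by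
  obtain ⟨k, m, c, hc⟩ := N.exists_chart_of_mem hx
  obtain ⟨k', m', c', L, -, hL⟩ := N.exists_linear_dil_zero hh hB hx c hc
  have := hL (c.e x).2
  rw [c.e.left_inv hc] at this
  rwa [N.dil_zero_eq this]

omit [IsManifold I ∞ M] in
theorem dil_zero_mem {x : M} (hx : x ∈ N.total) :
    N.dil h 0 x ∈ N.total ∧ N.proj (N.dil h 0 x) = h (N.proj x) := by
  obtain ⟨k, m, c, hc⟩ := N.exists_chart_of_mem hx
  obtain ⟨k', m', c', L, hc', hL⟩ := N.exists_linear_dil_zero hh hB hx c hc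
  have := hL (c.e x).2
  rw [c.e.left_inv hc] at this
  rw [N.dil_zero_eq this]
  refine ⟨c'.source_subset (c'.e.map_target (c'.mk_mem_target hc' _)), ?_⟩
  rw [c'.proj_symm _ (c'.fst_mem hc'), ← c'.proj_eq hc']
  exact N.proj_base _ (hB (N.proj_mem x hx))

omit [IsManifold I ∞ M] in
theorem dil_zero_add {x y : M} (hx : x ∈ N.total) (hy : y ∈ N.total) (hxy : N.proj x = N.proj y) :
    N.dil h 0 (N.add x y) = N.add (N.dil h 0 x) (N.dil h 0 y) := by
  obtain ⟨k, m, c, hc⟩ := N.exists_chart_of_mem hx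
  obtain ⟨k', m', c', L, hc', hL⟩ := N.exists_linear_dil_zero hh hB hx c hc
  have hcy : y ∈ c.e.source := c.saturated y hy (hxy ▸ c.proj_mem hc)
  have hu : (c.e y).1 = (c.e x).1 := by
    have h1 := c.apply_proj hc
    have h2 := c.apply_proj hcy
    rw [hxy, h2] at h1
    exact (Prod.mk.inj h1).1
  have hx' : x = c.e.symm ((c.e x).1, (c.e x).2) := (c.e.left_inv hc).symm
  have hy' : y = c.e.symm ((c.e x).1, (c.e y).2) := by
    rw [← hu]; exact (c.e.left_inv hcy).symm
  have hadd : N.add x y = c.e.symm ((c.e x).1, (c.e x).2 + (c.e y).2) := by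
    rw [← c.add_symm _ (c.fst_mem hc), ← hx', ← hy']
  rw [hadd, N.dil_zero_eq (hL _), map_add, ← c'.add_symm _ (c'.fst_mem hc'),
    ← N.dil_zero_eq (hL _), ← N.dil_zero_eq (hL _), ← hx', ← hy']

omit [IsManifold I ∞ M] in
theorem dil_mem {a : ℝ} {x : M} (hx : x ∈ N.total) (hax : h (N.smul a x) ∈ N.total) :
    N.dil h a x ∈ N.total := by
  by_cases ha : a = 0
  · subst ha
    exact (N.dil_zero_mem hh hB hx).1
  · rw [N.dil_of_ne h ha]
    exact N.smul_mem hax _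

omit [IsManifold I ∞ M] in
theorem smul_dil {a : ℝ} {x : M} (hx : x ∈ N.total) (hax : h (N.smul a x) ∈ N.total) :
    N.smul a (N.dil h a x) = h (N.smul a x) := by
  by_cases ha : a = 0
  · subst ha
    obtain ⟨h1, h2⟩ := N.dil_zero_mem hh hB hx
    rw [N.smul_zero h1, h2, N.smul_zero hx]
  · rw [N.dil_of_ne h ha, N.smul_smul_inv hax ha]

omit hh [IsManifold I ∞ M] in
theorem dil_base {b : M} (hb : b ∈ B) (a : ℝ) : N.dil h a b = h b := by
  have hbt := N.base_subset hb
  by_cases ha : a = 0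
  · subst ha
    refine N.dil_zero_eq ?_
    simp only [N.smul_base hb, N.smul_base (hB hb)]
    exact tendsto_const_nhds
  · rw [N.dil_of_ne h ha, N.smul_base hb, N.smul_base (hB hb)]

omit [IsManifold I ∞ M] in
theorem dil_smul {a s : ℝ} {x : M} (hx : x ∈ N.total) (hax : h (N.smul (a * s) x) ∈ N.total) :
    N.dil h a (N.smul s x) = N.smul s (N.dil h (a * s) x) := by
  by_cases hs : s = 0
  · subst hs
    rw [N.dil_base hB (N.smul_zero_mem hx), mul_zero] at *
    rw [N.smul_dil hh hB hx hax]
  by_cases ha : a = 0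
  · subst ha
    rw [zero_mul] at *
    refine N.dil_zero_eq ?_
    have h1 : Tendsto (fun r : ℝ => r * s) (𝓝[≠] 0) (𝓝[≠] 0) := by
      refine tendsto_nhdsWithin_iff.2 ⟨?_, ?_⟩
      · exact (Continuous.tendsto' (f := fun r : ℝ => r * s) (by fun_prop) _ _
          (zero_mul s)).mono_left
          nhdsWithin_le_nhds
      · filter_upwards [self_mem_nhdsWithin] with r hr using mul_ne_zero hr hs
    have h2 := (N.continuousAt_smul (t := s) (N.dil_zero_mem hh hB hx).1).tendsto.comp
      ((tendsto_const_nhds (x := s)).prodMk_nhds ((N.tendsto_dil_zero hh hB hx).comp h1))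
    refine Tendsto.congr' ?_ h2
    have hev : ∀ᶠ r : ℝ in 𝓝[≠] 0, h (N.smul (r * s) x) ∈ N.total := by
      have h3 : ContinuousAt (fun r : ℝ => h (N.smul (r * s) x)) 0 := by
        refine ContinuousAt.comp (g := h) hh.continuous.continuousAt ?_
        exact ContinuousAt.comp (f := fun r : ℝ => (r * s, x))
          (g := fun w : ℝ × M => N.smul w.1 w.2) (N.continuousAt_smul hx)
          (Continuous.continuousAt (by fun_prop))
      refine nhdsWithin_le_nhds (h3.eventually (N.isOpen_total.mem_nhds ?_))
      simpa only [zero_mul] using hax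
    filter_upwards [self_mem_nhdsWithin, hev] with r hr hrt
    have hr' : r ≠ 0 := hr
    simp only [Function.comp_apply]
    rw [N.smul_smul hrt, N.smul_smul hx, mul_inv, mul_comm r⁻¹ s⁻¹, ← mul_assoc,
      mul_inv_cancel₀ hs, one_mul]
  · rw [N.dil_of_ne h ha, N.dil_of_ne h (mul_ne_zero ha hs), N.smul_smul hx, N.smul_smul hax,
      mul_inv, mul_comm a⁻¹ s⁻¹, ← mul_assoc, mul_inv_cancel₀ hs, one_mul]

end Fixed

section Family

variable {T : Type*} [TopologicalSpace T] {h : T → M → M}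

omit [T2Space M] [IsManifold I ∞ M] in
theorem _root_.TrivializedChart.eventually_mem_target {E : Set M} {proj : M → M}
    {smul : ℝ → M → M} {add : M → M → M} {k m : ℕ} (c : TrivializedChart I E proj smul add k m)
    {w₀ : EuclideanSpace ℝ (Fin k) × EuclideanSpace ℝ (Fin m)} (hw₀ : w₀ ∈ c.e.target)
    (τ₀ : T) (a₀ : ℝ) :
    ∀ᶠ q : T × (ℝ × (EuclideanSpace ℝ (Fin k) × EuclideanSpace ℝ (Fin m))) in
      𝓝[univ ×ˢ (univ ×ˢ modelSet k m)] (τ₀, (a₀, w₀)), q.2.2 ∈ c.e.target := by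
  have h1 : Tendsto (fun q : T × (ℝ × (EuclideanSpace ℝ (Fin k) × EuclideanSpace ℝ (Fin m))) =>
      q.2.2) (𝓝[univ ×ˢ (univ ×ˢ modelSet k m)] (τ₀, (a₀, w₀))) (𝓝[modelSet k m] w₀) :=
    tendsto_nhdsWithin_iff.2 ⟨(Continuous.tendsto' (by fun_prop) _ _ rfl).mono_left
      nhdsWithin_le_nhds, by filter_upwards [self_mem_nhdsWithin] with q hq using hq.2.2⟩
  exact h1.eventually (c.target_mem_nhdsWithin hw₀)

omit [T2Space M] [IsManifold I ∞ M] in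
theorem _root_.TrivializedChart.smul_symm' {E : Set M} {proj : M → M}
    {smul : ℝ → M → M} {add : M → M → M} {k m : ℕ} (c : TrivializedChart I E proj smul add k m)
    {w : EuclideanSpace ℝ (Fin k) × EuclideanSpace ℝ (Fin m)} (hw : w ∈ c.e.target) (a : ℝ) :
    smul a (c.e.symm w) = c.e.symm (w.1, a • w.2) := by
  obtain ⟨u, v⟩ := w
  rw [c.target_eq] at hw
  exact c.smul_symm u hw.1 a v

omit [T2Space M] in
theorem manifoldFamilyAt_smul (hh : ∀ τ x, MapFamilyAt I h τ x)
    {k m : ℕ} (c : TrivializedChart I N.total N.proj N.smul N.add k m) (τ₀ : T) (a₀ : ℝ)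
    {w₀ : EuclideanSpace ℝ (Fin k) × EuclideanSpace ℝ (Fin m)} (hw₀ : w₀ ∈ c.e.target) :
    ManifoldFamilyAt I (fun τ (z : ℝ × (EuclideanSpace ℝ (Fin k) × EuclideanSpace ℝ (Fin m))) =>
      h τ (N.smul z.1 (c.e.symm z.2))) (univ ×ˢ modelSet k m) (τ₀, (a₀, w₀)) := by
  set S : Set (ℝ × (EuclideanSpace ℝ (Fin k) × EuclideanSpace ℝ (Fin m))) :=
    univ ×ˢ modelSet k m with hS
  have hSu : UniqueDiffOn ℝ S := uniqueDiffOn_univ.prod (uniqueDiffOn_modelSet k m)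
  have hpS : (a₀, w₀) ∈ S := ⟨mem_univ _, c.target_subset hw₀⟩
  have hd : SmoothFamilyAt (fun (_ : T)
      (z : ℝ × (EuclideanSpace ℝ (Fin k) × EuclideanSpace ℝ (Fin m))) => (z.2.1, z.1 • z.2.2)) S
      (τ₀, (a₀, w₀)) :=
    smoothFamilyAt_const (ContDiff.contDiffWithinAt (by fun_prop)) hSu hpS
  have hd' := hd.contMDiffWithinAt_comp (g := c.e.symm) (I := I) (t := modelSet k m)
    (c.contMDiffWithinAt_symm (c.mk_mem_target' hw₀ _)) hSu (uniqueDiffOn_modelSet k m) hpS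
    (by filter_upwards [self_mem_nhdsWithin] with q hq using ⟨hq.2.2.1, mem_univ _⟩)
  refine ((hh τ₀ _).apply_comp hd' hSu hpS).congr hpS ?_
  filter_upwards [c.eventually_mem_target hw₀ τ₀ a₀] with q hq
  rw [c.smul_symm' hq]

/-- The conjugates of a family of maps by the dilations form a smooth family, also near the zero
dilation, where it is given by division of the fibre coordinate by the dilation factor. -/
theorem manifoldFamilyAt_dil (hh : ∀ τ x, MapFamilyAt I h τ x) (hB : ∀ τ, MapsTo (h τ) B B)
    {k m : ℕ} (c : TrivializedChart I N.total N.proj N.smul N.add k m) {τ₀ : T} {a₀ : ℝ}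
    {w₀ : EuclideanSpace ℝ (Fin k) × EuclideanSpace ℝ (Fin m)} (hw₀ : w₀ ∈ c.e.target)
    (hmem : h τ₀ (N.smul a₀ (c.e.symm w₀)) ∈ N.total) :
    ManifoldFamilyAt I (fun τ (z : ℝ × (EuclideanSpace ℝ (Fin k) × EuclideanSpace ℝ (Fin m))) =>
      N.dil (h τ) z.1 (c.e.symm z.2)) (univ ×ˢ modelSet k m) (τ₀, (a₀, w₀)) := by
  obtain ⟨k', m', c', hbase⟩ := N.exists_chart_of_mem hmem
  set S : Set (ℝ × (EuclideanSpace ℝ (Fin k) × EuclideanSpace ℝ (Fin m))) :=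
    univ ×ˢ modelSet k m with hS
  have hSu : UniqueDiffOn ℝ S := uniqueDiffOn_univ.prod (uniqueDiffOn_modelSet k m)
  have hpS : (a₀, w₀) ∈ S := ⟨mem_univ _, c.target_subset hw₀⟩
  have hhd := N.manifoldFamilyAt_smul hh c τ₀ a₀ hw₀
  -- the map `h τ` composed with the dilation, in the two charts
  let A : T → ℝ × (EuclideanSpace ℝ (Fin k) × EuclideanSpace ℝ (Fin m)) →
      EuclideanSpace ℝ (Fin k') × EuclideanSpace ℝ (Fin m') :=
    fun τ z => c'.e (h τ (N.smul z.1 (c.e.symm z.2)))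
  have hA : SmoothFamilyAt A S (τ₀, (a₀, w₀)) :=
    hhd.contMDiffAt_comp (c'.contMDiffAt_toFun hbase) hSu hpS
  have hA1 : SmoothFamilyAt (fun τ z => (A τ z).1) S (τ₀, (a₀, w₀)) :=
    hA.contDiffAt_comp contDiff_fst.contDiffAt hSu hpS
  have hA2 : SmoothFamilyAt (fun τ z => (A τ z).2) S (τ₀, (a₀, w₀)) :=
    hA.contDiffAt_comp contDiff_snd.contDiffAt hSu hpS
  have hev1 := c.eventually_mem_target hw₀ τ₀ a₀
  have hev2 : ∀ᶠ q : T × (ℝ × (EuclideanSpace ℝ (Fin k) × EuclideanSpace ℝ (Fin m))) in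
      𝓝[univ ×ˢ S] (τ₀, (a₀, w₀)), h q.1 (N.smul q.2.1 (c.e.symm q.2.2)) ∈ c'.e.source :=
    hhd.1.tendsto.eventually (c'.isOpen_source.mem_nhds hbase)
  -- it suffices to divide the fibre coordinate by the dilation factor
  have key : ∀ G : T → ℝ × (EuclideanSpace ℝ (Fin k) × EuclideanSpace ℝ (Fin m)) →
      EuclideanSpace ℝ (Fin m'), SmoothFamilyAt G S (τ₀, (a₀, w₀)) →
      (∀ᶠ q in 𝓝[univ ×ˢ S] (τ₀, (a₀, w₀)), q.2.1 • G q.1 q.2 = (A q.1 q.2).2) →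
      ManifoldFamilyAt I (fun τ z => N.dil (h τ) z.1 (c.e.symm z.2)) S (τ₀, (a₀, w₀)) := by
    intro G hG hGA
    have hmemt : ∀ᶠ q in 𝓝[univ ×ˢ S] (τ₀, (a₀, w₀)),
        ((A q.1 q.2).1, G q.1 q.2) ∈ modelSet k' m' := by
      filter_upwards [hev2] with q hq using c'.target_subset (c'.mk_mem_target hq _)
    have h1 := (hA1.prodMk hG hSu hpS).contMDiffWithinAt_comp (g := c'.e.symm) (I := I)
      (t := modelSet k' m') (c'.contMDiffWithinAt_symm (c'.mk_mem_target hbase _)) hSu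
      (uniqueDiffOn_modelSet k' m') hpS hmemt
    have hne : ∀ᶠ q : T × (ℝ × (EuclideanSpace ℝ (Fin k) × EuclideanSpace ℝ (Fin m))) in
        𝓝[univ ×ˢ S] (τ₀, (a₀, w₀)), q.2.1 ≠ 0 →
        N.smul q.2.1⁻¹ (h q.1 (N.smul q.2.1 (c.e.symm q.2.2))) =
          c'.e.symm ((A q.1 q.2).1, G q.1 q.2) := by
      filter_upwards [hev2, hGA] with q hq2 hq3 hq
      rw [c'.smul_eq hq2]
      have : (c'.e (h q.1 (N.smul q.2.1 (c.e.symm q.2.2)))).2 = q.2.1 • G q.1 q.2 := hq3.symm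
      rw [this, inv_smul_smul₀ hq]
    refine h1.congr hpS ?_
    filter_upwards [h1.eventually_continuousWithinAt, hne, eventually_eventually_nhdsWithin.2 hne,
      self_mem_nhdsWithin] with q hqc hq1 hq2 hqS
    by_cases hq0 : q.2.1 = 0
    · obtain ⟨τ, a, w⟩ := q
      simp only at hq0
      subst hq0
      refine N.dil_zero_eq ?_
      have hcurve : Tendsto (fun r : ℝ => (τ, (r, w))) (𝓝[≠] 0)
          (𝓝[univ ×ˢ S] (τ, ((0 : ℝ), w))) :=
        tendsto_nhdsWithin_iff.2 ⟨(Continuous.tendsto' (by fun_prop) _ _ rfl).mono_left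
          nhdsWithin_le_nhds, Eventually.of_forall fun r => ⟨mem_univ _, mem_univ _, hqS.2.2⟩⟩
      refine Tendsto.congr' ?_ (hqc.tendsto.comp hcurve)
      filter_upwards [hcurve.eventually hq2, self_mem_nhdsWithin] with r hr hr0
      exact (hr hr0).symm
    · rw [N.dil_of_ne _ hq0]
      exact hq1 hq0
  by_cases ha : a₀ = 0
  · subst ha
    have hzero : ∀ᶠ q : T × (ℝ × (EuclideanSpace ℝ (Fin k) × EuclideanSpace ℝ (Fin m))) in
        𝓝[univ ×ˢ S] (τ₀, ((0 : ℝ), w₀)), (A q.1 (0, q.2.2)).2 = 0 := by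
      have h1 : Tendsto (fun q : T × (ℝ × (EuclideanSpace ℝ (Fin k) × EuclideanSpace ℝ (Fin m))) =>
          (q.1, ((0 : ℝ), q.2.2))) (𝓝[univ ×ˢ S] (τ₀, ((0 : ℝ), w₀)))
          (𝓝[univ ×ˢ S] (τ₀, ((0 : ℝ), w₀))) :=
        tendsto_nhdsWithin_iff.2 ⟨(Continuous.tendsto' (by fun_prop) _ _ rfl).mono_left
          nhdsWithin_le_nhds, by
            filter_upwards [self_mem_nhdsWithin] with q hq using ⟨mem_univ _, mem_univ _, hq.2.2⟩⟩
      filter_upwards [hev1, h1.eventually hev2] with q hq1 hq2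
      refine (N.mem_base_iff_snd c' hq2).1 (hB q.1 ?_)
      exact N.smul_zero_mem (c.source_subset (c.e.map_target hq1))
    obtain ⟨G, hG, hGA⟩ := hA2.exists_smul_eq (uniqueDiffOn_modelSet k m) (convex_modelSet k m)
      (c.target_subset hw₀) hzero
    exact key G hG hGA
  · refine key (fun τ z => z.1⁻¹ • (A τ z).2) ?_ ?_
    · have h1 : SmoothFamilyAt (fun (_ : T)
          (z : ℝ × (EuclideanSpace ℝ (Fin k) × EuclideanSpace ℝ (Fin m))) => z.1) S
          (τ₀, (a₀, w₀)) :=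
        smoothFamilyAt_const contDiff_fst.contDiffWithinAt hSu hpS
      refine (h1.prodMk hA2 hSu hpS).contDiffAt_comp
        (g := fun y : ℝ × EuclideanSpace ℝ (Fin m') => y.1⁻¹ • y.2) ?_ hSu hpS
      exact (contDiff_fst.contDiffAt.inv ha).smul contDiff_snd.contDiffAt
    · have h1 : Tendsto (fun q : T × (ℝ × (EuclideanSpace ℝ (Fin k) × EuclideanSpace ℝ (Fin m))) =>
          q.2.1) (𝓝[univ ×ˢ S] (τ₀, (a₀, w₀))) (𝓝 a₀) :=
        (Continuous.tendsto' (by fun_prop) _ _ rfl).mono_left nhdsWithin_le_nhds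
      filter_upwards [h1.eventually_ne ha] with q hq
      rw [smul_inv_smul₀ hq]

theorem continuousAt_dil (hh : ∀ τ x, MapFamilyAt I h τ x) (hB : ∀ τ, MapsTo (h τ) B B)
    {τ₀ : T} {a₀ : ℝ} {x₀ : M} (hx₀ : x₀ ∈ N.total) (hmem : h τ₀ (N.smul a₀ x₀) ∈ N.total) :
    ContinuousAt (fun w : T × (ℝ × M) => N.dil (h w.1) w.2.1 w.2.2) (τ₀, (a₀, x₀)) := by
  obtain ⟨k, m, c, hc⟩ := N.exists_chart_of_mem hx₀
  have hinv : c.e.symm (c.e x₀) = x₀ := c.e.left_inv hc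
  have h1 := (N.manifoldFamilyAt_dil hh hB c (c.e.map_source hc) (a₀ := a₀)
    (by rwa [hinv])).1
  have h2 : Tendsto (fun w : T × (ℝ × M) => (w.1, (w.2.1, c.e w.2.2))) (𝓝 (τ₀, (a₀, x₀)))
      (𝓝[univ ×ˢ (univ ×ˢ modelSet k m)] (τ₀, (a₀, c.e x₀))) := by
    refine tendsto_nhdsWithin_iff.2 ⟨?_, ?_⟩
    · refine continuousAt_fst.tendsto.prodMk_nhds
        ((continuousAt_fst.comp continuousAt_snd).tendsto.prodMk_nhds ?_)
      exact ContinuousAt.comp (f := fun w : T × (ℝ × M) => w.2.2) (x := (τ₀, (a₀, x₀)))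
        (c.contMDiffAt_toFun hc).continuousAt (Continuous.continuousAt (by fun_prop))
    · have : ∀ᶠ w : T × (ℝ × M) in 𝓝 (τ₀, (a₀, x₀)), w.2.2 ∈ c.e.source :=
        (Continuous.continuousAt (f := fun w : T × (ℝ × M) => w.2.2) (by fun_prop)).eventually
          (c.isOpen_source.mem_nhds hc)
      filter_upwards [this] with w hw
        using ⟨mem_univ _, mem_univ _, c.target_subset (c.e.map_source hw)⟩
  have h3 := h1.tendsto.comp h2
  simp only [hinv] at h3
  refine Tendsto.congr' ?_ h3
  have : ∀ᶠ w : T × (ℝ × M) in 𝓝 (τ₀, (a₀, x₀)), w.2.2 ∈ c.e.source :=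
    (Continuous.continuousAt (f := fun w : T × (ℝ × M) => w.2.2) (by fun_prop)).eventually
      (c.isOpen_source.mem_nhds hc)
  filter_upwards [this] with w hw
  simp only [Function.comp_apply, c.e.left_inv hw]

end Family

section Inverse

variable {h k : M → M}

/-- The conjugates of inverse maps are inverse to each other. -/
theorem dil_dil (hh : ContMDiff I I ∞ h) (hk : ContMDiff I I ∞ k) (hB : MapsTo h B B)
    (kB : MapsTo k B B) (hkh : ∀ x, k (h x) = x) {a : ℝ} {x : M} (hx : x ∈ N.total)
    (hax : h (N.smul a x) ∈ N.total) : N.dil k a (N.dil h a x) = x := by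
  have hne : ∀ r : ℝ, r ≠ 0 → h (N.smul r x) ∈ N.total → N.dil k r (N.dil h r x) = x := by
    intro r hr hrx
    rw [N.dil_of_ne k hr, N.smul_dil hh hB hx hrx, hkh, N.smul_inv_smul hx hr]
  by_cases ha : a = 0
  · subst ha
    obtain ⟨h1, h2⟩ := N.dil_zero_mem hh hB hx
    have hc := N.continuousAt_dil (T := Unit) (h := fun _ => k) (τ₀ := ()) (a₀ := 0)
      (fun _ x => mapFamilyAt_const hk.contMDiffAt) (fun _ => kB) h1
      (N.base_subset (kB (N.smul_zero_mem h1)))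
    have hd : Tendsto (fun r : ℝ => N.dil h r x) (𝓝[≠] 0) (𝓝 (N.dil h 0 x)) := by
      refine Tendsto.congr' ?_ (N.tendsto_dil_zero hh hB hx)
      filter_upwards [self_mem_nhdsWithin] with r hr using (N.dil_of_ne h hr x).symm
    have hlim := hc.tendsto.comp ((tendsto_const_nhds (x := ())).prodMk_nhds
      ((tendsto_id.mono_left (nhdsWithin_le_nhds (s := {(0 : ℝ)}ᶜ))).prodMk_nhds hd))
    have hev : ∀ᶠ r : ℝ in 𝓝[≠] 0, h (N.smul r x) ∈ N.total := by
      have h3 : ContinuousAt (fun r : ℝ => h (N.smul r x)) 0 := by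
        refine ContinuousAt.comp (g := h) hh.continuous.continuousAt ?_
        exact ContinuousAt.comp (f := fun r : ℝ => (r, x))
          (g := fun w : ℝ × M => N.smul w.1 w.2) (N.continuousAt_smul hx)
          (Continuous.continuousAt (by fun_prop))
      exact nhdsWithin_le_nhds (h3.eventually (N.isOpen_total.mem_nhds hax))
    refine tendsto_nhds_unique (hlim.congr' ?_) (tendsto_const_nhds (x := x))
    filter_upwards [hev, self_mem_nhdsWithin] with r hr hr0 using hne r hr0 hr
  · exact hne a ha hax

/-- The limit of the conjugates of a diffeomorphism preserving the base is a vector bundle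
automorphism. -/
theorem isAut_dil_zero (hh : ContMDiff I I ∞ h) (hk : ContMDiff I I ∞ k) (hB : MapsTo h B B)
    (kB : MapsTo k B B) (hkh : ∀ x, k (h x) = x) (hhk : ∀ x, h (k x) = x) :
    N.IsAut (N.dil h 0) := by
  have hsm : ∀ {h : M → M}, ContMDiff I I ∞ h → MapsTo h B B →
      ContMDiffOn I I ∞ (N.dil h 0) N.total := by
    intro h hh hB x hx
    obtain ⟨k, m, c, hc⟩ := N.exists_chart_of_mem hx
    have h0 : h (N.smul 0 (c.e.symm (c.e x))) ∈ N.total := by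
      rw [c.e.left_inv hc]; exact N.base_subset (hB (N.smul_zero_mem hx))
    have h1 := N.manifoldFamilyAt_dil (T := Unit) (h := fun _ => h) (τ₀ := ())
      (fun _ x => mapFamilyAt_const hh.contMDiffAt) (fun _ => hB) c (c.e.map_source hc) h0
    have hm := c.target_subset (c.e.map_source hc)
    have h2 : SmoothFamilyAt (fun (_ : Unit)
        (w : EuclideanSpace ℝ (Fin k) × EuclideanSpace ℝ (Fin m)) => ((0 : ℝ), w))
        (modelSet k m) ((), c.e x) :=
      smoothFamilyAt_const (ContDiff.contDiffWithinAt (by fun_prop)) (uniqueDiffOn_modelSet k m) hm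
    have h3 := ManifoldFamilyAt.comp (g := fun _ z => N.dil h z.1 (c.e.symm z.2)) h1 h2
      (uniqueDiffOn_modelSet k m)
      (uniqueDiffOn_univ.prod (uniqueDiffOn_modelSet k m)) hm
      (by filter_upwards [self_mem_nhdsWithin] with q hq using ⟨mem_univ _, hq.2⟩)
    have hsrc := c.isOpen_source.mem_nhds hc
    refine (MapFamilyAt.contMDiffAt (T := Unit) (Φ := fun _ => N.dil h 0) (τ := ())
      (MapFamilyAt.of_coordinates h3 (c.contMDiffAt_toFun hc) (uniqueDiffOn_modelSet k m) ?_
        ?_)).contMDiffWithinAt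
    · filter_upwards [hsrc] with y hy using c.target_subset (c.e.map_source hy)
    · have : ∀ᶠ w : Unit × M in 𝓝 ((), x), w.2 ∈ c.e.source :=
        continuousAt_snd.tendsto.eventually hsrc
      filter_upwards [this] with w hw
      simp only [c.e.left_inv hw]
  have hmaps : ∀ {h : M → M}, ContMDiff I I ∞ h → MapsTo h B B →
      MapsTo (N.dil h 0) N.total N.total := fun hh hB x hx => (N.dil_zero_mem hh hB hx).1
  refine ⟨hsm hh hB, hmaps hh hB, ?_, ?_, ?_, N.dil k 0, hsm hk kB, hmaps hk kB, ?_, ?_⟩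
  · intro x hx
    rw [(N.dil_zero_mem hh hB hx).2, N.dil_base hB (N.proj_mem x hx)]
  · intro t x hx
    have := N.dil_smul hh hB (a := 0) (s := t) hx
      (by rw [zero_mul]; exact N.base_subset (hB (N.smul_zero_mem hx)))
    rwa [zero_mul] at this
  · exact fun x hx y hy hxy => N.dil_zero_add hh hB hx hy hxy
  · exact fun x hx => N.dil_dil hh hk hB kB hkh hx (N.base_subset (hB (N.smul_zero_mem hx)))
  · exact fun x hx => N.dil_dil hk hh kB hB hhk hx (N.base_subset (kB (N.smul_zero_mem hx)))

theorem dil_mem_base_iff (hh : ContMDiff I I ∞ h) (hk : ContMDiff I I ∞ k) (hB : MapsTo h B B)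
    (kB : MapsTo k B B) (hkh : ∀ x, k (h x) = x) {a : ℝ} {x : M} (hx : x ∈ N.total)
    (hax : h (N.smul a x) ∈ N.total) : N.dil h a x ∈ B ↔ x ∈ B := by
  refine ⟨fun h1 => ?_, fun h1 => ?_⟩
  · rw [← N.dil_dil hh hk hB kB hkh hx hax, N.dil_base kB h1]
    exact kB h1
  · rw [N.dil_base hB h1]
    exact hB h1

end Inverse

end RegularNeighborhood

end Dilations

/-! ### Distortion of the norm by a diffeomorphism -/

section Estimates

open Filter

section PartialDerivative

variable {T : Type*} [TopologicalSpace T] {E : Type*} [NormedAddCommGroup E] [NormedSpace ℝ E]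
  {F : Type*} [NormedAddCommGroup F] [NormedSpace ℝ F]

/-- The partial derivatives of a smooth family in a scalar direction. -/
theorem SmoothFamilyAt.eventually_hasDerivAt_fst {f : T → ℝ × E → F} {s : Set E} {p : T × (ℝ × E)}
    (hf : SmoothFamilyAt f (univ ×ˢ s) p) :
    ∀ᶠ q in 𝓝[univ ×ˢ (univ ×ˢ s)] p, HasDerivAt (fun a => f q.1 (a, q.2.2))
      (fderivWithin ℝ (f q.1) (univ ×ˢ s) q.2 (1, 0)) q.2.1 := by
  filter_upwards [(hf 1).eventually_hasFDerivWithinAt, self_mem_nhdsWithin] with q hq hqs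
  have h1 : HasDerivAt (fun a : ℝ => (a, q.2.2)) ((1 : ℝ), (0 : E)) q.2.1 :=
    (hasDerivAt_id q.2.1).prodMk (hasDerivAt_const q.2.1 q.2.2)
  exact HasFDerivWithinAt.comp_hasDerivAt (l := f q.1) (f := fun a : ℝ => (a, q.2.2)) q.2.1 hq h1
    (Eventually.of_forall fun a => ⟨mem_univ _, hqs.2.2⟩)

end PartialDerivative

variable {V : Type*} [NormedAddCommGroup V] [NormedSpace ℝ V]
  {H : Type*} [TopologicalSpace H] {I : ModelWithCorners ℝ V H}
  {M : Type u} [TopologicalSpace M] [ChartedSpace H M]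

namespace RegularNeighborhood

variable {B : Set M} (N : RegularNeighborhood I B)

/-- A smooth function on the whole manifold which coincides with `q` where one of them is less
than `1/4`, and is equal to `1` outside of the unit disc bundle. -/
noncomputable def cutoff (q : M → ℝ) (x : M) : ℝ :=
  open Classical in
  if x ∈ N.total then
    (1 - Real.smoothTransition (4 / 3 * (q x - 1 / 4))) * q x +
      Real.smoothTransition (4 / 3 * (q x - 1 / 4))
  else 1

/-- The quotient by `a²` of the squared norm of `h (a x)`, extended to `a = 0`. -/
noncomputable def normQuot (q : M → ℝ) (h : M → M) (a : ℝ) (x : M) : ℝ :=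
  open Classical in
  if a = 0 then q (N.dil h 0 x) else N.cutoff q (h (N.smul a x)) / a ^ 2

variable {U : Set M} {q : M → ℝ} (hq : N.IsFibreNormSq U q)

include hq

variable {N}

namespace IsFibreNormSq

omit hq in
theorem cutoff_of_lt {x : M} (hx : x ∈ N.total) (hxq : q x ≤ 1 / 4) : N.cutoff q x = q x := by
  rw [cutoff, if_pos hx, Real.smoothTransition.zero_of_nonpos (by linarith)]
  ring

omit hq in
theorem of_cutoff_lt {x : M} (hx : N.cutoff q x < 1 / 4) :
    x ∈ N.total ∧ q x = N.cutoff q x := by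
  by_cases hxt : x ∈ N.total
  · refine ⟨hxt, ?_⟩
    by_cases hxq : q x ≤ 1 / 4
    · exact (cutoff_of_lt hxt hxq).symm
    · rw [cutoff, if_pos hxt] at hx
      have h1 := Real.smoothTransition.nonneg (4 / 3 * (q x - 1 / 4))
      have h2 := Real.smoothTransition.le_one (4 / 3 * (q x - 1 / 4))
      nlinarith
  · rw [cutoff, if_neg hxt] at hx
    norm_num at hx

omit hq in
theorem cutoff_of_one_le {x : M} (hxq : x ∈ N.total → 1 ≤ q x) : N.cutoff q x = 1 := by
  by_cases hxt : x ∈ N.total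
  · rw [cutoff, if_pos hxt, Real.smoothTransition.one_of_one_le (by linarith [hxq hxt])]
    ring
  · rw [cutoff, if_neg hxt]

theorem cutoff_base {b : M} (hb : b ∈ B) : N.cutoff q b = 0 := by
  have h1 := (hq.eq_zero_iff b (N.base_subset hb)).2 hb
  rw [cutoff_of_lt (N.base_subset hb) (by rw [h1]; norm_num), h1]

theorem continuousAt {x : M} (hx : x ∈ N.total) : ContinuousAt q x :=
  (hq.contMDiffAt x hx).continuousAt

theorem contMDiff_cutoff [T2Space M] : ContMDiff I 𝓘(ℝ, ℝ) ∞ (N.cutoff q) := by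
  intro x
  by_cases hx : x ∈ N.total
  · have hθ : ContDiff ℝ ∞ (fun s : ℝ => (1 - Real.smoothTransition (4 / 3 * (s - 1 / 4))) * s +
        Real.smoothTransition (4 / 3 * (s - 1 / 4))) := by
      have h1 : ContDiff ℝ ∞ (fun s : ℝ => Real.smoothTransition (4 / 3 * (s - 1 / 4))) :=
        Real.smoothTransition.contDiff.comp (by fun_prop)
      exact ((contDiff_const.sub h1).mul contDiff_id).add h1
    refine (hθ.contMDiff.contMDiffAt.comp x (hq.contMDiffAt x hx)).congr_of_eventuallyEq ?_
    filter_upwards [N.isOpen_total.mem_nhds hx] with y hy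
    rw [cutoff, if_pos hy]
    rfl
  · refine (contMDiffAt_const (c := (1 : ℝ))).congr_of_eventuallyEq ?_
    filter_upwards [hq.isCompact_disc.isClosed.isOpen_compl.mem_nhds fun h => hx h.1] with y hy
    refine cutoff_of_one_le fun h => ?_
    by_contra hlt
    exact hy ⟨h, (not_le.1 hlt).le⟩

theorem isCompact_sphere [T2Space M] : IsCompact {x | x ∈ N.total ∧ q x = 1} := by
  have h1 : {x | x ∈ N.total ∧ q x = 1} = {x | x ∈ N.total ∧ q x ≤ 1} ∩ q ⁻¹' {1} := by
    ext x
    exact ⟨fun h => ⟨⟨h.1, h.2.le⟩, h.2⟩, fun h => ⟨h.1.1, h.2⟩⟩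
  rw [h1]
  refine hq.isCompact_disc.of_isClosed_subset ?_ inter_subset_left
  exact ContinuousOn.preimage_isClosed_of_isClosed
    (fun x hx => (hq.continuousAt hx.1).continuousWithinAt) hq.isCompact_disc.isClosed
    isClosed_singleton

variable [T2Space M] [IsManifold I ∞ M]

omit [IsManifold I ∞ M] in
theorem normQuot_eq {h : M → M} (hh : ContMDiff I I ∞ h) (hB : MapsTo h B B) {a : ℝ} {x : M}
    (hx : x ∈ N.total) (hax : h (N.smul a x) ∈ N.total) (hqa : q (h (N.smul a x)) ≤ 1 / 4) :
    N.normQuot q h a x = q (N.dil h a x) := by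
  by_cases ha : a = 0
  · rw [normQuot, if_pos ha, ha]
  · rw [normQuot, if_neg ha, cutoff_of_lt hax hqa, ← N.smul_dil hh hB hx hax,
      hq.smul _ (N.dil_mem hh hB hx hax)]
    field_simp

omit [IsManifold I ∞ M] in
theorem normQuot_smul {h : M → M} (hh : ContMDiff I I ∞ h) (hB : MapsTo h B B) (a : ℝ) {s : ℝ}
    (hs : s ≠ 0) {x : M} (hx : x ∈ N.total) :
    N.normQuot q h a (N.smul s x) = s ^ 2 * N.normQuot q h (a * s) x := by
  have h0 : h (N.smul (0 * s) x) ∈ N.total := by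
    rw [zero_mul]; exact N.base_subset (hB (N.smul_zero_mem hx))
  by_cases ha : a = 0
  · subst ha
    rw [normQuot, if_pos rfl, N.dil_smul hh hB hx h0, zero_mul,
      hq.smul _ (N.dil_zero_mem hh hB hx).1, normQuot, if_pos rfl]
  · rw [normQuot, if_neg ha, normQuot, if_neg (mul_ne_zero ha hs), N.smul_smul hx]
    field_simp

omit [IsManifold I ∞ M] in
theorem normQuot_base {h : M → M} (hB : MapsTo h B B) (a : ℝ) {b : M}
    (hb : b ∈ B) : N.normQuot q h a b = 0 := by
  have h1 := (hq.eq_zero_iff (h b) (N.base_subset (hB hb))).2 (hB hb)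
  by_cases ha : a = 0
  · rw [normQuot, if_pos ha, N.dil_base hB hb, h1]
  · rw [normQuot, if_neg ha, N.smul_base hb, hq.cutoff_base (hB hb), zero_div]

section Family

variable {T : Type*} [TopologicalSpace T] {h : T → M → M}

/-- The quotients `normQuot` of a family of maps form a smooth family. -/
theorem smoothFamilyAt_normQuot (hh : ∀ τ x, MapFamilyAt I h τ x) (hB : ∀ τ, MapsTo (h τ) B B)
    {k m : ℕ} (c : TrivializedChart I N.total N.proj N.smul N.add k m) (τ₀ : T) (a₀ : ℝ)
    {w₀ : EuclideanSpace ℝ (Fin k) × EuclideanSpace ℝ (Fin m)} (hw₀ : w₀ ∈ c.e.target) :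
    SmoothFamilyAt (fun τ (z : ℝ × (EuclideanSpace ℝ (Fin k) × EuclideanSpace ℝ (Fin m))) =>
      N.normQuot q (h τ) z.1 (c.e.symm z.2)) (univ ×ˢ modelSet k m) (τ₀, (a₀, w₀)) := by
  set S : Set (ℝ × (EuclideanSpace ℝ (Fin k) × EuclideanSpace ℝ (Fin m))) :=
    univ ×ˢ modelSet k m with hS
  have hSu : UniqueDiffOn ℝ S := uniqueDiffOn_univ.prod (uniqueDiffOn_modelSet k m)
  have hpS : (a₀, w₀) ∈ S := ⟨mem_univ _, c.target_subset hw₀⟩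
  have hhd := N.manifoldFamilyAt_smul hh c τ₀ a₀ hw₀
  have hx₀ : c.e.symm w₀ ∈ N.total := c.source_subset (c.e.map_target hw₀)
  have hsm : ∀ τ, ContMDiff I I ∞ (h τ) := fun τ x => (hh τ x).contMDiffAt
  by_cases ha : a₀ = 0
  · subst ha
    have hbB : h τ₀ (N.smul 0 (c.e.symm w₀)) ∈ B := hB τ₀ (N.smul_zero_mem hx₀)
    have h1 := N.manifoldFamilyAt_dil hh hB c (τ₀ := τ₀) hw₀ (N.base_subset hbB)
    refine (h1.contMDiffAt_comp (hq.contMDiffAt _ (N.dil_zero_mem (hsm τ₀) (hB τ₀) hx₀).1) hSu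
      hpS).congr ?_
    have h2 : ∀ᶠ y in 𝓝 (h τ₀ (N.smul 0 (c.e.symm w₀))), N.cutoff q y < 1 / 4 := by
      refine (hq.contMDiff_cutoff.continuous.tendsto _).eventually_lt_const ?_
      rw [hq.cutoff_base hbB]
      norm_num
    filter_upwards [hhd.1.tendsto.eventually h2, c.eventually_mem_target hw₀ τ₀ 0] with p hp1 hp2
    obtain ⟨h3, h4⟩ := of_cutoff_lt hp1
    exact hq.normQuot_eq (hsm _) (hB _) (c.source_subset (c.e.map_target hp2)) h3
      (by rw [h4]; exact hp1.le)
  · have h1 : SmoothFamilyAt (fun (_ : T)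
        (z : ℝ × (EuclideanSpace ℝ (Fin k) × EuclideanSpace ℝ (Fin m))) => z.1) S
        (τ₀, (a₀, w₀)) :=
      smoothFamilyAt_const contDiff_fst.contDiffWithinAt hSu hpS
    have h2 := hhd.contMDiffAt_comp (hq.contMDiff_cutoff.contMDiffAt) hSu hpS
    have h3 := (h2.prodMk h1 hSu hpS).contDiffAt_comp (g := fun y : ℝ × ℝ => y.1 / y.2 ^ 2)
      (contDiff_fst.contDiffAt.div (contDiff_snd.pow 2).contDiffAt (pow_ne_zero 2 ha)) hSu hpS
    refine h3.congr ?_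
    have h4 : Tendsto (fun q : T × (ℝ × (EuclideanSpace ℝ (Fin k) × EuclideanSpace ℝ (Fin m))) =>
        q.2.1) (𝓝[univ ×ˢ S] (τ₀, (a₀, w₀))) (𝓝 a₀) :=
      (Continuous.tendsto' (by fun_prop) _ _ rfl).mono_left nhdsWithin_le_nhds
    filter_upwards [h4.eventually_ne ha] with p hp
    rw [normQuot, if_neg hp]

/-- Differentiability of `normQuot`, and joint continuity of it and its derivative. -/
theorem continuousAt_normQuot (hh : ∀ τ x, MapFamilyAt I h τ x) (hB : ∀ τ, MapsTo (h τ) B B)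
    (τ₀ : T) (a₀ : ℝ) {x₀ : M} (hx₀ : x₀ ∈ N.total) :
    DifferentiableAt ℝ (fun a => N.normQuot q (h τ₀) a x₀) a₀ ∧
    ContinuousAt (fun w : T × (ℝ × M) => N.normQuot q (h w.1) w.2.1 w.2.2) (τ₀, (a₀, x₀)) ∧
    ContinuousAt (fun w : T × (ℝ × M) => deriv (fun a => N.normQuot q (h w.1) a w.2.2) w.2.1)
      (τ₀, (a₀, x₀)) := by
  obtain ⟨k, m, c, hc⟩ := N.exists_chart_of_mem hx₀
  have hinv : c.e.symm (c.e x₀) = x₀ := c.e.left_inv hc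
  have hw₀ := c.e.map_source hc
  set S : Set (ℝ × (EuclideanSpace ℝ (Fin k) × EuclideanSpace ℝ (Fin m))) :=
    univ ×ˢ modelSet k m with hS
  have hSu : UniqueDiffOn ℝ S := uniqueDiffOn_univ.prod (uniqueDiffOn_modelSet k m)
  have hpS : (a₀, c.e x₀) ∈ S := ⟨mem_univ _, c.target_subset hw₀⟩
  have h1 := hq.smoothFamilyAt_normQuot hh hB c τ₀ a₀ hw₀
  have hder := h1.eventually_hasDerivAt_fst
  have h2 : Tendsto (fun w : T × (ℝ × M) => (w.1, (w.2.1, c.e w.2.2))) (𝓝 (τ₀, (a₀, x₀)))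
      (𝓝[univ ×ˢ S] (τ₀, (a₀, c.e x₀))) := by
    refine tendsto_nhdsWithin_iff.2 ⟨?_, ?_⟩
    · refine continuousAt_fst.tendsto.prodMk_nhds
        ((continuousAt_fst.comp continuousAt_snd).tendsto.prodMk_nhds ?_)
      exact ContinuousAt.comp (f := fun w : T × (ℝ × M) => w.2.2) (x := (τ₀, (a₀, x₀)))
        (c.contMDiffAt_toFun hc).continuousAt (Continuous.continuousAt (by fun_prop))
    · have : ∀ᶠ w : T × (ℝ × M) in 𝓝 (τ₀, (a₀, x₀)), w.2.2 ∈ c.e.source :=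
        (Continuous.continuousAt (f := fun w : T × (ℝ × M) => w.2.2) (by fun_prop)).eventually
          (c.isOpen_source.mem_nhds hc)
      filter_upwards [this] with w hw
        using ⟨mem_univ _, mem_univ _, c.target_subset (c.e.map_source hw)⟩
  have hev : ∀ᶠ w : T × (ℝ × M) in 𝓝 (τ₀, (a₀, x₀)), w.2.2 ∈ c.e.source :=
    (Continuous.continuousAt (f := fun w : T × (ℝ × M) => w.2.2) (by fun_prop)).eventually
      (c.isOpen_source.mem_nhds hc)
  refine ⟨?_, ?_, ?_⟩
  · have h3 := (hder.self_of_nhdsWithin (mem_prod_of_mem hpS)).differentiableAt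
    simpa only [hinv] using h3
  · have h3 := (h1.continuousWithinAt hpS).tendsto.comp h2
    simp only [hinv] at h3
    refine Tendsto.congr' ?_ h3
    filter_upwards [hev] with w hw
    simp only [Function.comp_apply, c.e.left_inv hw]
  · have h3 := (((h1 1).fderivWithin hSu).continuousWithinAt hpS).tendsto.comp h2
    have h4 := ((ContinuousLinearMap.apply ℝ ℝ ((1 : ℝ),
      (0 : EuclideanSpace ℝ (Fin k) × EuclideanSpace ℝ (Fin m)))).continuous.tendsto _).comp h3
    have h5 := (hder.self_of_nhdsWithin (mem_prod_of_mem hpS)).deriv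
    simp only [hinv] at h5
    rw [ContinuousAt]
    simp only [h5]
    refine Tendsto.congr' ?_ h4
    filter_upwards [hev, h2.eventually hder] with w hw hwd
    have h6 := hwd.deriv
    simp only [c.e.left_inv hw] at h6
    exact h6.symm

end Family

end IsFibreNormSq

variable (N q)

omit hq

/-- A bound for the distortion by `h` of the norm near the base, which depends continuously
on `h`. -/
noncomputable def distortion (h : M → M) : ℝ :=
  1 + ⨆ p : ↥(Icc (0 : ℝ) 1 ×ˢ {x | x ∈ N.total ∧ q x = 1}),
    (|deriv (fun a => N.normQuot q h a p.1.2) p.1.1| + N.normQuot q h 0 p.1.2 +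
      (N.normQuot q h 0 p.1.2)⁻¹)

variable {N q}

include hq

namespace IsFibreNormSq

variable [T2Space M] [IsManifold I ∞ M]

/-- The limit of the conjugates is invertible on the fibres, so that it maps nonzero vectors to
nonzero ones. -/
theorem normQuot_zero_pos {h : M ≃ₘ⟮I, I⟯ M} (hB : h ∈ diffInv I B) {x : M} (hx : x ∈ N.total)
    (hxB : x ∉ B) : 0 < N.normQuot q h 0 x := by
  have h1 : MapsTo h B B := by rw [mapsTo_iff_image_subset]; exact hB.subset
  have h2 : MapsTo h.symm B B := by
    intro b hb
    obtain ⟨c, hc, rfl⟩ := hB.superset hb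
    simpa using hc
  have h3 := N.base_subset (h1 (N.smul_zero_mem hx))
  rw [normQuot, if_pos rfl]
  have h4 := (N.dil_zero_mem h.contMDiff h1 hx).1
  refine lt_of_le_of_ne (hq.nonneg _ h4) fun h5 => hxB ?_
  exact (N.dil_mem_base_iff h.contMDiff h.symm.contMDiff h1 h2 (fun x => h.symm_apply_apply x) hx
    h3).1 ((hq.eq_zero_iff _ h4).1 h5.symm)

section

variable {T : Type*} [TopologicalSpace T] {h : T → (M ≃ₘ⟮I, I⟯ M)}

theorem continuous_distortion_integrand (hh : ∀ τ x, MapFamilyAt I (fun τ => h τ) τ x)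
    (hB : ∀ τ, h τ ∈ diffInv I B) :
    Continuous fun w : T × ↥(Icc (0 : ℝ) 1 ×ˢ {x | x ∈ N.total ∧ q x = 1}) =>
      (|deriv (fun a => N.normQuot q (h w.1) a w.2.1.2) w.2.1.1| +
        N.normQuot q (h w.1) 0 w.2.1.2 + (N.normQuot q (h w.1) 0 w.2.1.2)⁻¹) := by
  rw [continuous_iff_continuousAt]
  rintro ⟨τ, ⟨a, x⟩, ha, hx⟩
  have hB' : ∀ τ, MapsTo (h τ) B B := fun τ => by
    rw [mapsTo_iff_image_subset]; exact (hB τ).subset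
  have hxB : x ∉ B := fun hxB => by
    have := (hq.eq_zero_iff x hx.1).2 hxB
    linarith [hx.2]
  have h1 : ContinuousAt (fun w : T × ↥(Icc (0 : ℝ) 1 ×ˢ {x | x ∈ N.total ∧ q x = 1}) =>
      deriv (fun a => N.normQuot q (h w.1) a w.2.1.2) w.2.1.1) (τ, ⟨(a, x), ha, hx⟩) :=
    ContinuousAt.comp
      (g := fun w : T × (ℝ × M) => deriv (fun a => N.normQuot q (h w.1) a w.2.2) w.2.1)
      (f := fun w : T × ↥(Icc (0 : ℝ) 1 ×ˢ {x | x ∈ N.total ∧ q x = 1}) => (w.1, w.2.1))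
      (hq.continuousAt_normQuot hh hB' τ a hx.1).2.2 (Continuous.continuousAt (by fun_prop))
  have h2 : ContinuousAt (fun w : T × ↥(Icc (0 : ℝ) 1 ×ˢ {x | x ∈ N.total ∧ q x = 1}) =>
      N.normQuot q (h w.1) 0 w.2.1.2) (τ, ⟨(a, x), ha, hx⟩) :=
    ContinuousAt.comp (g := fun w : T × (ℝ × M) => N.normQuot q (h w.1) w.2.1 w.2.2)
      (f := fun w : T × ↥(Icc (0 : ℝ) 1 ×ˢ {x | x ∈ N.total ∧ q x = 1}) =>
        (w.1, ((0 : ℝ), w.2.1.2)))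
      (hq.continuousAt_normQuot hh hB' τ 0 hx.1).2.1 (Continuous.continuousAt (by fun_prop))
  exact (h1.abs.add h2).add (h2.inv₀ (hq.normQuot_zero_pos (hB τ) hx.1 hxB).ne')

omit [IsManifold I ∞ M] in
theorem compactSpace_segment_sphere :
    CompactSpace ↥(Icc (0 : ℝ) 1 ×ˢ {x | x ∈ N.total ∧ q x = 1}) :=
  isCompact_iff_compactSpace.1 (isCompact_Icc.prod hq.isCompact_sphere)

/-- The distortion is a supremum over a compact set, hence it depends continuously on the
diffeomorphism. -/
theorem continuous_distortion (hh : ∀ τ x, MapFamilyAt I (fun τ => h τ) τ x)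
    (hB : ∀ τ, h τ ∈ diffInv I B) : Continuous fun τ => N.distortion q (h τ) := by
  have := hq.compactSpace_segment_sphere
  have h1 := isCompact_univ.continuous_sSup (f := fun τ
    (p : ↥(Icc (0 : ℝ) 1 ×ˢ {x | x ∈ N.total ∧ q x = 1})) =>
      (|deriv (fun a => N.normQuot q (h τ) a p.1.2) p.1.1| +
        N.normQuot q (h τ) 0 p.1.2 + (N.normQuot q (h τ) 0 p.1.2)⁻¹))
    (hq.continuous_distortion_integrand hh hB)
  simp only [image_univ] at h1
  exact continuous_const.add h1

end

variable {h : M ≃ₘ⟮I, I⟯ M} (hB : h ∈ diffInv I B)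

include hB

theorem normQuot_zero_nonneg {x : M} (hx : x ∈ N.total) : 0 ≤ N.normQuot q h 0 x := by
  by_cases hxB : x ∈ B
  · rw [hq.normQuot_base (by rw [mapsTo_iff_image_subset]; exact hB.subset) 0 hxB]
  · exact (hq.normQuot_zero_pos hB hx hxB).le

theorem one_le_distortion : 1 ≤ N.distortion q h := by
  refine le_add_of_nonneg_right (Real.iSup_nonneg ?_)
  rintro ⟨⟨a, x⟩, ha, hx⟩
  have h1 := hq.normQuot_zero_nonneg hB hx.1
  positivity

theorem le_distortion {a : ℝ} (ha : a ∈ Icc (0 : ℝ) 1) {u : M} (hu : u ∈ N.total)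
    (huq : q u = 1) : |deriv (fun a => N.normQuot q h a u) a| ≤ N.distortion q h ∧
      N.normQuot q h 0 u ≤ N.distortion q h ∧ (N.normQuot q h 0 u)⁻¹ ≤ N.distortion q h := by
  have := hq.compactSpace_segment_sphere
  have hc := hq.continuous_distortion_integrand (T := Unit) (h := fun _ => h)
    (fun _ x => mapFamilyAt_const h.contMDiff.contMDiffAt) (fun _ => hB)
  have hb := (isCompact_range (hc.comp (Continuous.prodMk_right ()))).bddAbove
  have h1 := le_ciSup hb ⟨(a, u), ha, hu, huq⟩
  have h2 : 0 ≤ N.normQuot q h 0 u := hq.normQuot_zero_nonneg hB hu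
  have h3 : 0 ≤ (N.normQuot q h 0 u)⁻¹ := inv_nonneg.2 h2
  have h4 := abs_nonneg (deriv (fun a => N.normQuot q h a u) a)
  simp only [Function.comp_apply] at h1
  have h5 : N.distortion q h = 1 + ⨆ p : ↥(Icc (0 : ℝ) 1 ×ˢ {x | x ∈ N.total ∧ q x = 1}),
    (|deriv (fun a => N.normQuot q h a p.1.2) p.1.1| + N.normQuot q h 0 p.1.2 +
      (N.normQuot q h 0 p.1.2)⁻¹) := rfl
  refine ⟨?_, ?_, ?_⟩ <;> rw [h5] <;> refine le_trans ?_ (add_le_add_right h1 1) <;> linarith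

omit hq [T2Space M] [IsManifold I ∞ M] in
theorem _root_.mapsTo_of_mem_diffInv : MapsTo h B B := by
  rw [mapsTo_iff_image_subset]; exact hB.subset

/-- On the unit sphere bundle, `normQuot` is bounded from above and from below for short
dilation factors. -/
theorem normQuot_sphere_bounds {a : ℝ} (ha : 0 ≤ a) (ha' : a ≤ 1 / (4 * N.distortion q h ^ 2))
    {u : M} (hu : u ∈ N.total) (huq : q u = 1) :
    1 / (2 * N.distortion q h) ≤ N.normQuot q h a u ∧
      N.normQuot q h a u ≤ 2 * N.distortion q h := by
  have hΛ := hq.one_le_distortion hB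
  set Λ := N.distortion q h with hΛdef
  have hΛ0 : 0 < Λ := by linarith
  have hdiff : ∀ b, DifferentiableAt ℝ (fun a => N.normQuot q h a u) b := fun b =>
    (hq.continuousAt_normQuot (T := Unit) (h := fun _ => h)
      (fun _ x => mapFamilyAt_const h.contMDiff.contMDiffAt)
      (fun _ => mapsTo_of_mem_diffInv hB) () b hu).1
  have ha1 : a ≤ 1 := by
    refine ha'.trans ?_
    rw [div_le_one (by positivity)]
    nlinarith
  have hmv := Convex.norm_image_sub_le_of_norm_deriv_le (𝕜 := ℝ)
    (f := fun a => N.normQuot q h a u) (C := Λ) (s := Icc (0 : ℝ) 1)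
    (fun b _ => hdiff b) (fun b hb => (hq.le_distortion hB hb hu huq).1) (convex_Icc _ _)
    (⟨le_rfl, zero_le_one⟩ : (0 : ℝ) ∈ Icc (0 : ℝ) 1) (⟨ha, ha1⟩ : a ∈ Icc (0 : ℝ) 1)
  simp only [sub_zero, Real.norm_eq_abs, abs_of_nonneg ha] at hmv
  have h1 : Λ * a ≤ 1 / (4 * Λ) := by
    calc Λ * a ≤ Λ * (1 / (4 * Λ ^ 2)) := by gcongr
      _ = 1 / (4 * Λ) := by field_simp
  obtain ⟨-, h2, h3⟩ := hq.le_distortion hB (⟨le_rfl, zero_le_one⟩ : (0 : ℝ) ∈ Icc (0 : ℝ) 1)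
    hu huq
  have huB : u ∉ B := fun hb => by
    have := (hq.eq_zero_iff u hu).2 hb
    linarith
  have hpos := hq.normQuot_zero_pos hB hu huB
  have h4 : 1 / Λ ≤ N.normQuot q h 0 u := by
    rw [one_div]
    exact inv_le_of_inv_le₀ hpos h3
  have h5 : 1 / (4 * Λ) ≤ Λ := by
    rw [div_le_iff₀ (by positivity)]
    nlinarith
  have h6 : 1 / Λ = 4 * (1 / (4 * Λ)) := by field_simp
  have h7 : 1 / (2 * Λ) = 2 * (1 / (4 * Λ)) := by field_simp; norm_num
  have h8 : 0 < 1 / (4 * Λ) := by positivity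
  have h9 := abs_le.1 (hmv.trans h1)
  constructor
  · rw [h7]; linarith [h9.1]
  · linarith [h9.2]

end IsFibreNormSq

end RegularNeighborhood

end Estimates

/-! ### Damping factors -/

section Damping

open Filter

/-- The derivative of the smooth transition function is bounded. -/
theorem exists_abs_deriv_smoothTransition_le :
    ∃ L : ℝ, 0 ≤ L ∧ ∀ x, |deriv Real.smoothTransition x| ≤ L := by
  have hc : Continuous (deriv Real.smoothTransition) :=
    (Real.smoothTransition.contDiff (n := 1)).continuous_deriv le_rfl
  obtain ⟨L, hL⟩ := (isCompact_Icc (a := (0 : ℝ)) (b := 1)).exists_bound_of_continuousOn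
    hc.continuousOn
  refine ⟨L, (norm_nonneg _).trans (hL 0 ⟨le_rfl, zero_le_one⟩), fun x => ?_⟩
  by_cases hx : x ∈ Icc (0 : ℝ) 1
  · exact hL x hx
  have h0 : deriv Real.smoothTransition x = 0 := by
    rw [mem_Icc, not_and_or, not_le, not_le] at hx
    rcases hx with hx | hx
    · have : Real.smoothTransition =ᶠ[𝓝 x] fun _ => 0 := by
        filter_upwards [eventually_lt_nhds hx] with y hy
          using Real.smoothTransition.zero_of_nonpos hy.le
      rw [this.deriv_eq, deriv_const]
    · have : Real.smoothTransition =ᶠ[𝓝 x] fun _ => 1 := by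
        filter_upwards [eventually_gt_nhds hx] with y hy
          using Real.smoothTransition.one_of_one_le hy.le
      rw [this.deriv_eq, deriv_const]
  rw [h0, abs_zero]
  exact (norm_nonneg _).trans (hL 0 ⟨le_rfl, zero_le_one⟩)

/-- The factor by which the points of squared norm `ρ` are multiplied at the time `t`: it is `1` for
`e² ≤ ρ` and `1 - t` for `ρ ≤ e² / 2`. -/
noncomputable def damp (t e ρ : ℝ) : ℝ := 1 - t + t * Real.smoothTransition (2 * (ρ / e ^ 2) - 1)

theorem damp_mem {t : ℝ} (ht : t ∈ Icc (0 : ℝ) 1) (e ρ : ℝ) : damp t e ρ ∈ Icc (0 : ℝ) 1 := by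
  have h1 := Real.smoothTransition.nonneg (2 * (ρ / e ^ 2) - 1)
  have h2 := Real.smoothTransition.le_one (2 * (ρ / e ^ 2) - 1)
  obtain ⟨h3, h4⟩ := ht
  refine ⟨?_, ?_⟩ <;> rw [damp] <;> nlinarith

theorem damp_of_le {t e ρ : ℝ} (he : 0 < e) (h : e ^ 2 ≤ ρ) : damp t e ρ = 1 := by
  have h1 : 1 ≤ ρ / e ^ 2 := (one_le_div (by positivity)).2 h
  rw [damp, Real.smoothTransition.one_of_one_le (by linarith)]
  ring

theorem damp_of_ge {t e ρ : ℝ} (he : 0 < e) (h : 2 * ρ ≤ e ^ 2) : damp t e ρ = 1 - t := by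
  have h1 : ρ / e ^ 2 ≤ 1 / 2 := by
    rw [div_le_iff₀ (by positivity)]
    linarith
  rw [damp, Real.smoothTransition.zero_of_nonpos (by linarith)]
  ring

@[simp] theorem damp_zero (e ρ : ℝ) : damp 0 e ρ = 1 := by
  rw [damp]; ring

theorem contDiffAt_damp {y : ℝ × ℝ × ℝ} (hy : y.2.1 ≠ 0) :
    ContDiffAt ℝ ∞ (fun y : ℝ × ℝ × ℝ => damp y.1 y.2.1 y.2.2) y := by
  have h1 : ContDiffAt ℝ ∞ (fun y : ℝ × ℝ × ℝ => 2 * (y.2.2 / y.2.1 ^ 2) - 1) y :=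
    (contDiffAt_const.mul ((contDiff_snd.snd.contDiffAt).div
      (contDiff_snd.fst.contDiffAt.pow 2) (pow_ne_zero 2 hy))).sub contDiffAt_const
  have h2 : ContDiffAt ℝ ∞
      (fun y : ℝ × ℝ × ℝ => Real.smoothTransition (2 * (y.2.2 / y.2.1 ^ 2) - 1)) y :=
    Real.smoothTransition.contDiffAt.comp y h1
  exact (contDiffAt_const.sub contDiff_fst.contDiffAt).add (contDiff_fst.contDiffAt.mul h2)

theorem hasDerivAt_damp (t e ρ : ℝ) : HasDerivAt (damp t e)
    (t * (deriv Real.smoothTransition (2 * (ρ / e ^ 2) - 1) * (2 / e ^ 2))) ρ := by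
  have h1 : HasDerivAt (fun ρ : ℝ => 2 * (ρ / e ^ 2) - 1) (2 / e ^ 2) ρ := by
    exact ((((hasDerivAt_id ρ).div_const (e ^ 2)).const_mul 2).sub_const 1).congr_deriv (by ring)
  have h2 : HasDerivAt Real.smoothTransition
      (deriv Real.smoothTransition (2 * (ρ / e ^ 2) - 1)) (2 * (ρ / e ^ 2) - 1) :=
    ((Real.smoothTransition.contDiffAt (n := 1)).differentiableAt (by simp)).hasDerivAt
  exact ((h2.comp ρ h1).const_mul t).const_add (1 - t)

/-- A function of `[0, 1]` to itself with derivative at most `1/2` has a fixed point, and the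
distance to it of any point is controlled by the displacement of the latter. -/
theorem exists_fixed_of_abs_deriv_le {f : ℝ → ℝ} (hf : MapsTo f (Icc 0 1) (Icc 0 1))
    (hd : ∀ a, DifferentiableAt ℝ f a) (hd' : ∀ a ∈ Icc (0 : ℝ) 1, |deriv f a| ≤ 1 / 2) :
    (∃ a ∈ Icc (0 : ℝ) 1, f a = a) ∧ ∀ a ∈ Icc (0 : ℝ) 1, ∀ b ∈ Icc (0 : ℝ) 1, f a = a →
      |a - b| ≤ 2 * |f b - b| := by
  constructor
  · have hc : Continuous fun a => f a - a :=
      (continuous_iff_continuousAt.2 fun a => (hd a).continuousAt).sub continuous_id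
    have h0 := hf (⟨le_rfl, zero_le_one⟩ : (0 : ℝ) ∈ Icc (0 : ℝ) 1)
    have h1 := hf (⟨zero_le_one, le_rfl⟩ : (1 : ℝ) ∈ Icc (0 : ℝ) 1)
    obtain ⟨a, ha, ha'⟩ := intermediate_value_Icc' (zero_le_one' ℝ) hc.continuousOn
      (show (0 : ℝ) ∈ Icc (f 1 - 1) (f 0 - 0) from ⟨by linarith [h1.2], by linarith [h0.1]⟩)
    exact ⟨a, ha, sub_eq_zero.1 ha'⟩
  · intro a ha b hb hab
    have hmv := Convex.norm_image_sub_le_of_norm_deriv_le (𝕜 := ℝ) (f := f) (fun c _ => hd c) hd'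
      (convex_Icc _ _) hb ha
    rw [hab, Real.norm_eq_abs, Real.norm_eq_abs] at hmv
    have : |a - b| ≤ |a - f b| + |f b - b| := abs_sub_le _ _ _
    linarith

end Damping

/-! ### Estimates near the base -/

section Zone

open Filter

/-- The squared radius of the disc bundle in which a diffeomorphism with the distortion `Λ` is
straightened. -/
noncomputable def zoneRadius (Λ : ℝ) : ℝ := 1 / (16 * Λ ^ 4)

/-- The radius beyond which the factors `damp` are equal to `1`, if the derivative of the smooth
transition function is bounded by `L`. -/
noncomputable def dampRadius (L Λ : ℝ) : ℝ := 1 / (32 * (L + 1) * Λ ^ 4)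

theorem zoneRadius_pos {Λ : ℝ} (hΛ : 1 ≤ Λ) : 0 < zoneRadius Λ := by
  rw [zoneRadius]; positivity

theorem zoneRadius_le {Λ : ℝ} (hΛ : 1 ≤ Λ) : zoneRadius Λ ≤ 1 / 16 := by
  rw [zoneRadius]
  have : 1 ≤ Λ ^ 4 := one_le_pow₀ hΛ
  apply one_div_le_one_div_of_le <;> linarith

theorem dampRadius_pos {L Λ : ℝ} (hL : 0 ≤ L) (hΛ : 1 ≤ Λ) : 0 < dampRadius L Λ := by
  rw [dampRadius]; positivity

theorem dampRadius_le {L Λ : ℝ} (hL : 0 ≤ L) (hΛ : 1 ≤ Λ) :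
    dampRadius L Λ ^ 2 < zoneRadius Λ / (8 * Λ) ∧
      2 * Λ * dampRadius L Λ ^ 2 < zoneRadius Λ / 2 := by
  have h1 : dampRadius L Λ ≤ 1 / (32 * Λ ^ 4) := by
    rw [dampRadius]
    apply one_div_le_one_div_of_le (by positivity)
    have : 0 ≤ L * Λ ^ 4 := by positivity
    linarith
  have h2 : dampRadius L Λ ^ 2 ≤ (1 / (32 * Λ ^ 4)) ^ 2 :=
    pow_le_pow_left₀ (dampRadius_pos hL hΛ).le h1 2
  have h3 : (1 / (32 * Λ ^ 4)) ^ 2 ≤ 1 / (1024 * Λ ^ 5) := by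
    rw [div_pow, one_pow, mul_pow, ← pow_mul]
    apply one_div_le_one_div_of_le (by positivity)
    norm_num
    exact pow_le_pow_right₀ hΛ (by norm_num)
  have h4 : zoneRadius Λ / (8 * Λ) = 8 * (1 / (1024 * Λ ^ 5)) := by
    rw [zoneRadius]; field_simp; norm_num
  have h5 : zoneRadius Λ / 2 = 16 * (2 * Λ * (1 / (1024 * Λ ^ 5))) := by
    rw [zoneRadius]; field_simp; norm_num
  have h6 : 0 < 1 / (1024 * Λ ^ 5) := by positivity
  have h7 : 0 < 2 * Λ * (1 / (1024 * Λ ^ 5)) := by positivity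
  have h8 : 2 * Λ * dampRadius L Λ ^ 2 ≤ 2 * Λ * (1 / (1024 * Λ ^ 5)) :=
    mul_le_mul_of_nonneg_left (h2.trans h3) (by positivity)
  constructor <;> linarith

variable {V : Type*} [NormedAddCommGroup V] [NormedSpace ℝ V]
  {H : Type*} [TopologicalSpace H] {I : ModelWithCorners ℝ V H}
  {M : Type u} [TopologicalSpace M] [ChartedSpace H M] [T2Space M] [IsManifold I ∞ M]

namespace RegularNeighborhood.IsFibreNormSq

variable {B : Set M} {N : RegularNeighborhood I B} {U : Set M} {q : M → ℝ}
  (hq : N.IsFibreNormSq U q) {h : M ≃ₘ⟮I, I⟯ M} (hB : h ∈ diffInv I B)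

include hq hB

theorem differentiableAt_normQuot {x : M} (hx : x ∈ N.total) (a : ℝ) :
    DifferentiableAt ℝ (fun a => N.normQuot q h a x) a :=
  (hq.continuousAt_normQuot (T := Unit) (h := fun _ => h)
      (fun _ _ => mapFamilyAt_const h.contMDiff.contMDiffAt)
      (fun _ => mapsTo_of_mem_diffInv hB) () a hx).1

/-- The estimates of `normQuot` in the disc bundle of squared radius `zoneRadius`. -/
theorem normQuot_bounds {x : M} (hx : x ∈ N.total) (hxq : q x < zoneRadius (N.distortion q h))
    {a : ℝ} (ha : a ∈ Icc (0 : ℝ) 1) :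
    q x / (2 * N.distortion q h) ≤ N.normQuot q h a x ∧
      N.normQuot q h a x ≤ 2 * N.distortion q h * q x ∧
      |deriv (fun a => N.normQuot q h a x) a| ≤ N.distortion q h * √(q x) ^ 3 := by
  have hΛ := hq.one_le_distortion hB
  set Λ := N.distortion q h with hΛdef
  by_cases hxB : x ∈ B
  · have h1 : ∀ a, N.normQuot q h a x = 0 := fun a =>
      hq.normQuot_base (mapsTo_of_mem_diffInv hB) a hxB
    simp [h1, (hq.eq_zero_iff x hx).2 hxB]
  have hqx : 0 < q x :=
    lt_of_le_of_ne (hq.nonneg x hx) fun h0 => hxB ((hq.eq_zero_iff x hx).1 h0.symm)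
  set s := √(q x) with hs
  have hs0 : 0 < s := Real.sqrt_pos.2 hqx
  have hs2 : s ^ 2 = q x := Real.sq_sqrt hqx.le
  have hslt : s < 1 / (4 * Λ ^ 2) := by
    rw [hs, Real.sqrt_lt' (by positivity)]
    refine hxq.trans_eq ?_
    rw [zoneRadius]
    ring
  set u := N.smul s⁻¹ x with hu
  have hut : u ∈ N.total := N.smul_mem hx _
  have hxu : N.smul s u = x := N.smul_smul_inv hx hs0.ne'
  have huq : q u = 1 := by
    rw [hu, hq.smul _ hx, ← hs2]
    field_simp
  have hfun : (fun a => N.normQuot q h a x) = fun a => s ^ 2 * N.normQuot q h (a * s) u := by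
    funext a
    rw [← hq.normQuot_smul h.contMDiff (mapsTo_of_mem_diffInv hB) a hs0.ne' hut, hxu]
  have has : 0 ≤ a * s := mul_nonneg ha.1 hs0.le
  have has1 : a * s ≤ 1 / (4 * Λ ^ 2) := by nlinarith [ha.2]
  have has2 : a * s ≤ 1 := by
    refine has1.trans ?_
    rw [div_le_one (by positivity)]
    nlinarith
  obtain ⟨h1, h2⟩ := hq.normQuot_sphere_bounds hB has has1 hut huq
  rw [← hΛdef] at h1 h2
  have hval : N.normQuot q h a x = s ^ 2 * N.normQuot q h (a * s) u := congrFun hfun a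
  refine ⟨?_, ?_, ?_⟩
  · rw [hval, ← hs2, div_eq_mul_one_div]
    exact mul_le_mul_of_nonneg_left h1 (by positivity)
  · rw [hval, ← hs2, mul_comm]
    exact mul_le_mul_of_nonneg_right h2 (by positivity)
  · have h3 : HasDerivAt (fun a => N.normQuot q h a x)
        (s ^ 2 * (deriv (fun a => N.normQuot q h a u) (a * s) * s)) a := by
      rw [hfun]
      have h4 := (hq.differentiableAt_normQuot hB hut (a * s)).hasDerivAt
      have h5 : HasDerivAt (fun a => a * s) s a := by
        simpa using (hasDerivAt_id a).mul_const s
      exact (HasDerivAt.comp (h₂ := fun a => N.normQuot q h a u) a h4 h5).const_mul _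
    rw [h3.deriv, abs_mul, abs_mul, abs_of_pos hs0, abs_of_pos (by positivity : 0 < s ^ 2)]
    have h4 := (hq.le_distortion hB ⟨has, has2⟩ hut huq).1
    rw [← hΛdef] at h4
    calc s ^ 2 * (|deriv (fun a => N.normQuot q h a u) (a * s)| * s)
        ≤ s ^ 2 * (Λ * s) := by gcongr
      _ = Λ * s ^ 3 := by ring

/-- The lower bound of `normQuot` for the factor zero holds on the whole total space, since the
limit of the conjugates is linear on the fibres. -/
theorem normQuot_zero_ge {x : M} (hx : x ∈ N.total) :
    q x ≤ N.distortion q h * N.normQuot q h 0 x := by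
  by_cases hxB : x ∈ B
  · rw [(hq.eq_zero_iff x hx).2 hxB, hq.normQuot_base (mapsTo_of_mem_diffInv hB) 0 hxB,
      mul_zero]
  have hqx : 0 < q x :=
    lt_of_le_of_ne (hq.nonneg x hx) fun h0 => hxB ((hq.eq_zero_iff x hx).1 h0.symm)
  set s := √(q x) with hs
  have hs0 : 0 < s := Real.sqrt_pos.2 hqx
  have hs2 : s ^ 2 = q x := Real.sq_sqrt hqx.le
  set u := N.smul s⁻¹ x with hu
  have hut : u ∈ N.total := N.smul_mem hx _
  have hxu : N.smul s u = x := N.smul_smul_inv hx hs0.ne'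
  have huq : q u = 1 := by
    rw [hu, hq.smul _ hx, ← hs2]
    field_simp
  have huB : u ∉ B := fun hb => by
    have := (hq.eq_zero_iff u hut).2 hb
    linarith
  have h1 := (hq.le_distortion hB (⟨le_rfl, zero_le_one⟩ : (0 : ℝ) ∈ Icc (0 : ℝ) 1) hut huq).2.2
  have h2 := hq.normQuot_zero_pos hB hut huB
  rw [← hxu, hq.normQuot_smul h.contMDiff (mapsTo_of_mem_diffInv hB) 0 hs0.ne' hut, zero_mul,
    hxu, ← hs2]
  have h3 : 1 ≤ N.distortion q h * N.normQuot q h 0 u := by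
    rw [inv_le_iff_one_le_mul₀ h2] at h1
    exact h1
  nlinarith [sq_nonneg s]

/-- The zone is so small that its segments towards the base are mapped to where
`cutoff` coincides with `q`. -/
theorem map_smul_mem {x : M} (hx : x ∈ N.total) (hxq : q x < zoneRadius (N.distortion q h))
    {a : ℝ} (ha : a ∈ Icc (0 : ℝ) 1) :
    h (N.smul a x) ∈ N.total ∧ q (h (N.smul a x)) ≤ 1 / 4 ∧
      N.normQuot q h a x = q (N.dil h a x) := by
  suffices hlt : N.cutoff q (h (N.smul a x)) < 1 / 4 by
    obtain ⟨h1, h2⟩ := of_cutoff_lt hlt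
    have h3 : q (h (N.smul a x)) ≤ 1 / 4 := by rw [h2]; exact hlt.le
    exact ⟨h1, h3, hq.normQuot_eq h.contMDiff (mapsTo_of_mem_diffInv hB) hx h1 h3⟩
  by_cases ha0 : a = 0
  · subst ha0
    rw [hq.cutoff_base (mapsTo_of_mem_diffInv hB (N.smul_zero_mem hx))]
    norm_num
  have hΛ := hq.one_le_distortion hB
  have h1 := (hq.normQuot_bounds hB hx hxq ha).2.1
  set Λ := N.distortion q h with hΛdef
  have hapos : 0 < a ^ 2 := by positivity
  rw [normQuot, if_neg ha0, div_le_iff₀ hapos] at h1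
  have hq0 := hq.nonneg x hx
  have h2 : a ^ 2 ≤ 1 := pow_le_one₀ ha.1 ha.2
  have h3 : 2 * Λ * q x * a ^ 2 ≤ 2 * Λ * q x :=
    mul_le_of_le_one_right (by positivity) h2
  have h4 : 2 * Λ * zoneRadius Λ ≤ 1 / 8 := by
    rw [zoneRadius, mul_one_div, div_le_iff₀ (by positivity)]
    have : Λ ^ 1 ≤ Λ ^ 4 := pow_le_pow_right₀ hΛ (by norm_num)
    linarith
  have h5 : 2 * Λ * q x < 2 * Λ * zoneRadius Λ := by gcongr
  linarith

variable {L : ℝ} (hL : 0 ≤ L) (hLd : ∀ x, |deriv Real.smoothTransition x| ≤ L)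
  {t : ℝ} (ht : t ∈ Icc (0 : ℝ) 1)

include hL hLd ht

/-- The function whose fixed point is the damping factor is a contraction: it is not locally
constant only at the points with squared norm at most `2 * distortion * dampRadius ^ 2`, and there the
derivative of `normQuot` is of the third order in the norm. -/
theorem abs_deriv_damp_normQuot_le {x : M} (hx : x ∈ N.total)
    (hxq : q x < zoneRadius (N.distortion q h)) {a : ℝ} (ha : a ∈ Icc (0 : ℝ) 1) :
    |deriv (fun a => damp t (dampRadius L (N.distortion q h)) (N.normQuot q h a x)) a| ≤ 1 / 2 := by
  have hΛ := hq.one_le_distortion hB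
  obtain ⟨h1, -, h3⟩ := hq.normQuot_bounds hB hx hxq ha
  set Λ := N.distortion q h with hΛdef
  have he := dampRadius_pos hL hΛ
  have hlam : dampRadius L Λ * (32 * (L + 1) * Λ ^ 4) = 1 := by
    rw [dampRadius]; field_simp
  set e := dampRadius L Λ with hedef
  have hd := (hq.differentiableAt_normQuot hB hx a).hasDerivAt
  have hcomp := (HasDerivAt.comp (h₂ := damp t e) a (hasDerivAt_damp t e (N.normQuot q h a x)) hd)
  have hcomp' : deriv (fun a => damp t e (N.normQuot q h a x)) a = _ := hcomp.deriv
  by_cases hbig : e ^ 2 < N.normQuot q h a x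
  · have : (fun a => damp t e (N.normQuot q h a x)) =ᶠ[𝓝 a] fun _ => 1 := by
      filter_upwards [hd.continuousAt.eventually (eventually_gt_nhds hbig)] with b hb
        using damp_of_le he hb.le
    rw [this.deriv_eq, deriv_const, abs_zero]
    norm_num
  push Not at hbig
  rw [hcomp']
  have hq0 := hq.nonneg x hx
  have hs2 : √(q x) ^ 2 = q x := Real.sq_sqrt hq0
  have hs0 : 0 ≤ √(q x) := Real.sqrt_nonneg _
  set s := √(q x)
  -- where the factor is not locally constant, the norm of the point is comparable with `e`
  have hs : s ≤ 2 * Λ * e := by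
    refine abs_le_of_sq_le_sq' ?_ (by positivity) |>.2
    have h5 := h1.trans hbig
    rw [div_le_iff₀ (by positivity)] at h5
    rw [hs2]
    have : 0 ≤ e ^ 2 * Λ * (Λ - 1) := by
      have : 0 ≤ Λ - 1 := by linarith
      positivity
    nlinarith [sq_nonneg e]
  have h6 : Λ * s ^ 3 ≤ Λ * (2 * Λ * e) ^ 3 := by gcongr
  have ht1 : |t| ≤ 1 := abs_le.2 ⟨by linarith [ht.1], ht.2⟩
  rw [abs_mul, abs_mul, abs_mul, abs_of_pos (by positivity : 0 < 2 / e ^ 2)]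
  calc |t| * (|deriv Real.smoothTransition (2 * (N.normQuot q h a x / e ^ 2) - 1)| * (2 / e ^ 2)) *
        |deriv (fun a => N.normQuot q h a x) a|
      ≤ 1 * (L * (2 / e ^ 2)) * (Λ * (2 * Λ * e) ^ 3) := by
        gcongr
        · exact hLd _
        · exact h3.trans h6
    _ = 16 * L * Λ ^ 4 * e := by field_simp; ring
    _ ≤ 1 / 2 := by
        have : 0 ≤ Λ ^ 4 * e := by positivity
        nlinarith

theorem exists_damp_normQuot_eq {x : M} (hx : x ∈ N.total)
    (hxq : q x < zoneRadius (N.distortion q h)) :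
    (∃ a ∈ Icc (0 : ℝ) 1,
      damp t (dampRadius L (N.distortion q h)) (N.normQuot q h a x) = a) ∧
    ∀ a ∈ Icc (0 : ℝ) 1, ∀ b ∈ Icc (0 : ℝ) 1,
      damp t (dampRadius L (N.distortion q h)) (N.normQuot q h a x) = a →
      |a - b| ≤ 2 * |damp t (dampRadius L (N.distortion q h)) (N.normQuot q h b x) - b| := by
  refine exists_fixed_of_abs_deriv_le (fun a _ => damp_mem ht _ _) (fun a => ?_)
    fun a ha => hq.abs_deriv_damp_normQuot_le hB hL hLd ht hx hxq ha
  exact ((hasDerivAt_damp _ _ _).comp a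
    (hq.differentiableAt_normQuot hB hx a).hasDerivAt).differentiableAt

end RegularNeighborhood.IsFibreNormSq

end Zone

/-! ### The deformation -/

section Straightening

open Filter

variable {V : Type*} [NormedAddCommGroup V] [NormedSpace ℝ V]
  {H : Type*} [TopologicalSpace H] {I : ModelWithCorners ℝ V H}
  {M : Type u} [TopologicalSpace M] [ChartedSpace H M]

namespace RegularNeighborhood

variable {B : Set M} (N : RegularNeighborhood I B)

/-- The factor `a` by which the point `x` is multiplied at the time `t` in the deformation of `h`:
a solution of an equation which involves the norm of the image of `x`, so that the deformed
diffeomorphism has an explicit inverse. It is set to `1` where there is no solution. -/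
noncomputable def dampFactor (q : M → ℝ) (L t : ℝ) (h : M → M) (x : M) : ℝ :=
  open Classical in
  if ex : ∃ a ∈ Icc (0 : ℝ) 1,
    damp t (dampRadius L (N.distortion q h)) (N.normQuot q h a x) = a then ex.choose else 1

/-- The disc bundle where `h` is deformed. -/
def zone (q : M → ℝ) (h : M → M) : Set M :=
  {x | x ∈ N.total ∧ q x < zoneRadius (N.distortion q h)}

/-- The deformation of the diffeomorphism `h` at the time `t`: near the base, `h` is replaced by
its conjugate by the multiplication by `dampFactor`. -/
noncomputable def straighten (q : M → ℝ) (L t : ℝ) (h : M → M) (x : M) : M :=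
  open Classical in
  if x ∈ N.zone q h then N.dil h (N.dampFactor q L t h x) x else h x

/-- The inverse of `straighten`, where `k` is the inverse of `h` and `Λ` is the distortion
of `h`. -/
noncomputable def unstraighten (q : M → ℝ) (L t Λ : ℝ) (k : M → M) (y : M) : M :=
  open Classical in
  if y ∈ N.total ∧ q y < zoneRadius Λ / (8 * Λ) then
    N.dil k (damp t (dampRadius L Λ) (q y)) y else k y

theorem straighten_of_mem {q : M → ℝ} (L t : ℝ) {h : M → M} {x : M} (hx : x ∈ N.zone q h) :
    N.straighten q L t h x = N.dil h (N.dampFactor q L t h x) x := by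
  rw [straighten, if_pos hx]

theorem straighten_of_notMem {q : M → ℝ} (L t : ℝ) {h : M → M} {x : M} (hx : x ∉ N.zone q h) :
    N.straighten q L t h x = h x := by
  rw [straighten, if_neg hx]

variable [T2Space M] [IsManifold I ∞ M]

variable {N} in
/-- The conjugates of a family of maps by the multiplication by a variable factor. -/
theorem mapFamilyAt_dil {T : Type*} [TopologicalSpace T] {h : T → M → M}
    (hh : ∀ τ x, MapFamilyAt I h τ x) (hB : ∀ τ, MapsTo (h τ) B B)
    {k m : ℕ} (c : TrivializedChart I N.total N.proj N.smul N.add k m) {τ₀ : T} {x₀ : M}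
    (hc : x₀ ∈ c.e.source) {a : T → M → ℝ}
    (ha : SmoothFamilyAt (fun τ w => a τ (c.e.symm w)) (modelSet k m) (τ₀, c.e x₀))
    (hmem : h τ₀ (N.smul (a τ₀ x₀) x₀) ∈ N.total) {Φ : T → M → M}
    (hΦ : ∀ᶠ w in 𝓝 (τ₀, x₀), Φ w.1 w.2 = N.dil (h w.1) (a w.1 w.2) w.2) :
    MapFamilyAt I Φ τ₀ x₀ := by
  have hinv : c.e.symm (c.e x₀) = x₀ := c.e.left_inv hc
  have hw₀ := c.e.map_source hc
  have hm := c.target_subset hw₀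
  have h1 := N.manifoldFamilyAt_dil hh hB c (τ₀ := τ₀) (a₀ := a τ₀ x₀) hw₀ (by rwa [hinv])
  have h2 := ha.prodMk (smoothFamilyAt_id (uniqueDiffOn_modelSet k m) hm)
    (uniqueDiffOn_modelSet k m) hm
  have h3 := ManifoldFamilyAt.comp (g := fun τ z => N.dil (h τ) z.1 (c.e.symm z.2))
    (t := univ ×ˢ modelSet k m) (by simpa only [hinv] using h1) h2
    (uniqueDiffOn_modelSet k m) (uniqueDiffOn_univ.prod (uniqueDiffOn_modelSet k m)) hm
    (by filter_upwards [self_mem_nhdsWithin] with q hq using ⟨mem_univ _, hq.2⟩)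
  have hsrc := c.isOpen_source.mem_nhds hc
  refine MapFamilyAt.of_coordinates h3 (c.contMDiffAt_toFun hc) (uniqueDiffOn_modelSet k m) ?_ ?_
  · filter_upwards [hsrc] with y hy using c.target_subset (c.e.map_source hy)
  · filter_upwards [continuousAt_snd.tendsto.eventually hsrc, hΦ] with w hw hw'
    simp only [c.e.left_inv hw, hw']

namespace IsFibreNormSq

variable {N} {U : Set M} {q : M → ℝ} (hq : N.IsFibreNormSq U q)

section Single

variable {h : M ≃ₘ⟮I, I⟯ M} (hB : h ∈ diffInv I B)

include hq hB

theorem zoneRadius_le_cutoff {x : M} (hx : x ∉ N.zone q h) :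
    zoneRadius (N.distortion q h) / 2 < N.cutoff q x := by
  have h1 := zoneRadius_le (hq.one_le_distortion hB)
  have h2 := zoneRadius_pos (hq.one_le_distortion hB)
  by_contra hlt
  push Not at hlt
  obtain ⟨h3, h4⟩ := of_cutoff_lt (N := N) (q := q) (x := x) (by linarith)
  exact hx ⟨h3, by linarith⟩

variable {L : ℝ} (hL : 0 ≤ L) (hLd : ∀ x, |deriv Real.smoothTransition x| ≤ L)
  {t : ℝ} (ht : t ∈ Icc (0 : ℝ) 1)

include hL hLd ht

theorem dampFactor_spec {x : M} (hx : x ∈ N.zone q h) :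
    N.dampFactor q L t h x ∈ Icc (0 : ℝ) 1 ∧
      damp t (dampRadius L (N.distortion q h)) (N.normQuot q h (N.dampFactor q L t h x) x) =
        N.dampFactor q L t h x := by
  have ex := (hq.exists_damp_normQuot_eq hB hL hLd ht hx.1 hx.2).1
  rw [dampFactor, dif_pos ex]
  exact ex.choose_spec

theorem abs_dampFactor_sub_le {x : M} (hx : x ∈ N.zone q h) {b : ℝ} (hb : b ∈ Icc (0 : ℝ) 1) :
    |N.dampFactor q L t h x - b| ≤
      2 * |damp t (dampRadius L (N.distortion q h)) (N.normQuot q h b x) - b| :=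
  have h1 := hq.dampFactor_spec hB hL hLd ht hx
  (hq.exists_damp_normQuot_eq hB hL hLd ht hx.1 hx.2).2 _ h1.1 b hb h1.2

theorem dampFactor_eq {x : M} (hx : x ∈ N.zone q h) {b : ℝ} (hb : b ∈ Icc (0 : ℝ) 1)
    (hb' : damp t (dampRadius L (N.distortion q h)) (N.normQuot q h b x) = b) :
    N.dampFactor q L t h x = b := by
  have h1 := hq.abs_dampFactor_sub_le hB hL hLd ht hx hb
  rw [hb', sub_self, abs_zero, mul_zero] at h1
  exact sub_eq_zero.1 (abs_nonpos_iff.1 h1)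

theorem dampFactor_eq_one {x : M} (hx : x ∈ N.zone q h)
    (hxq : dampRadius L (N.distortion q h) ^ 2 ≤ N.normQuot q h 1 x) :
    N.dampFactor q L t h x = 1 :=
  hq.dampFactor_eq hB hL hLd ht hx ⟨zero_le_one, le_rfl⟩
    (damp_of_le (dampRadius_pos hL (hq.one_le_distortion hB)) hxq)

theorem straighten_eq_of_le_normQuot {x : M} (hx : x ∈ N.zone q h)
    (hxq : dampRadius L (N.distortion q h) ^ 2 ≤ N.normQuot q h 1 x) :
    N.straighten q L t h x = h x := by
  rw [N.straighten_of_mem L t hx, hq.dampFactor_eq_one hB hL hLd ht hx hxq]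
  have h1 := (hq.map_smul_mem hB hx.1 hx.2 (⟨zero_le_one, le_rfl⟩ : (1 : ℝ) ∈ Icc (0 : ℝ) 1)).1
  rw [N.smul_one hx.1] at h1
  exact N.dil_one hx.1 h1

theorem straighten_of_lt_cutoff {x : M}
    (hx : zoneRadius (N.distortion q h) / 2 < N.cutoff q x) :
    N.straighten q L t h x = h x := by
  by_cases hxz : x ∈ N.zone q h
  · refine hq.straighten_eq_of_le_normQuot hB hL hLd ht hxz ?_
    have hΛ := hq.one_le_distortion hB
    have h0 := zoneRadius_le hΛ
    have h1 := (hq.normQuot_bounds hB hxz.1 hxz.2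
      (⟨zero_le_one, le_rfl⟩ : (1 : ℝ) ∈ Icc (0 : ℝ) 1)).1
    have h2 := (dampRadius_le hL hΛ).2
    rw [cutoff_of_lt hxz.1 (by linarith [hxz.2])] at hx
    refine le_trans ?_ h1
    rw [le_div_iff₀ (by linarith)]
    linarith
  · exact N.straighten_of_notMem L t hxz

end Single

section Family

variable {T : Type*} [TopologicalSpace T] {h : T → (M ≃ₘ⟮I, I⟯ M)}
  (hh : ∀ τ x, MapFamilyAt I (fun τ => h τ) τ x) (hB : ∀ τ, h τ ∈ diffInv I B)

include hq hh hB

theorem continuous_zoneRadius : Continuous fun τ => zoneRadius (N.distortion q (h τ)) := by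
  have hc := hq.continuous_distortion hh hB
  unfold zoneRadius
  refine continuous_const.div (continuous_const.mul (hc.pow 4)) fun τ => ?_
  have := hq.one_le_distortion (hB τ)
  positivity

theorem eventually_mem_zone {τ : T} {x : M} (hx : x ∈ N.zone q (h τ)) :
    ∀ᶠ w : T × M in 𝓝 (τ, x), w.2 ∈ N.zone q (h w.1) := by
  have h1 : ContinuousAt (fun w : T × M => zoneRadius (N.distortion q (h w.1))) (τ, x) :=
    ((hq.continuous_zoneRadius hh hB).comp continuous_fst).continuousAt
  have h2 : ContinuousAt (fun w : T × M => q w.2) (τ, x) :=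
    ContinuousAt.comp (f := Prod.snd) (g := q) (hq.continuousAt hx.1) continuousAt_snd
  filter_upwards [h2.eventually_lt h1 hx.2,
    continuousAt_snd.tendsto.eventually (N.isOpen_total.mem_nhds hx.1)]
    with w hw hw' using ⟨hw', hw⟩

theorem continuous_dampRadius {L : ℝ} (hL : 0 ≤ L) :
    Continuous fun τ => dampRadius L (N.distortion q (h τ)) := by
  have hc := hq.continuous_distortion hh hB
  unfold dampRadius
  refine continuous_const.div (continuous_const.mul (hc.pow 4)) fun τ => ?_
  have := hq.one_le_distortion (hB τ)
  positivity

variable {L : ℝ} (hL : 0 ≤ L) (hLd : ∀ x, |deriv Real.smoothTransition x| ≤ L)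
  {t : T → ℝ} (htc : Continuous t) (ht : ∀ τ, t τ ∈ Icc (0 : ℝ) 1)

include hL hLd htc ht

/-- Fixed points of uniform contractions depend continuously on parameters. -/
theorem continuousAt_dampFactor {τ : T} {x : M} (hx : x ∈ N.zone q (h τ)) :
    ContinuousAt (fun w : T × M => N.dampFactor q L (t w.1) (h w.1) w.2) (τ, x) := by
  obtain ⟨hb, hb'⟩ := hq.dampFactor_spec (hB τ) hL hLd (ht τ) hx
  set b := N.dampFactor q L (t τ) (h τ) x with hbdef
  have h1 : ContinuousAt (fun w : T × M => N.normQuot q (h w.1) b w.2) (τ, x) :=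
    ContinuousAt.comp (g := fun w : T × (ℝ × M) => N.normQuot q (h w.1) w.2.1 w.2.2)
      (f := fun w : T × M => (w.1, (b, w.2)))
      (hq.continuousAt_normQuot hh (fun τ => mapsTo_of_mem_diffInv (hB τ)) τ b hx.1).2.1
      (Continuous.continuousAt (by fun_prop))
  have h2 : ContinuousAt (fun w : T × M => (t w.1, dampRadius L (N.distortion q (h w.1)),
      N.normQuot q (h w.1) b w.2)) (τ, x) :=
    (htc.comp continuous_fst).continuousAt.prodMk
      (((hq.continuous_dampRadius hh hB hL).comp continuous_fst).continuousAt.prodMk h1)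
  have h3 : ContinuousAt (fun w : T × M => damp (t w.1) (dampRadius L (N.distortion q (h w.1)))
      (N.normQuot q (h w.1) b w.2)) (τ, x) :=
    ContinuousAt.comp (g := fun y : ℝ × ℝ × ℝ => damp y.1 y.2.1 y.2.2)
      (f := fun w : T × M => (t w.1, dampRadius L (N.distortion q (h w.1)),
        N.normQuot q (h w.1) b w.2))
      (contDiffAt_damp (dampRadius_pos hL (hq.one_le_distortion (hB τ))).ne').continuousAt h2
  have h4 : Tendsto (fun w : T × M => 2 * |damp (t w.1) (dampRadius L (N.distortion q (h w.1)))
      (N.normQuot q (h w.1) b w.2) - b|) (𝓝 (τ, x)) (𝓝 0) := by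
    have h5 := ((h3.tendsto.sub_const b).abs.const_mul 2)
    rwa [hb', sub_self, abs_zero, mul_zero] at h5
  rw [ContinuousAt, tendsto_iff_norm_sub_tendsto_zero]
  refine squeeze_zero' (Eventually.of_forall fun _ => norm_nonneg _) ?_ h4
  filter_upwards [hq.eventually_mem_zone hh hB hx] with w hw
  exact hq.abs_dampFactor_sub_le (hB w.1) hL hLd (ht w.1) hw hb

/-- The damping factors form a smooth family, by the implicit function theorem. -/
theorem smoothFamilyAt_dampFactor {τ : T} {x : M} (hx : x ∈ N.zone q (h τ))
    {k m : ℕ} (c : TrivializedChart I N.total N.proj N.smul N.add k m) (hc : x ∈ c.e.source) :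
    SmoothFamilyAt (fun τ w => N.dampFactor q L (t τ) (h τ) (c.e.symm w)) (modelSet k m)
      (τ, c.e x) := by
  have hinv : c.e.symm (c.e x) = x := c.e.left_inv hc
  have hw₀ := c.e.map_source hc
  have hm := c.target_subset hw₀
  set S : Set (ℝ × (EuclideanSpace ℝ (Fin k) × EuclideanSpace ℝ (Fin m))) :=
    univ ×ˢ modelSet k m with hS
  have hSu : UniqueDiffOn ℝ S := uniqueDiffOn_univ.prod (uniqueDiffOn_modelSet k m)
  obtain ⟨hb, hb'⟩ := hq.dampFactor_spec (hB τ) hL hLd (ht τ) hx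
  set b := N.dampFactor q L (t τ) (h τ) x with hbdef
  have hpS : (b, c.e x) ∈ S := ⟨mem_univ _, hm⟩
  have h1 := hq.smoothFamilyAt_normQuot hh (fun τ => mapsTo_of_mem_diffInv (hB τ)) c τ b hw₀
  have h2 : SmoothFamilyAt
      (fun τ (z : ℝ × (EuclideanSpace ℝ (Fin k) × EuclideanSpace ℝ (Fin m))) =>
        damp (t τ) (dampRadius L (N.distortion q (h τ))) (N.normQuot q (h τ) z.1 (c.e.symm z.2)))
      S (τ, (b, c.e x)) :=
    ((smoothFamilyAt_param htc).prodMk ((smoothFamilyAt_param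
      (hq.continuous_dampRadius hh hB hL)).prodMk h1 hSu hpS) hSu hpS).contDiffAt_comp
      (g := fun y : ℝ × ℝ × ℝ => damp y.1 y.2.1 y.2.2)
      (contDiffAt_damp (dampRadius_pos hL (hq.one_le_distortion (hB τ))).ne') hSu hpS
  have hev : ∀ᶠ p in 𝓝[univ ×ˢ modelSet k m] (τ, c.e x),
      p.2 ∈ c.e.target ∧ c.e.symm p.2 ∈ N.zone q (h p.1) := by
    have h3 : Tendsto (fun p : T × (EuclideanSpace ℝ (Fin k) × EuclideanSpace ℝ (Fin m)) =>
        p.2) (𝓝[univ ×ˢ modelSet k m] (τ, c.e x)) (𝓝[modelSet k m] (c.e x)) :=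
      tendsto_nhdsWithin_iff.2 ⟨(Continuous.tendsto' (by fun_prop) _ _ rfl).mono_left
        nhdsWithin_le_nhds, by filter_upwards [self_mem_nhdsWithin] with q hq using hq.2⟩
    have h4 := (c.contMDiffWithinAt_symm hw₀).continuousWithinAt.tendsto.comp h3
    rw [hinv] at h4
    have h5 := ((Continuous.tendsto' continuous_fst (τ, c.e x) τ rfl).mono_left
      (nhdsWithin_le_nhds (s := univ ×ˢ modelSet k m))).prodMk_nhds h4
    filter_upwards [h3.eventually (c.target_mem_nhdsWithin hw₀),
      h5.eventually (hq.eventually_mem_zone hh hB hx)] with p hp hp' using ⟨hp, hp'⟩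
  refine SmoothFamilyAt.implicit (Φ := fun τ z => damp (t τ)
      (dampRadius L (N.distortion q (h τ))) (N.normQuot q (h τ) z.1 (c.e.symm z.2)))
    (uniqueDiffOn_modelSet k m) hm (by simpa only [hinv] using h2) ?_ ?_ ?_
  · filter_upwards [hev] with p hp
    have h3 : Tendsto (fun p : T × (EuclideanSpace ℝ (Fin k) × EuclideanSpace ℝ (Fin m)) =>
        p.2) (𝓝[univ ×ˢ modelSet k m] p) (𝓝[modelSet k m] p.2) :=
      tendsto_nhdsWithin_iff.2 ⟨(Continuous.tendsto' (by fun_prop) _ _ rfl).mono_left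
        nhdsWithin_le_nhds, by filter_upwards [self_mem_nhdsWithin] with q hq using hq.2⟩
    have h4 := (c.contMDiffWithinAt_symm hp.1).continuousWithinAt.tendsto.comp h3
    have h5 := ((Continuous.tendsto' continuous_fst p p.1 rfl).mono_left
      (nhdsWithin_le_nhds (s := univ ×ˢ modelSet k m))).prodMk_nhds h4
    exact (hq.continuousAt_dampFactor hh hB hL hLd htc ht hp.2).tendsto.comp h5
  · filter_upwards [hev] with p hp
    exact (hq.dampFactor_spec (hB p.1) hL hLd (ht p.1) hp.2).2.symm
  · simp only [hinv, ← hbdef]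
    have h3 := (h2.eventually_hasDerivAt_fst.self_of_nhdsWithin (mem_prod_of_mem hpS)).deriv
    simp only [hinv] at h3
    rw [← h3]
    have h4 := hq.abs_deriv_damp_normQuot_le (hB τ) hL hLd (ht τ) hx.1 hx.2 hb
    intro h5
    rw [h5] at h4
    norm_num at h4

/-- The deformed diffeomorphisms form a smooth family. -/
theorem mapFamilyAt_straighten (τ : T) (x : M) :
    MapFamilyAt I (fun τ => N.straighten q L (t τ) (h τ)) τ x := by
  by_cases hx : x ∈ N.zone q (h τ)
  · obtain ⟨k, m, c, hc⟩ := N.exists_chart_of_mem hx.1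
    refine mapFamilyAt_dil hh (fun τ => mapsTo_of_mem_diffInv (hB τ)) c hc
      (hq.smoothFamilyAt_dampFactor hh hB hL hLd htc ht hx c hc) ?_ ?_
    · exact (hq.map_smul_mem (hB τ) hx.1 hx.2
        (hq.dampFactor_spec (hB τ) hL hLd (ht τ) hx).1).1
    · filter_upwards [hq.eventually_mem_zone hh hB hx] with w hw
      exact N.straighten_of_mem L _ hw
  · refine (hh τ x).congr ?_
    have h1 : ContinuousAt (fun w : T × M => zoneRadius (N.distortion q (h w.1)) / 2) (τ, x) :=
      (((hq.continuous_zoneRadius hh hB).comp continuous_fst).div_const 2).continuousAt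
    have h2 : ContinuousAt (fun w : T × M => N.cutoff q w.2) (τ, x) :=
      (hq.contMDiff_cutoff.continuous.comp continuous_snd).continuousAt
    filter_upwards [h1.eventually_lt h2 (hq.zoneRadius_le_cutoff (hB τ) hx)] with w hw
    exact hq.straighten_of_lt_cutoff (hB w.1) hL hLd (ht w.1) hw

end Family

end IsFibreNormSq

end RegularNeighborhood

end Straightening

/-! ### The inverse of a deformed diffeomorphism -/

section Inverse

open Filter

variable {V : Type*} [NormedAddCommGroup V] [NormedSpace ℝ V]
  {H : Type*} [TopologicalSpace H] {I : ModelWithCorners ℝ V H}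
  {M : Type u} [TopologicalSpace M] [ChartedSpace H M] [T2Space M] [IsManifold I ∞ M]

namespace RegularNeighborhood.IsFibreNormSq

variable {B : Set M} {N : RegularNeighborhood I B} {U : Set M} {q : M → ℝ}
  (hq : N.IsFibreNormSq U q) {h : M ≃ₘ⟮I, I⟯ M} (hB : h ∈ diffInv I B)

include hq hB

omit hq [T2Space M] [IsManifold I ∞ M] in
theorem _root_.mapsTo_symm_of_mem_diffInv : MapsTo h.symm B B := by
  intro b hb
  obtain ⟨c, hc, rfl⟩ := hB.superset hb
  simpa using hc

theorem base_subset_zone : B ⊆ N.zone q h := by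
  intro b hb
  refine ⟨N.base_subset hb, ?_⟩
  rw [(hq.eq_zero_iff b (N.base_subset hb)).2 hb]
  exact zoneRadius_pos (hq.one_le_distortion hB)

omit hB [T2Space M] [IsManifold I ∞ M] in
theorem isOpen_zone : IsOpen (N.zone q h) :=
  ContinuousOn.isOpen_inter_preimage (fun _ hx => (hq.continuousAt hx).continuousWithinAt)
    N.isOpen_total isOpen_Iio

theorem map_mem_of_mem_zone {x : M} (hx : x ∈ N.zone q h) : h x ∈ N.total ∧
    N.normQuot q h 1 x = q (h x) ∧ q x / (2 * N.distortion q h) ≤ q (h x) := by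
  have h1 : (1 : ℝ) ∈ Icc (0 : ℝ) 1 := ⟨zero_le_one, le_rfl⟩
  obtain ⟨h2, -, h3⟩ := hq.map_smul_mem hB hx.1 hx.2 h1
  rw [N.smul_one hx.1] at h2
  rw [N.dil_one hx.1 h2] at h3
  exact ⟨h2, h3, h3 ▸ (hq.normQuot_bounds hB hx.1 hx.2 h1).1⟩

/-- The inverse of `h` maps a small disc bundle to the zone where `h` is deformed. -/
theorem symm_smul_mem {y : M} (hy : y ∈ N.total)
    (hyq : q y < zoneRadius (N.distortion q h) / (8 * N.distortion q h)) {s : ℝ}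
    (hs : s ∈ Icc (0 : ℝ) 1) : h.symm (N.smul s y) ∈ N.total ∧
      q (h.symm (N.smul s y)) < zoneRadius (N.distortion q h) / 4 := by
  have hΛ := hq.one_le_distortion hB
  set Λ := N.distortion q h with hΛdef
  have hr0 := zoneRadius_pos hΛ
  have hr1 := zoneRadius_le hΛ
  suffices hlt : N.cutoff q (h.symm (N.smul s y)) < zoneRadius Λ / 4 by
    obtain ⟨h1, h2⟩ := of_cutoff_lt (N := N) (q := q) (x := h.symm (N.smul s y)) (by linarith)
    exact ⟨h1, h2 ▸ hlt⟩
  by_contra hge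
  push Not at hge
  have hc : Continuous fun a : ℝ => N.cutoff q (h.symm (N.smul a y)) := by
    refine hq.contMDiff_cutoff.continuous.comp (h.symm.contMDiff.continuous.comp ?_)
    refine continuous_iff_continuousAt.2 fun a => ?_
    exact ContinuousAt.comp (f := fun a : ℝ => (a, y))
      (g := fun w : ℝ × M => N.smul w.1 w.2) (N.continuousAt_smul hy)
      (Continuous.continuousAt (by fun_prop))
  have h0 : N.cutoff q (h.symm (N.smul 0 y)) = 0 :=
    hq.cutoff_base (mapsTo_symm_of_mem_diffInv hB (N.smul_zero_mem hy))
  -- the curve `s ↦ h⁻¹ (s y)` would meet the sphere bundle of squared radius `zoneRadius / 4`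
  obtain ⟨a, ha, ha'⟩ := intermediate_value_Icc hs.1 hc.continuousOn
    (show zoneRadius Λ / 4 ∈ _ from ⟨by rw [h0]; linarith, hge⟩)
  replace ha' : N.cutoff q (h.symm (N.smul a y)) = zoneRadius Λ / 4 := ha'
  obtain ⟨h1, h2⟩ := of_cutoff_lt (N := N) (q := q) (x := h.symm (N.smul a y))
    (by rw [ha']; linarith)
  rw [ha'] at h2
  have h3 := (hq.map_mem_of_mem_zone hB (x := h.symm (N.smul a y))
    ⟨h1, by rw [h2, ← hΛdef]; linarith⟩).2.2
  rw [h.apply_symm_apply, hq.smul _ hy, h2, ← hΛdef] at h3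
  have h4 : zoneRadius Λ / 4 / (2 * Λ) = zoneRadius Λ / (8 * Λ) := by field_simp; norm_num
  have h5 : a ^ 2 ≤ 1 := pow_le_one₀ ha.1 (ha.2.trans hs.2)
  nlinarith [hq.nonneg y hy]

theorem lt_quarter {y : M} (hyq : q y < zoneRadius (N.distortion q h) / (8 * N.distortion q h)) :
    q y < 1 / 4 := by
  have hΛ := hq.one_le_distortion hB
  refine hyq.trans_le ((div_le_self (zoneRadius_pos hΛ).le (by linarith)).trans ?_)
  linarith [zoneRadius_le hΛ]

theorem symm_mem_zone {y : M} (hy : y ∈ N.total)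
    (hyq : q y < zoneRadius (N.distortion q h) / (8 * N.distortion q h)) :
    h.symm y ∈ N.zone q h := by
  have h1 := hq.symm_smul_mem hB hy hyq (⟨zero_le_one, le_rfl⟩ : (1 : ℝ) ∈ Icc (0 : ℝ) 1)
  rw [N.smul_one hy] at h1
  exact ⟨h1.1, by linarith [zoneRadius_pos (hq.one_le_distortion hB)]⟩

theorem unstraighten_eq_of_le {L t : ℝ} (hL : 0 ≤ L) {y : M} (hy : y ∈ N.total →
    q y < zoneRadius (N.distortion q h) / (8 * N.distortion q h) →
      dampRadius L (N.distortion q h) ^ 2 ≤ q y) :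
    N.unstraighten q L t (N.distortion q h) h.symm y = h.symm y := by
  rw [unstraighten]
  split_ifs with hyz
  · rw [damp_of_le (dampRadius_pos hL (hq.one_le_distortion hB)) (hy hyz.1 hyz.2)]
    exact N.dil_one hyz.1
      (hq.symm_mem_zone hB hyz.1 hyz.2).1
  · rfl

variable {L : ℝ} (hL : 0 ≤ L) (hLd : ∀ x, |deriv Real.smoothTransition x| ≤ L)
  {t : ℝ} (ht : t ∈ Icc (0 : ℝ) 1)

include hL ht

theorem contMDiff_unstraighten :
    ContMDiff I I ∞ (N.unstraighten q L t (N.distortion q h) h.symm) := by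
  intro y
  have hΛ := hq.one_le_distortion hB
  have he := dampRadius_pos hL hΛ
  by_cases hy : y ∈ N.total ∧ q y < zoneRadius (N.distortion q h) / (8 * N.distortion q h)
  · obtain ⟨k, m, c, hc⟩ := N.exists_chart_of_mem hy.1
    have hm := c.target_subset (c.e.map_source hc)
    have hinv : c.e.symm (c.e y) = y := c.e.left_inv hc
    have h1 : SmoothFamilyAt (fun (_ : Unit) w => q (c.e.symm w)) (modelSet k m) ((), c.e y) :=
      ManifoldFamilyAt.contMDiffAt_comp (I := I) ((smoothFamilyAt_id (T := Unit)
        (uniqueDiffOn_modelSet k m) hm).contMDiffWithinAt_comp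
          (c.contMDiffWithinAt_symm (c.e.map_source hc)) (uniqueDiffOn_modelSet k m)
          (uniqueDiffOn_modelSet k m) hm
          (by filter_upwards [self_mem_nhdsWithin] with q hq using hq.2))
        (by simpa only [hinv] using hq.contMDiffAt y hy.1) (uniqueDiffOn_modelSet k m) hm
    have hd : ContDiff ℝ ∞ (damp t (dampRadius L (N.distortion q h))) :=
      contDiff_iff_contDiffAt.2 fun ρ => ContDiffAt.comp ρ
        (g := fun y : ℝ × ℝ × ℝ => damp y.1 y.2.1 y.2.2)
        (f := fun ρ : ℝ => (t, dampRadius L (N.distortion q h), ρ)) (contDiffAt_damp he.ne')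
        (contDiffAt_const.prodMk (contDiffAt_const.prodMk contDiffAt_id))
    have h2 := h1.contDiffAt_comp hd.contDiffAt (uniqueDiffOn_modelSet k m) hm
    refine (mapFamilyAt_dil (T := Unit) (h := fun _ => h.symm) (τ₀ := ())
      (a := fun _ y => damp t (dampRadius L (N.distortion q h)) (q y))
      (Φ := fun _ => N.unstraighten q L t (N.distortion q h) h.symm)
      (fun _ x => mapFamilyAt_const h.symm.contMDiff.contMDiffAt)
      (fun _ => mapsTo_symm_of_mem_diffInv hB) c hc h2
      (hq.symm_smul_mem hB hy.1 hy.2 (damp_mem ht _ _)).1 ?_).contMDiffAt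
    have h3 : ∀ᶠ w : Unit × M in 𝓝 ((), y), w.2 ∈ N.total ∧
        q w.2 < zoneRadius (N.distortion q h) / (8 * N.distortion q h) :=
      (continuousAt_snd (X := Unit) (p := ((), y))).tendsto.eventually
        ((N.isOpen_total.eventually_mem hy.1).and
          ((hq.continuousAt hy.1).eventually_lt_const hy.2))
    filter_upwards [h3] with w hw
    rw [unstraighten, if_pos hw]
  · refine h.symm.contMDiff.contMDiffAt.congr_of_eventuallyEq ?_
    have h1 : dampRadius L (N.distortion q h) ^ 2 < N.cutoff q y := by
      have h2 := (dampRadius_le hL hΛ).1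
      by_contra hlt
      push Not at hlt
      have h3 : zoneRadius (N.distortion q h) / (8 * N.distortion q h) ≤ 1 / 4 :=
        (div_le_self (zoneRadius_pos hΛ).le (by linarith)).trans
          (by linarith [zoneRadius_le hΛ])
      obtain ⟨h4, h5⟩ := of_cutoff_lt (N := N) (q := q) (x := y) (by linarith)
      exact hy ⟨h4, by linarith⟩
    filter_upwards [hq.contMDiff_cutoff.continuous.continuousAt.eventually
      (eventually_gt_nhds h1)] with z hz
    refine hq.unstraighten_eq_of_le hB hL fun hzt hzq => ?_
    rw [cutoff_of_lt hzt (hq.lt_quarter hB hzq).le] at hz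
    exact hz.le

include hLd

theorem straighten_of_le_map {x : M} (hxq : h x ∈ N.total →
      q (h x) < zoneRadius (N.distortion q h) / (8 * N.distortion q h) →
      dampRadius L (N.distortion q h) ^ 2 ≤ q (h x)) :
    N.straighten q L t h x = h x := by
  by_cases hx : x ∈ N.zone q h
  · obtain ⟨h1, h2, -⟩ := hq.map_mem_of_mem_zone hB hx
    refine hq.straighten_eq_of_le_normQuot hB hL hLd ht hx ?_
    rw [h2]
    by_cases h3 : q (h x) < zoneRadius (N.distortion q h) / (8 * N.distortion q h)
    · exact hxq h1 h3
    · exact (dampRadius_le hL (hq.one_le_distortion hB)).1.le.trans (not_lt.1 h3)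
  · exact N.straighten_of_notMem L t hx

/-- The factor used by `unstraighten` is `dampFactor`, since the latter is defined by an equation
involving the norm of the image only. -/
theorem unstraighten_straighten (x : M) :
    N.unstraighten q L t (N.distortion q h) h.symm (N.straighten q L t h x) = x := by
  have hΛ := hq.one_le_distortion hB
  by_cases hx : x ∈ N.zone q h
  · obtain ⟨ha, ha'⟩ := hq.dampFactor_spec hB hL hLd ht hx
    obtain ⟨h1, h2, h3⟩ := hq.map_smul_mem hB hx.1 hx.2 ha
    set a := N.dampFactor q L t h x with hadef
    have h4 := N.straighten_of_mem L t hx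
    rw [← hadef] at h4
    rw [h3] at ha'
    by_cases hy : q (N.dil h a x) < zoneRadius (N.distortion q h) / (8 * N.distortion q h)
    · rw [h4, unstraighten,
        if_pos ⟨N.dil_mem h.contMDiff (mapsTo_of_mem_diffInv hB) hx.1 h1, hy⟩, ha']
      exact N.dil_dil h.contMDiff h.symm.contMDiff (mapsTo_of_mem_diffInv hB)
        (mapsTo_symm_of_mem_diffInv hB)
        (fun x => h.symm_apply_apply x) hx.1 h1
    · rw [damp_of_le (dampRadius_pos hL hΛ)
        ((dampRadius_le hL hΛ).1.le.trans (not_lt.1 hy))] at ha'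
      rw [← ha', N.dil_one hx.1
        (hq.map_mem_of_mem_zone hB hx).1] at h4 hy
      rw [h4, hq.unstraighten_eq_of_le hB hL (fun _ hlt => absurd hlt hy), h.symm_apply_apply]
  · rw [N.straighten_of_notMem L t hx, hq.unstraighten_eq_of_le hB hL, h.symm_apply_apply]
    intro h1 h2
    have := hq.symm_mem_zone hB h1 h2
    rw [h.symm_apply_apply] at this
    exact absurd this hx

/-- The point given by `unstraighten` is in the zone, and the factor used to find it satisfies the
equation of `dampFactor`. -/
theorem straighten_unstraighten (y : M) :
    N.straighten q L t h (N.unstraighten q L t (N.distortion q h) h.symm y) = y := by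
  have hΛ := hq.one_le_distortion hB
  have hr0 := zoneRadius_pos hΛ
  by_cases hy : y ∈ N.total ∧ q y < zoneRadius (N.distortion q h) / (8 * N.distortion q h)
  · rw [unstraighten, if_pos hy]
    have hb := damp_mem ht (dampRadius L (N.distortion q h)) (q y)
    set b := damp t (dampRadius L (N.distortion q h)) (q y) with hbdef
    obtain ⟨h1, h2⟩ := hq.symm_smul_mem hB hy.1 hy.2 hb
    have hhk : N.dil h b (N.dil h.symm b y) = y :=
      N.dil_dil h.symm.contMDiff h.contMDiff (mapsTo_symm_of_mem_diffInv hB)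
        (mapsTo_of_mem_diffInv hB)
        (fun x => h.apply_symm_apply x) hy.1 h1
    have hxt := N.dil_mem h.symm.contMDiff (mapsTo_symm_of_mem_diffInv hB) hy.1 h1
    have hsm := N.smul_dil h.symm.contMDiff (mapsTo_symm_of_mem_diffInv hB) hy.1 h1
    set x := N.dil h.symm b y with hxdef
    -- the point found lies in the zone where `h` is deformed
    have hxz : x ∈ N.zone q h := by
      refine ⟨hxt, ?_⟩
      by_cases hb0 : b = 0
      · have h3 := hq.normQuot_zero_ge hB hxt
        rw [normQuot, if_pos rfl, ← hb0, hhk] at h3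
        refine h3.trans_lt ?_
        calc N.distortion q h * q y
            < N.distortion q h * (zoneRadius (N.distortion q h) / (8 * N.distortion q h)) := by
              gcongr; exact hy.2
          _ = zoneRadius (N.distortion q h) / 8 := by field_simp
          _ ≤ _ := by linarith
      · have h3 := (hq.map_mem_of_mem_zone hB (x := h.symm (N.smul b y))
          ⟨h1, by linarith⟩).2.2
        have hbpos : 0 < b ^ 2 := by positivity
        rw [h.apply_symm_apply, ← hsm, hq.smul _ hxt, hq.smul _ hy.1, mul_div_assoc,
          mul_le_mul_iff_right₀ hbpos, div_le_iff₀ (by positivity)] at h3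
        refine h3.trans_lt ?_
        calc q y * (2 * N.distortion q h)
            < zoneRadius (N.distortion q h) / (8 * N.distortion q h) *
              (2 * N.distortion q h) := by gcongr; exact hy.2
          _ = zoneRadius (N.distortion q h) / 4 := by field_simp; norm_num
          _ ≤ _ := by linarith
    have h3 := (hq.map_smul_mem hB hxt hxz.2 hb).2.2
    rw [N.straighten_of_mem L t hxz, hq.dampFactor_eq hB hL hLd ht hxz hb (by rw [h3, hhk]), hhk]
  · have h1 : N.unstraighten q L t (N.distortion q h) h.symm y = h.symm y :=
      hq.unstraighten_eq_of_le hB hL fun h2 h3 => absurd ⟨h2, h3⟩ hy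
    rw [h1, hq.straighten_of_le_map hB hL hLd ht, h.apply_symm_apply]
    rw [h.apply_symm_apply]
    exact fun h2 h3 => absurd ⟨h2, h3⟩ hy

theorem exists_diffeomorph_straighten :
    ∃ D : M ≃ₘ⟮I, I⟯ M, ⇑D = N.straighten q L t h :=
  ⟨{ toFun := N.straighten q L t h
     invFun := N.unstraighten q L t (N.distortion q h) h.symm
     left_inv := hq.unstraighten_straighten hB hL hLd ht
     right_inv := hq.straighten_unstraighten hB hL hLd ht
     contMDiff_toFun := fun x => (hq.mapFamilyAt_straighten (T := Unit) (h := fun _ => h)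
        (fun _ _ => mapFamilyAt_const h.contMDiff.contMDiffAt) (fun _ => hB) hL hLd
        (t := fun _ => t) continuous_const (fun _ => ht) () x).contMDiffAt
     contMDiff_invFun := hq.contMDiff_unstraighten hB hL ht }, rfl⟩

end RegularNeighborhood.IsFibreNormSq

end Inverse

/-! ### Leaves and linearity along the deformation -/

section Deformation

open Filter

variable {V : Type*} [NormedAddCommGroup V] [NormedSpace ℝ V]
  {H : Type*} [TopologicalSpace H] {I : ModelWithCorners ℝ V H}
  {M : Type u} [TopologicalSpace M] [ChartedSpace H M] [T2Space M] [IsManifold I ∞ M]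

namespace RegularNeighborhood.IsFibreNormSq

variable {B : Set M} {N : RegularNeighborhood I B} {U : Set M} {q : M → ℝ}
  (hq : N.IsFibreNormSq U q) {h : M ≃ₘ⟮I, I⟯ M} (hB : h ∈ diffInv I B)
  {L : ℝ} (hL : 0 ≤ L) (hLd : ∀ x, |deriv Real.smoothTransition x| ≤ L)
  {t : ℝ} (ht : t ∈ Icc (0 : ℝ) 1)

include hq hB

theorem straighten_base {b : M} (hb : b ∈ B) : N.straighten q L t h b = h b := by
  rw [N.straighten_of_mem L t (hq.base_subset_zone hB hb)]
  exact N.dil_base (mapsTo_of_mem_diffInv hB) hb _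

/-- The conjugates of a leaf preserving diffeomorphism preserve the leaves: by homogeneity for a
nonzero factor, and by the condition on the closures of the leaves for the factor zero. -/
theorem dil_mem_leaf {F : Set (Set M)} (hF : Setoid.IsPartition F) (hhom : N.IsHomogeneous F U)
    (hcl : ∀ S ∈ F, U ∩ (closure S \ S) ⊆ B) (hh : h ∈ diffLP I F) {S : Set M} (hS : S ∈ F)
    {x : M} (hx : x ∈ N.zone q h) (hxS : x ∈ S) {a : ℝ} (ha : a ∈ Icc (0 : ℝ) 1) :
    N.dil h a x ∈ S := by
  have hΛ := hq.one_le_distortion hB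
  have hr := zoneRadius_le hΛ
  have hleaf : ∀ {x : M} {S : Set M}, S ∈ F → x ∈ S → h x ∈ S :=
    fun hS hx => hh _ hS (mem_image_of_mem h hx)
  have hunique : ∀ {y : M}, SameLeaf F x y → y ∈ S := by
    rintro y ⟨S', hS', hxS', hyS'⟩
    rwa [(hF.2 x).unique ⟨hS, hxS⟩ ⟨hS', hxS'⟩]
  have hxU : ∀ {s : ℝ}, s ∈ Icc (0 : ℝ) 1 → N.smul s x ∈ U := fun {s} hs => by
    refine hq.disc_subset _ (N.smul_mem hx.1 s) ?_
    rw [hq.smul _ hx.1]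
    have : s ^ 2 ≤ 1 := pow_le_one₀ hs.1 hs.2
    nlinarith [hx.2, hq.nonneg x hx.1]
  have hdU : ∀ {s : ℝ}, s ∈ Icc (0 : ℝ) 1 → N.dil h s x ∈ U := fun {s} hs => by
    obtain ⟨h1, -, h3⟩ := hq.map_smul_mem hB hx.1 hx.2 hs
    refine hq.disc_subset _ (N.dil_mem h.contMDiff (mapsTo_of_mem_diffInv hB) hx.1 h1) ?_
    rw [← h3]
    refine (hq.normQuot_bounds hB hx.1 hx.2 hs).2.1.trans ?_
    have h4 : 2 * N.distortion q h * zoneRadius (N.distortion q h) ≤ 1 := by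
      rw [zoneRadius, mul_one_div, div_le_one (by positivity)]
      have : N.distortion q h ^ 1 ≤ N.distortion q h ^ 4 := pow_le_pow_right₀ hΛ (by norm_num)
      linarith
    refine le_trans ?_ h4
    gcongr
    exact hx.2.le
  have hne : ∀ {s : ℝ}, s ∈ Ioc (0 : ℝ) 1 → N.dil h s x ∈ S := fun {s} hs => by
    have hs' : s ∈ Icc (0 : ℝ) 1 := ⟨hs.1.le, hs.2⟩
    obtain ⟨h1, h2, -⟩ := hq.map_smul_mem hB hx.1 hx.2 hs'
    obtain ⟨S', ⟨hS', hxS'⟩, -⟩ := hF.2 (N.smul s x)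
    have h3 := hhom (N.smul s x) (hxU hs') (h (N.smul s x)) (hq.disc_subset _ h1 (by linarith))
      s⁻¹ (inv_pos.2 hs.1)
      (by
        rw [N.smul_inv_smul hx.1 hs.1.ne']
        exact hq.disc_subset _ hx.1 (by linarith [hx.2]))
      (by rw [← N.dil_of_ne h hs.1.ne']; exact hdU hs') ⟨S', hS', hxS', hleaf hS' hxS'⟩
    rw [N.smul_inv_smul hx.1 hs.1.ne', ← N.dil_of_ne h hs.1.ne'] at h3
    exact hunique h3
  rcases ha.1.eq_or_lt with rfl | ha0
  · by_cases hxB : x ∈ B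
    · rw [N.dil_base (mapsTo_of_mem_diffInv hB) hxB]
      exact hleaf hS hxS
    by_contra hnot
    have hclos : N.dil h 0 x ∈ closure S := by
      refine mem_closure_of_tendsto
        ((N.tendsto_dil_zero h.contMDiff (mapsTo_of_mem_diffInv hB) hx.1).mono_left
        (nhdsWithin_mono (0 : ℝ) (s := Ioi 0) fun r hr => ne_of_gt hr)) ?_
      filter_upwards [Ioc_mem_nhdsGT (zero_lt_one' ℝ)] with r hr
      rw [← N.dil_of_ne h hr.1.ne']
      exact hne hr
    exact hxB ((N.dil_mem_base_iff h.contMDiff h.symm.contMDiff (mapsTo_of_mem_diffInv hB)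
      (mapsTo_symm_of_mem_diffInv hB) (fun x => h.symm_apply_apply x) hx.1
      (hq.map_smul_mem hB hx.1 hx.2 ha).1).1 (hcl S hS ⟨hdU ha, hclos, hnot⟩))
  · exact hne ⟨ha0, ha.2⟩

include hL hLd ht

theorem straighten_mem_leaf {F : Set (Set M)} (hF : Setoid.IsPartition F)
    (hhom : N.IsHomogeneous F U) (hcl : ∀ S ∈ F, U ∩ (closure S \ S) ⊆ B) (hh : h ∈ diffLP I F)
    {S : Set M} (hS : S ∈ F) {x : M} (hxS : x ∈ S) : N.straighten q L t h x ∈ S := by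
  by_cases hx : x ∈ N.zone q h
  · rw [N.straighten_of_mem L t hx]
    exact hq.dil_mem_leaf hB hF hhom hcl hh hS hx hxS (hq.dampFactor_spec hB hL hLd ht hx).1
  · rw [N.straighten_of_notMem L t hx]
    exact hh _ hS (mem_image_of_mem h hxS)

omit hL hLd ht in
/-- The deformation is supported in a fixed compact set, which makes it continuous in the strong
topology too. -/
theorem straighten_eq_of_notMem_disc {x : M} (hx : x ∉ {x | x ∈ N.total ∧ q x ≤ 1}) :
    N.straighten q L t h x = h x :=
  N.straighten_of_notMem L t fun h1 =>
    hx ⟨h1.1, by linarith [h1.2, zoneRadius_le (hq.one_le_distortion hB)]⟩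

/-- A diffeomorphism which is linear near the base does not change near the base. -/
theorem straighten_mem_diffInvLin (hh : h ∈ diffInvLin N) {D : M ≃ₘ⟮I, I⟯ M}
    (hD : ⇑D = N.straighten q L t h) (hDB : D ∈ diffInv I B) : D ∈ diffInvLin N := by
  obtain ⟨-, g, hg, W, hW, hBW, hWN, hEq⟩ := hh
  -- a disc bundle contained in `W`
  obtain ⟨ρ, hρ, hρW⟩ : ∃ ρ : ℝ, 0 < ρ ∧ ∀ x ∈ N.total, q x < ρ → x ∈ W := by
    have hK : IsCompact ({x | x ∈ N.total ∧ q x ≤ 1} \ W) := hq.isCompact_disc.diff hW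
    have hpos : ∀ x ∈ {x | x ∈ N.total ∧ q x ≤ 1} \ W, 0 < q x := fun x hx =>
      lt_of_le_of_ne (hq.nonneg x hx.1.1) fun h0 => hx.2 (hBW ((hq.eq_zero_iff x hx.1.1).1 h0.symm))
    obtain ⟨ρ, hρ, hρK⟩ := hK.exists_forall_le' (a := 0)
      (fun x hx => (hq.continuousAt hx.1.1).continuousWithinAt) hpos
    refine ⟨min ρ 1, lt_min hρ one_pos, fun x hx hxρ => ?_⟩
    by_contra hxW
    exact absurd (hρK x ⟨⟨hx, (hxρ.trans_le (min_le_right _ _)).le⟩, hxW⟩)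
      (not_le.2 (hxρ.trans_le (min_le_left _ _)))
  have hsmul : ∀ x ∈ N.total, q x < ρ → ∀ a ∈ Icc (-1 : ℝ) 1, h (N.smul a x) = N.smul a (g x) := by
    intro x hx hxρ a ha
    rw [hEq (hρW _ (N.smul_mem hx a) ?_), hg.map_smul a x hx]
    rw [hq.smul _ hx]
    have : a ^ 2 ≤ 1 := by nlinarith [ha.1, ha.2]
    nlinarith [hq.nonneg x hx]
  have hdil : ∀ x ∈ N.total, q x < ρ → ∀ a ∈ Icc (-1 : ℝ) 1, N.dil h a x = g x := by
    intro x hx hxρ a ha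
    by_cases ha0 : a = 0
    · subst ha0
      refine N.dil_zero_eq ?_
      refine tendsto_const_nhds.congr' ?_
      filter_upwards [self_mem_nhdsWithin, nhdsWithin_le_nhds (Icc_mem_nhds
        (by norm_num : (-1 : ℝ) < 0) one_pos)] with r hr hr'
      rw [hsmul x hx hxρ r hr', N.smul_inv_smul (hg.mapsTo hx) hr]
    · rw [N.dil_of_ne h ha0, hsmul x hx hxρ a ha, N.smul_inv_smul (hg.mapsTo hx) ha0]
  refine ⟨hDB, g, hg, {x | x ∈ N.total ∧ q x < ρ}, ?_, fun b hb => ?_, fun x hx => hx.1, ?_⟩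
  · exact ContinuousOn.isOpen_inter_preimage
      (fun _ hx => (hq.continuousAt hx).continuousWithinAt) N.isOpen_total isOpen_Iio
  · exact ⟨N.base_subset hb, by rwa [(hq.eq_zero_iff b (N.base_subset hb)).2 hb]⟩
  · intro x hx
    rw [hD]
    by_cases hxz : x ∈ N.zone q h
    · have ha := (hq.dampFactor_spec hB hL hLd ht hxz).1
      rw [N.straighten_of_mem L t hxz]
      exact hdil x hx.1 hx.2 _ ⟨by linarith [ha.1], ha.2⟩
    · rw [N.straighten_of_notMem L t hxz]
      exact hEq (hρW x hx.1 hx.2)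

omit ht

theorem straighten_zero : N.straighten q L 0 h = h := by
  funext x
  by_cases hx : x ∈ N.zone q h
  · have h0 : (0 : ℝ) ∈ Icc (0 : ℝ) 1 := ⟨le_rfl, zero_le_one⟩
    rw [N.straighten_of_mem L 0 hx,
      hq.dampFactor_eq hB hL hLd h0 hx (⟨zero_le_one, le_rfl⟩ : (1 : ℝ) ∈ Icc (0 : ℝ) 1)
        (damp_zero _ _)]
    exact N.dil_one hx.1 (hq.map_mem_of_mem_zone hB hx).1
  · exact N.straighten_of_notMem L 0 hx

/-- At the end of the deformation, the diffeomorphism is linear near the base. -/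
theorem straighten_one_mem_diffInvLin {D : M ≃ₘ⟮I, I⟯ M}
    (hD : ⇑D = N.straighten q L 1 h) (hDB : D ∈ diffInv I B) : D ∈ diffInvLin N := by
  have hΛ := hq.one_le_distortion hB
  have he := dampRadius_pos hL hΛ
  have h1 : (1 : ℝ) ∈ Icc (0 : ℝ) 1 := ⟨zero_le_one, le_rfl⟩
  have h0 : (0 : ℝ) ∈ Icc (0 : ℝ) 1 := ⟨le_rfl, zero_le_one⟩
  have hV : IsOpen {x | x ∈ N.total ∧
      q x < dampRadius L (N.distortion q h) ^ 2 / (4 * N.distortion q h)} :=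
    ContinuousOn.isOpen_inter_preimage
      (fun _ hx => (hq.continuousAt hx).continuousWithinAt) N.isOpen_total isOpen_Iio
  refine ⟨hDB, N.dil h 0, N.isAut_dil_zero h.contMDiff h.symm.contMDiff (mapsTo_of_mem_diffInv hB)
    (mapsTo_symm_of_mem_diffInv hB) (fun x => h.symm_apply_apply x) (fun x => h.apply_symm_apply x),
    _, hq.isOpen_zone.inter hV, fun b hb => ⟨hq.base_subset_zone hB hb, N.base_subset hb, ?_⟩,
    fun x hx => hx.1.1, ?_⟩
  · rw [(hq.eq_zero_iff b (N.base_subset hb)).2 hb]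
    positivity
  · rintro x ⟨hxz, -, hxq⟩
    rw [hD, N.straighten_of_mem L 1 hxz, hq.dampFactor_eq hB hL hLd h1 hxz h0]
    rw [damp_of_ge he, sub_self]
    have h2 := (hq.normQuot_bounds hB hxz.1 hxz.2 h0).2.1
    rw [lt_div_iff₀ (by positivity)] at hxq
    linarith

end RegularNeighborhood.IsFibreNormSq

end Deformation

/-! ### Homotopy equivalences of pairs from deformations -/

section Homotopy

/-- A deformation of `Y` into `X` through maps which preserve `X` and `Y₀`. -/
theorem inclusionIsPairHomotopyEquiv_of_deformation {Z : Type*} (tZ : TopologicalSpace Z)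
    {X Y X₀ Y₀ : Set Z} (hXY : X ⊆ Y) (hX₀ : X₀ = X ∩ Y₀) (K : Y × unitInterval → Z)
    (hK : Continuous K) (h0 : ∀ y : Y, K (y, 0) = y) (hY : ∀ y s, K (y, s) ∈ Y)
    (hX : ∀ (y : Y) s, (y : Z) ∈ X → K (y, s) ∈ X)
    (hY₀ : ∀ (y : Y) s, (y : Z) ∈ Y₀ → K (y, s) ∈ Y₀)
    (h1 : ∀ y, K (y, 1) ∈ X) : InclusionIsPairHomotopyEquiv tZ hXY X₀ Y₀ := by
  subst hX₀
  refine ⟨fun x hx => hx.2, ⟨fun y => ⟨K (y, 1), h1 y⟩, by fun_prop⟩,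
    fun y hy => ⟨h1 y, hY₀ y 1 hy⟩, ⟨⟨⟨⟨fun p => ⟨K (inclusion hXY p.2, unitInterval.symm p.1),
      hX _ _ p.2.2⟩, ?_⟩, fun x => ?_, fun x => ?_⟩, fun s x hx => ?_⟩⟩,
    ⟨⟨⟨⟨fun p => ⟨K (p.2, unitInterval.symm p.1), hY _ _⟩, ?_⟩, fun x => ?_, fun x => ?_⟩,
      fun s x hx => ?_⟩⟩⟩
  · have := continuous_inclusion hXY
    fun_prop
  · simp only [unitInterval.symm_zero]
    rfl
  · simp only [unitInterval.symm_one, h0]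
    rfl
  · exact ⟨hX _ _ x.2, hY₀ _ _ hx.2⟩
  · fun_prop
  · simp only [unitInterval.symm_zero]
    rfl
  · simp only [unitInterval.symm_one, h0]
    rfl
  · exact hY₀ _ _ hx

end Homotopy

theorem theorem5p4
    {V : Type*} [NormedAddCommGroup V] [NormedSpace ℝ V] [FiniteDimensional ℝ V]
    {H : Type*} [TopologicalSpace H] (I : ModelWithCorners ℝ V H) (hI : IsHalfSpaceModel I)
    {M : Type*} [TopologicalSpace M] [T2Space M] [SecondCountableTopology M]
    [ChartedSpace H M] [IsManifold I ∞ M]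
    (F : Set (Set M)) (hF : Setoid.IsPartition F)
    (B : Set M) (hB : IsSaturated F B) (N : RegularNeighborhood I B)
    (U : Set M) (hUN : U ⊆ N.total) (hUB : U ∈ 𝓝ˢ B) (hUc : IsCompact U)
    (hhom : N.IsHomogeneous F U)
    (hcl : ∀ L ∈ F, U ∩ (closure L \ L) ⊆ B) :
    InclusionIsPairHomotopyEquiv (weakDiff I M) (diffLP_inter_lin_subset N F)
        (diffLP I F ∩ diffFixLin N) (diffLP I F ∩ diffFix I B) ∧
      InclusionIsPairHomotopyEquiv (strongDiff I M) (diffLP_inter_lin_subset N F)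
        (diffLP I F ∩ diffFixLin N) (diffLP I F ∩ diffFix I B) := by
  obtain ⟨q, hq⟩ := N.exists_isFibreNormSq hUN hUB hUc
  obtain ⟨L, hL, hLd⟩ := exists_abs_deriv_smoothTransition_le
  choose! D hD using fun (h : M ≃ₘ⟮I, I⟯ M) (hh : h ∈ diffInv I B) (t : unitInterval) =>
    hq.exists_diffeomorph_straighten hh hL hLd t.2
  have hDB : ∀ h ∈ diffInv I B, ∀ t, D h t ∈ diffInv I B := by
    intro h hh t
    change D h t '' B = B
    conv_rhs => rw [← show h '' B = B from hh]
    exact image_congr fun b hb => by rw [hD h hh t, hq.straighten_base hh hb]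
  have hLP : ∀ h ∈ diffLP I F ∩ diffInv I B, ∀ t, D h t ∈ diffLP I F := by
    rintro h hh t S hS _ ⟨x, hx, rfl⟩
    rw [hD h hh.2 t]
    exact hq.straighten_mem_leaf hh.2 hL hLd t.2 hF hhom hcl hh.1 hS hx
  have hX₀ : diffLP I F ∩ diffFixLin N =
      (diffLP I F ∩ diffInvLin N) ∩ (diffLP I F ∩ diffFix I B) := by
    ext h
    simp only [diffFixLin, mem_inter_iff]
    tauto
  -- everything but the continuity of the deformation is independent of the topology
  have key : ∀ tZ : TopologicalSpace (M ≃ₘ⟮I, I⟯ M),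
      (Continuous fun p : ↥(diffLP I F ∩ diffInv I B) × unitInterval => D p.1 p.2) →
      InclusionIsPairHomotopyEquiv tZ (diffLP_inter_lin_subset N F)
        (diffLP I F ∩ diffFixLin N) (diffLP I F ∩ diffFix I B) := by
    intro tZ hc
    refine inclusionIsPairHomotopyEquiv_of_deformation tZ _ hX₀ (fun p => D p.1 p.2) hc
      ?_ ?_ ?_ ?_ ?_
    · rintro ⟨h, hh⟩
      refine DFunLike.coe_injective ?_
      change ⇑(D h 0) = h
      rw [hD h hh.2 0]
      exact hq.straighten_zero hh.2 hL hLd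
    · exact fun ⟨h, hh⟩ t => ⟨hLP h hh t, hDB h hh.2 t⟩
    · exact fun ⟨h, hh⟩ t hl => ⟨hLP h hh t, hq.straighten_mem_diffInvLin hh.2 hL hLd t.2 hl.2
        (hD h hh.2 t) (hDB h hh.2 t)⟩
    · refine fun ⟨h, hh⟩ t hf => ⟨hLP h hh t, hDB h hh.2 t, fun b hb => ?_⟩
      change D h t b = b
      rw [hD h hh.2 t, hq.straighten_base hh.2 hb]
      exact hf.2.2 b hb
    · exact fun ⟨h, hh⟩ => ⟨hLP h hh 1, hq.straighten_one_mem_diffInvLin hh.2 hL hLd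
        (hD h hh.2 1) (hDB h hh.2 1)⟩
  have hweak : ∀ [TopologicalSpace (↥(diffLP I F ∩ diffInv I B) × unitInterval)],
      (@Continuous _ _ _ (weakWhitney I I M M)
        fun p : ↥(diffLP I F ∩ diffInv I B) × unitInterval => p.1.1.toContMDiffMap) →
      (Continuous fun p : ↥(diffLP I F ∩ diffInv I B) × unitInterval => p.2) →
      @Continuous _ _ _ (weakWhitney I I M M)
        fun p : ↥(diffLP I F ∩ diffInv I B) × unitInterval => (D p.1 p.2).toContMDiffMap := by
    intro _ hp hp'
    refine continuous_weakWhitney_of_mapFamilyAt fun τ x => ?_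
    have h1 := hq.mapFamilyAt_straighten (h := fun τ => τ.1.1)
      (fun τ x => mapFamilyAt_of_continuous_weakWhitney hp τ x) (fun τ => τ.1.2.2) hL hLd
      (t := fun τ => τ.2) (continuous_subtype_val.comp hp') (fun τ => τ.2.2) τ x
    exact h1.congr (Filter.Eventually.of_forall fun w => congrFun (hD _ w.1.1.2.2 _) w.2)
  constructor
  · refine key _ ?_
    let := weakDiff I M
    have hval : Continuous fun p : ↥(diffLP I F ∩ diffInv I B) × unitInterval => p.1.1 :=
      continuous_subtype_val.comp continuous_fst
    have hd : @Continuous _ _ _ (weakWhitney I I M M)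
        (Diffeomorph.toContMDiffMap : (M ≃ₘ⟮I, I⟯ M) → _) := continuous_induced_dom
    exact continuous_induced_rng.2 (hweak
      (@Continuous.comp _ _ _ _ _ (weakWhitney I I M M) _ _ hd hval) continuous_snd)
  · refine key _ ?_
    let := strongDiff I M
    have hval : Continuous fun p : ↥(diffLP I F ∩ diffInv I B) × unitInterval => p.1.1 :=
      continuous_subtype_val.comp continuous_fst
    have hd : @Continuous _ _ _ (strongWhitney I I M M)
        (Diffeomorph.toContMDiffMap : (M ≃ₘ⟮I, I⟯ M) → _) := continuous_induced_dom
    have hs : @Continuous _ _ _ (strongWhitney I I M M)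
        fun p : ↥(diffLP I F ∩ diffInv I B) × unitInterval => p.1.1.toContMDiffMap :=
      @Continuous.comp _ _ _ _ _ (strongWhitney I I M M) _ _ hd hval
    refine continuous_induced_rng.2 (continuous_strongWhitney_of_weakWhitney
      (hweak (continuous_weakWhitney_of_strongWhitney hs) continuous_snd) hs
      hq.isCompact_disc fun p x hx => ?_)
    exact (congrFun (hD _ p.1.2.2 _) x).trans
      (hq.straighten_eq_of_notMem_disc p.1.2.2 hx)
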